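/- Let $X$ be an oriented smooth manifold of dimension $n$ (Hausdorff, $\sigma$-compact, without boundary), let $Y\subset X$ be a closed embedded submanifold of codimension $m$, and let $\mu\colon X\to\mathbb R_{\ge 0}$ be a nonnegative Morse--Bott function with zero set $Y$: $\mu$ is smooth, vanishes exactly on $Y$, and its Hessian has rank $m$ at every point of $Y$. All differential forms are complex valued. Let $\mathcal A_\mu^p(X)$ be the space of smooth $p$-forms $\omega$ on $X\smallsetminus Y$ such that every point of $X$ has an open neighbourhood $U$ for which, for some integer $N\ge 0$, the form $\mu^N\omega$ on $U\smallsetminus Y$ extends to a smooth form on $U$. With the de Rham differential, $\mathcal A_\mu(X)=\bigoplus_p\mathcal A_\mu^p(X)$ is a complex. Let $\mathcal D^q(X)$ be the space of compactly supported smooth $q$-forms on $X$ with its usual (inductive limit of Fréchet spaces) topology. De Rham currents of degree $p$ are the continuous linear forms on $\mathcal D^{n-p}(X)$; they form the space $\mathcal D'(X)^p$, and $\mathcal D'(X)$ is a complex with differential $$d\kappa(\varphi)=(-1)^{p+1}\kappa(d\varphi),\qquad \kappa\in\mathcal D'(X)^p,\ \varphi\in\mathcal D^{n-p-1}(X).$$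 A current is supported on the closed set $Y$ if it vanishes on all test forms with support in $X\smallsetminus Y$. For a form $\alpha\in\mathcal A_\mu^n(X)$ whose support has compact closure in $X$, let $\zeta(s;\mu,\alpha)$ denote the meromorphic continuation to $s\in\mathbb C$ of the function $\int_X\mu^{s/2}\alpha$, defined for $\operatorname{Re}s$ sufficiently large, and let $I_0(\mu,\alpha)=\operatorname{res}_{s=0}\zeta(s;\mu,\alpha)$. Then for all $p,q\ge 0$ with $p+q=n$, all $\omega\in\mathcal A_\mu^p(X)$ and all $\varphi\in\mathcal D^{q}(X)$ the meromorphic continuation of $\int_X\mu^{s/2}\omega\wedge\varphi$ exists; for every $\omega\in\mathcal A^p_\mu(X)$ the functional $$I_0(\mu,\omega\wedge\text{---})\colon\ \mathcal D^{n-p}(X)\to\mathbb C,\qquad \varphi\mapsto I_0(\mu,\omega\wedge\varphi),$$ is a de Rham current of degree $p$ supported on $Y$; and the map $\omega\mapsto I_0(\mu,\omega\wedge\text{---})$ is a morphism of complexes $\mathcal A_\mu(X)\to\mathcal D'(X)$. -/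

import Mathlib

open scoped Manifold ContDiff Topology
open Set Filter

universe u

noncomputable section

namespace ResidueCurrents

/-! ### Complex-valued differential forms on a smooth manifold -/

/-- The model space `ℝⁿ`. -/
abbrev Euc (n : ℕ) : Type := EuclideanSpace ℝ (Fin n)

/-- Complex-valued differential `p`-forms on the `n`-manifold `X`, with no regularity imposed. -/
abbrev Form (n : ℕ) (X : Type u) [TopologicalSpace X] [ChartedSpace (Euc n) X] (p : ℕ) : Type u :=
  (x : X) → TangentSpace (𝓡 n) x [⋀^Fin p]→L[ℝ] ℂ

section Forms

variable {n : ℕ} {X : Type u} [TopologicalSpace X] [ChartedSpace (Euc n) X] {p q k : ℕ}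

/-- The expression of a form in the chart at `c`: its pull-back by the inverse of that chart.
It is meaningful on the target of the chart. -/
def chartRep (α : Form n X p) (c : X) (z : Euc n) : Euc n [⋀^Fin p]→L[ℝ] ℂ :=
  (α ((extChartAt (𝓡 n) c).symm z)).compContinuousLinearMap
    (mfderiv 𝓘(ℝ, Euc n) (𝓡 n) (extChartAt (𝓡 n) c).symm z)

/-- `α` is smooth at `x` in every chart around `x`. (It is used at all points of open sets.) -/
def SmoothFormAt (α : Form n X p) (x : X) : Prop :=
  ∀ c : X, x ∈ (chartAt (Euc n) c).source →
    ContDiffAt ℝ ∞ (chartRep α c) (extChartAt (𝓡 n) c x)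

/-- The exterior derivative, computed at `x` in the chart at `x`. -/
def formDeriv (α : Form n X p) : Form n X (p + 1) := fun x =>
  (extDeriv (chartRep α x) (extChartAt (𝓡 n) x x)).compContinuousLinearMap
    (mfderiv (𝓡 n) 𝓘(ℝ, Euc n) (extChartAt (𝓡 n) x) x)

/-- The exterior product of two alternating forms (sum over shuffles, without factorials),
with total degree `k = p + q`. -/
def wedgeAt {V : Type*} [AddCommGroup V] [Module ℝ V] [TopologicalSpace V] (h : p + q = k)
    (a : V [⋀^Fin p]→L[ℝ] ℂ) (b : V [⋀^Fin q]→L[ℝ] ℂ) : V [⋀^Fin k]→L[ℝ] ℂ :=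
  { ((LinearMap.mul' ℝ ℂ).compAlternatingMap
      (a.toAlternatingMap.domCoprod b.toAlternatingMap)).domDomCongr
        (finSumFinEquiv.trans (finCongr h)) with
    cont := by
      suffices H : ∀ σ, Continuous fun v : Fin p ⊕ Fin q → V => LinearMap.mul' ℝ ℂ
          (AlternatingMap.domCoprod.summand a.toAlternatingMap b.toAlternatingMap σ v) by
        have h1 : Continuous fun v : Fin p ⊕ Fin q → V => LinearMap.mul' ℝ ℂ
            (a.toAlternatingMap.domCoprod b.toAlternatingMap v) := by
          simp only [AlternatingMap.domCoprod_apply, sum_apply, map_sum]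
          exact continuous_finsetSum _ fun σ _ => H σ
        exact h1.comp (continuous_pi fun i => continuous_apply _)
      intro σ
      induction σ using Quotient.inductionOn' with | _ σ
      simp only [AlternatingMap.domCoprod.summand_mk'', smul_apply,
        MultilinearMap.domDomCongr_apply, MultilinearMap.domCoprod_apply]
      simp only [Units.smul_def, map_zsmul, LinearMap.mul'_apply]
      refine Continuous.const_smul (Continuous.mul ?_ ?_) _
      · exact a.cont.comp (continuous_pi fun i => continuous_apply _)
      · exact b.cont.comp (continuous_pi fun i => continuous_apply _) }

/-- The exterior product of differential forms. -/
def wedge (h : p + q = k) (α : Form n X p) (φ : Form n X q) : Form n X k :=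
  fun x => wedgeAt h (α x) (φ x)

/-! ### Elementary facts on the exterior derivative -/

theorem chartRep_add (α β : Form n X p) (c : X) :
    chartRep (α + β) c = chartRep α c + chartRep β c := rfl

theorem chartRep_smul (a : ℂ) (α : Form n X p) (c : X) :
    chartRep (a • α) c = a • chartRep α c := rfl

theorem chartRep_zero (c : X) : chartRep (0 : Form n X p) c = 0 := rfl

theorem chartRep_congr {α β : Form n X p} {x c : X}
    (h : ∀ᶠ y in 𝓝 x, α y = β y) (hx : x ∈ (chartAt (Euc n) c).source) :
    chartRep α c =ᶠ[𝓝 (extChartAt (𝓡 n) c x)] chartRep β c := by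
  have h1 : Tendsto (extChartAt (𝓡 n) c).symm (𝓝 (extChartAt (𝓡 n) c x)) (𝓝 x) := by
    have := continuousAt_extChartAt_symm' (I := 𝓡 n) (x := c) (x' := x)
      (by rwa [extChartAt_source])
    rw [ContinuousAt, (extChartAt (𝓡 n) c).left_inv (by rwa [extChartAt_source])] at this
    exact this
  filter_upwards [h1.eventually h] with z hz
  simp only [chartRep, hz]

theorem SmoothFormAt.congr {α β : Form n X p} {x : X} (hα : SmoothFormAt α x)
    (h : ∀ᶠ y in 𝓝 x, α y = β y) : SmoothFormAt β x := fun c hc =>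
  (hα c hc).congr_of_eventuallyEq (chartRep_congr h hc).symm

theorem formDeriv_congr {α β : Form n X p} {x : X} (h : ∀ᶠ y in 𝓝 x, α y = β y) :
    formDeriv α x = formDeriv β x := by
  simp only [formDeriv, (chartRep_congr h (mem_chart_source (Euc n) x)).extDeriv_eq]

theorem SmoothFormAt.add {α β : Form n X p} {x : X} (hα : SmoothFormAt α x)
    (hβ : SmoothFormAt β x) : SmoothFormAt (α + β) x := fun c hc => (hα c hc).add (hβ c hc)

theorem SmoothFormAt.smul {α : Form n X p} {x : X} (hα : SmoothFormAt α x) (a : ℂ) :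
    SmoothFormAt (a • α) x := fun c hc => (hα c hc).const_smul a

theorem smoothFormAt_zero (x : X) : SmoothFormAt (0 : Form n X p) x :=
  fun _ _ => contDiffAt_const (c := (0 : Euc n [⋀^Fin p]→L[ℝ] ℂ))

theorem extDeriv_complex_smul (a : ℂ) (f : Euc n → Euc n [⋀^Fin p]→L[ℝ] ℂ) (z : Euc n) 
    (hf : DifferentiableAt ℝ f z) :
    extDeriv (a • f) z = a • extDeriv f z := by
  ext v
  rw [extDeriv, fderiv_const_smul hf]
  change _ = a • (ContinuousAlternatingMap.alternatizeUncurryFin (fderiv ℝ f z) v)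
  rw [ContinuousAlternatingMap.alternatizeUncurryFin_apply,
    ContinuousAlternatingMap.alternatizeUncurryFin_apply, Finset.smul_sum]
  exact Finset.sum_congr rfl fun i _ =>
    smul_comm ((-1 : ℤ) ^ (i : ℕ)) a ((fderiv ℝ f z) (v i) (i.removeNth v))

theorem SmoothFormAt.differentiableAt {α : Form n X p} {x c : X} (hα : SmoothFormAt α x)
    (hc : x ∈ (chartAt (Euc n) c).source) :
    DifferentiableAt ℝ (chartRep α c) (extChartAt (𝓡 n) c x) :=
  (hα c hc).differentiableAt (by simp)

theorem formDeriv_add {α β : Form n X p} {x : X} (hα : SmoothFormAt α x)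
    (hβ : SmoothFormAt β x) : formDeriv (α + β) x = formDeriv α x + formDeriv β x := by
  have hx := mem_chart_source (Euc n) x
  simp only [formDeriv, chartRep_add,
    extDeriv_add (hα.differentiableAt hx) (hβ.differentiableAt hx)]
  rfl

theorem formDeriv_smul {α : Form n X p} {x : X} (hα : SmoothFormAt α x) (a : ℂ) :
    formDeriv (a • α) x = a • formDeriv α x := by
  have hx := mem_chart_source (Euc n) x
  simp only [formDeriv, chartRep_smul, extDeriv_complex_smul a _ _ (hα.differentiableAt hx)]
  rfl

theorem two_le_smooth : minSmoothness ℝ 2 ≤ (∞ : WithTop ℕ∞) := by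
  rw [minSmoothness_of_isRCLikeNormedField]
  exact WithTop.coe_le_coe.2 (le_top (a := (2 : ℕ∞)))

theorem eventually_chart {P : X → Prop} {x c : X} (h : ∀ᶠ y in 𝓝 x, P y)
    (hc : x ∈ (chartAt (Euc n) c).source) :
    ∀ᶠ z in 𝓝 (extChartAt (𝓡 n) c x), ∃ y, P y ∧ y ∈ (chartAt (Euc n) c).source ∧
      z = extChartAt (𝓡 n) c y := by
  have h1 : x ∈ (extChartAt (𝓡 n) c).source := by rwa [extChartAt_source]
  have ht : (extChartAt (𝓡 n) c).target ∈ 𝓝 (extChartAt (𝓡 n) c x) :=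
    extChartAt_target_mem_nhds' ((extChartAt (𝓡 n) c).map_source h1)
  have h3 := continuousAt_extChartAt_symm' (I := 𝓡 n) h1
  rw [ContinuousAt, (extChartAt (𝓡 n) c).left_inv h1] at h3
  filter_upwards [ht, h3.eventually h] with z hz hz'
  refine ⟨_, hz', ?_, ((extChartAt (𝓡 n) c).right_inv hz).symm⟩
  rw [← extChartAt_source (𝓡 n)]
  exact (extChartAt (𝓡 n) c).map_target hz

variable [IsManifold (𝓡 n) ∞ X]

theorem mdifferentiableAt_symm {c : X} {z : Euc n} (hz : z ∈ (extChartAt (𝓡 n) c).target) :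
    MDifferentiableAt 𝓘(ℝ, Euc n) (𝓡 n) (extChartAt (𝓡 n) c).symm z := by
  have : IsManifold (𝓡 n) 1 X := IsManifold.of_le (n := ∞) (by simp)
  have := mdifferentiableWithinAt_extChartAt_symm (I := 𝓡 n) hz
  rwa [ModelWithCorners.range_eq_univ, mdifferentiableWithinAt_univ] at this

theorem contDiffAt_transition {c c' x : X} (hc : x ∈ (chartAt (Euc n) c).source)
    (hc' : x ∈ (chartAt (Euc n) c').source) :
    ContDiffAt ℝ ∞ (extChartAt (𝓡 n) c' ∘ (extChartAt (𝓡 n) c).symm)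
      (extChartAt (𝓡 n) c x) := by
  have := contDiffWithinAt_ext_coord_change (I := 𝓡 n) (n := ∞) c' c
    (y := extChartAt (𝓡 n) c x) (by
      have h1 : x ∈ (extChartAt (𝓡 n) c).source := by rwa [extChartAt_source]
      have h2 : x ∈ (extChartAt (𝓡 n) c').source := by rwa [extChartAt_source]
      rw [PartialEquiv.trans_source]
      refine ⟨(extChartAt (𝓡 n) c).map_source h1, ?_⟩
      rw [mem_preimage, (extChartAt (𝓡 n) c).left_inv h1]
      exact h2)
  simpa [contDiffWithinAt_univ] using this

theorem chartRep_transition (α : Form n X p) {c c' x : X}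
    (hc : x ∈ (chartAt (Euc n) c).source) (hc' : x ∈ (chartAt (Euc n) c').source) :
    chartRep α c =ᶠ[𝓝 (extChartAt (𝓡 n) c x)] fun z =>
      (chartRep α c' ((extChartAt (𝓡 n) c' ∘ (extChartAt (𝓡 n) c).symm) z)).compContinuousLinearMap
        (fderiv ℝ (extChartAt (𝓡 n) c' ∘ (extChartAt (𝓡 n) c).symm) z) := by
  have : IsManifold (𝓡 n) 1 X := IsManifold.of_le (n := ∞) (by simp)
  have h1 : x ∈ (extChartAt (𝓡 n) c).source := by rwa [extChartAt_source]
  have h2 : x ∈ (extChartAt (𝓡 n) c').source := by rwa [extChartAt_source]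
  have ht : (extChartAt (𝓡 n) c).target ∈ 𝓝 (extChartAt (𝓡 n) c x) :=
    extChartAt_target_mem_nhds' ((extChartAt (𝓡 n) c).map_source h1)
  have hs : (extChartAt (𝓡 n) c).symm ⁻¹' (extChartAt (𝓡 n) c').source
      ∈ 𝓝 (extChartAt (𝓡 n) c x) := by
    have h3 := continuousAt_extChartAt_symm' (I := 𝓡 n) h1
    apply h3
    rw [(extChartAt (𝓡 n) c).left_inv h1]
    exact extChartAt_source_mem_nhds' h2
  filter_upwards [eventually_mem_nhds_iff.2 ht, eventually_eventually_nhds.2 hs] with z hz hz'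
  have hzt := mem_of_mem_nhds hz
  have hzs : (extChartAt (𝓡 n) c).symm z ∈ (extChartAt (𝓡 n) c').source := hz'.self_of_nhds
  set τ := extChartAt (𝓡 n) c' ∘ (extChartAt (𝓡 n) c).symm with hτ
  have hback : (extChartAt (𝓡 n) c').symm (τ z) = (extChartAt (𝓡 n) c).symm z :=
    (extChartAt (𝓡 n) c').left_inv hzs
  have hτd : MDifferentiableAt 𝓘(ℝ, Euc n) 𝓘(ℝ, Euc n) τ z :=
    MDifferentiableAt.comp z (mdifferentiableAt_extChartAt (by rwa [extChartAt_source] at hzs))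
      (mdifferentiableAt_symm hzt)
  have hτt : τ z ∈ (extChartAt (𝓡 n) c').target := (extChartAt (𝓡 n) c').map_source hzs
  have hcomp : mfderiv 𝓘(ℝ, Euc n) (𝓡 n) ((extChartAt (𝓡 n) c').symm ∘ τ) z =
      (mfderiv 𝓘(ℝ, Euc n) (𝓡 n) (extChartAt (𝓡 n) c').symm (τ z)).comp
        (mfderiv 𝓘(ℝ, Euc n) 𝓘(ℝ, Euc n) τ z) :=
    mfderiv_comp z (mdifferentiableAt_symm hτt) hτd
  have heq : (extChartAt (𝓡 n) c').symm ∘ τ =ᶠ[𝓝 z] (extChartAt (𝓡 n) c).symm := by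
    filter_upwards [hz'] with y hy
    exact (extChartAt (𝓡 n) c').left_inv hy
  have hder : ∀ v : Euc n,
      (mfderiv 𝓘(ℝ, Euc n) (𝓡 n) (extChartAt (𝓡 n) c).symm z v : Euc n) =
      mfderiv 𝓘(ℝ, Euc n) (𝓡 n) (extChartAt (𝓡 n) c').symm (τ z) (fderiv ℝ τ z v) := by
    intro v
    have h5 := heq.mfderiv_eq (I := 𝓘(ℝ, Euc n)) (I' := 𝓡 n)
    have h6 : (mfderiv 𝓘(ℝ, Euc n) (𝓡 n) ((extChartAt (𝓡 n) c').symm ∘ τ) z v : Euc n) =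
      mfderiv 𝓘(ℝ, Euc n) (𝓡 n) (extChartAt (𝓡 n) c').symm (τ z) (fderiv ℝ τ z v) := by
      rw [hcomp, mfderiv_eq_fderiv]; rfl
    rw [← h6]
    exact (congrArg (fun A : Euc n →L[ℝ] Euc n => A v) h5).symm
  ext v
  let αf : X → (Fin p → Euc n) → ℂ := fun y w => α y w
  change αf ((extChartAt (𝓡 n) c).symm z) _ = αf ((extChartAt (𝓡 n) c').symm (τ z)) _
  rw [hback]
  congr 1
  funext i
  exact hder (v i)

/-- In every chart, the exterior derivative is the exterior derivative on `ℝⁿ`. -/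
theorem chartRep_formDeriv {α : Form n X p} {x c : X} (hα : SmoothFormAt α x)
    (hc : x ∈ (chartAt (Euc n) c).source) :
    chartRep (formDeriv α) c (extChartAt (𝓡 n) c x) =
      extDeriv (chartRep α c) (extChartAt (𝓡 n) c x) := by
  have : IsManifold (𝓡 n) 1 X := IsManifold.of_le (n := ∞) (by simp)
  have hx := mem_chart_source (Euc n) x
  have h1 : x ∈ (extChartAt (𝓡 n) c).source := by rwa [extChartAt_source]
  set τ := extChartAt (𝓡 n) x ∘ (extChartAt (𝓡 n) c).symm with hτ
  have hleft : (extChartAt (𝓡 n) c).symm (extChartAt (𝓡 n) c x) = x :=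
    (extChartAt (𝓡 n) c).left_inv h1
  have hτx : τ (extChartAt (𝓡 n) c x) = extChartAt (𝓡 n) x x := by
    rw [hτ, Function.comp_apply, hleft]
  rw [(chartRep_transition α hc hx).extDeriv_eq, extDeriv_pullback (r := ∞)
    (by rw [← hτ, hτx]; exact hα.differentiableAt hx) (contDiffAt_transition hc hx) two_le_smooth]
  rw [← hτ, hτx]
  have htd : extChartAt (𝓡 n) c x ∈ (extChartAt (𝓡 n) c).target :=
    (extChartAt (𝓡 n) c).map_source h1
  have hcomp : mfderiv 𝓘(ℝ, Euc n) 𝓘(ℝ, Euc n) τ (extChartAt (𝓡 n) c x) =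
      (mfderiv (𝓡 n) 𝓘(ℝ, Euc n) (extChartAt (𝓡 n) x)
        ((extChartAt (𝓡 n) c).symm (extChartAt (𝓡 n) c x))).comp
        (mfderiv 𝓘(ℝ, Euc n) (𝓡 n) (extChartAt (𝓡 n) c).symm (extChartAt (𝓡 n) c x)) :=
    mfderiv_comp _ (mdifferentiableAt_extChartAt (by rw [hleft]; exact hx))
      (mdifferentiableAt_symm htd)
  ext v
  let βf : X → (Fin (p + 1) → Euc n) → ℂ := fun y w => formDeriv α y w
  change βf ((extChartAt (𝓡 n) c).symm (extChartAt (𝓡 n) c x)) _ = _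
  rw [hleft]
  change extDeriv (chartRep α x) (extChartAt (𝓡 n) x x) _ =
    extDeriv (chartRep α x) (extChartAt (𝓡 n) x x) _
  congr 1
  funext i
  let γf : X → Euc n → Euc n := fun y w => mfderiv (𝓡 n) 𝓘(ℝ, Euc n) (extChartAt (𝓡 n) x) y w
  have h7 : (fderiv ℝ τ (extChartAt (𝓡 n) c x) (v i) : Euc n) =
      γf ((extChartAt (𝓡 n) c).symm (extChartAt (𝓡 n) c x))
        (mfderiv 𝓘(ℝ, Euc n) (𝓡 n) (extChartAt (𝓡 n) c).symm (extChartAt (𝓡 n) c x) (v i)) := by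
    rw [← mfderiv_eq_fderiv, hcomp]; rfl
  rw [hleft] at h7
  exact h7.symm

theorem chartRep_formDeriv_eventually {α : Form n X p} {x c : X}
    (hα : ∀ᶠ y in 𝓝 x, SmoothFormAt α y) (hc : x ∈ (chartAt (Euc n) c).source) :
    chartRep (formDeriv α) c =ᶠ[𝓝 (extChartAt (𝓡 n) c x)] extDeriv (chartRep α c) := by
  filter_upwards [eventually_chart hα hc] with z hz
  obtain ⟨y, hy, hyc, rfl⟩ := hz
  exact chartRep_formDeriv hy hyc

theorem contDiffAt_extDeriv {f : Euc n → Euc n [⋀^Fin p]→L[ℝ] ℂ} {z : Euc n}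
    (hf : ContDiffAt ℝ ∞ f z) : ContDiffAt ℝ ∞ (extDeriv f) z :=
  (ContinuousAlternatingMap.alternatizeUncurryFinCLM ℝ (Euc n) ℂ).contDiff.contDiffAt.comp z
    (hf.fderiv_right (by simp))

theorem SmoothFormAt.formDeriv {α : Form n X p} {x : X}
    (hα : ∀ᶠ y in 𝓝 x, SmoothFormAt α y) : SmoothFormAt (formDeriv α) x := fun c hc =>
  (contDiffAt_extDeriv (hα.self_of_nhds c hc)).congr_of_eventuallyEq
    (chartRep_formDeriv_eventually hα hc)

theorem formDeriv_formDeriv {α : Form n X p} {x : X}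
    (hα : ∀ᶠ y in 𝓝 x, SmoothFormAt α y) : formDeriv (formDeriv α) x = 0 := by
  have hx := mem_chart_source (Euc n) x
  rw [ResidueCurrents.formDeriv, (chartRep_formDeriv_eventually hα hx).extDeriv_eq,
    extDeriv_extDeriv_apply (hα.self_of_nhds x hx) two_le_smooth]
  rfl

end Forms

end ResidueCurrents

namespace ResidueCurrents

/-! ### Submanifolds, nonnegative Morse--Bott functions, forms with singularities -/

section Singular

/-- A closed (embedded) submanifold of codimension `m` of the `n`-manifold `X`: near each of its
points it is given by the vanishing of the first `m` coordinates of some smooth chart. -/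
structure ClosedSubmanifold (n m : ℕ) (X : Type u) [TopologicalSpace X]
    [ChartedSpace (Euc n) X] where
  carrier : Set X
  isClosed : IsClosed carrier
  codim_le : m ≤ n
  slice : ∀ y ∈ carrier, ∃ e ∈ IsManifold.maximalAtlas (𝓡 n) ∞ X, y ∈ e.source ∧
    ∀ x ∈ e.source, x ∈ carrier ↔ ∀ i : Fin n, (i : ℕ) < m → (e x) i = 0

variable {n m : ℕ} {X : Type u} [TopologicalSpace X] [ChartedSpace (Euc n) X] {p q : ℕ}

/-- A nonnegative Morse--Bott function with zero set `Y`: at the points of `Y`, which are critical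
points, the rank of the Hessian (computed in a chart) is the codimension of `Y`. -/
structure MorseBott (Y : ClosedSubmanifold n m X) where
  toFun : X → ℝ
  smooth : ContMDiff (𝓡 n) 𝓘(ℝ) ∞ toFun
  nonneg : ∀ x, 0 ≤ toFun x
  eq_zero_iff : ∀ x, toFun x = 0 ↔ x ∈ Y.carrier
  hessian_rank : ∀ x ∈ Y.carrier,
    Module.finrank ℝ (LinearMap.range
      (fderiv ℝ (fderiv ℝ (toFun ∘ (extChartAt (𝓡 n) x).symm))
        (extChartAt (𝓡 n) x x)).toLinearMap) = m

theorem smooth_in_chart [IsManifold (𝓡 n) ∞ X] {f : X → ℝ}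
    (hf : ContMDiff (𝓡 n) 𝓘(ℝ) ∞ f) {x c : X}
    (hc : x ∈ (chartAt (Euc n) c).source) :
    ContDiffAt ℝ ∞ (f ∘ (extChartAt (𝓡 n) c).symm) (extChartAt (𝓡 n) c x) := by
  have h1 : x ∈ (extChartAt (𝓡 n) c).source := by rwa [extChartAt_source]
  have h2 := contMDiffOn_extChartAt_symm (I := 𝓡 n) (n := ∞) c
  have h3 := (hf.comp_contMDiffOn h2).contDiffOn
  exact h3.contDiffAt (extChartAt_target_mem_nhds' ((extChartAt (𝓡 n) c).map_source h1))

theorem SmoothFormAt.funSmul [IsManifold (𝓡 n) ∞ X] {f : X → ℝ} (hf : ContMDiff (𝓡 n) 𝓘(ℝ) ∞ f)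
    {α : Form n X p} {x : X} (hα : SmoothFormAt α x) :
    SmoothFormAt (fun y => f y • α y) x := fun c hc =>
  (smooth_in_chart hf hc).smul (hα c hc)

/-- Leibniz rule for the products of a form with the powers of a function. -/
theorem formDeriv_pow_smul [IsManifold (𝓡 n) ∞ X] {f : X → ℝ}
    (hf : ContMDiff (𝓡 n) 𝓘(ℝ) ∞ f) {α : Form n X p} {x : X} (hα : SmoothFormAt α x) :
    ∃ B : TangentSpace (𝓡 n) x [⋀^Fin (p + 1)]→L[ℝ] ℂ, ∀ N : ℕ,
      formDeriv (fun y => f y ^ N • α y) x =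
        f x ^ N • formDeriv α x + (N * f x ^ (N - 1)) • B := by
  have hx := mem_chart_source (Euc n) x
  set g := f ∘ (extChartAt (𝓡 n) x).symm with hg
  have hgd : DifferentiableAt ℝ g (extChartAt (𝓡 n) x x) :=
    (smooth_in_chart hf hx).differentiableAt (by simp)
  have hgx : g (extChartAt (𝓡 n) x x) = f x := by simp [hg]
  refine ⟨(ContinuousAlternatingMap.alternatizeUncurryFin ((fderiv ℝ g
    (extChartAt (𝓡 n) x x)).smulRight (chartRep α x (extChartAt (𝓡 n) x x)))).compContinuousLinearMap
    (mfderiv (𝓡 n) 𝓘(ℝ, Euc n) (extChartAt (𝓡 n) x) x), fun N => ?_⟩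
  have hrep : chartRep (fun y => f y ^ N • α y) x = (g ^ N) • chartRep α x := rfl
  have hd : extDeriv ((g ^ N) • chartRep α x) (extChartAt (𝓡 n) x x) =
      f x ^ N • extDeriv (chartRep α x) (extChartAt (𝓡 n) x x) +
      (N * f x ^ (N - 1)) • ContinuousAlternatingMap.alternatizeUncurryFin ((fderiv ℝ g
        (extChartAt (𝓡 n) x x)).smulRight (chartRep α x (extChartAt (𝓡 n) x x))) := by
    have h1 : fderiv ℝ ((g ^ N) • chartRep α x) (extChartAt (𝓡 n) x x) =
        f x ^ N • fderiv ℝ (chartRep α x) (extChartAt (𝓡 n) x x) +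
        (N * f x ^ (N - 1)) • (fderiv ℝ g (extChartAt (𝓡 n) x x)).smulRight
          (chartRep α x (extChartAt (𝓡 n) x x)) := by
      rw [fderiv_smul (hgd.pow N) (hα.differentiableAt hx), fderiv_pow N hgd, Pi.pow_apply, hgx]
      ext v w
      simp [mul_assoc]
    rw [extDeriv, h1, ContinuousAlternatingMap.alternatizeUncurryFin_add,
      ContinuousAlternatingMap.alternatizeUncurryFin_smul,
      ContinuousAlternatingMap.alternatizeUncurryFin_smul]
    rfl
  rw [formDeriv, hrep, hd]
  rfl

variable {Y : ClosedSubmanifold n m X}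

/-- The condition that `α` is a section over `X` of the sheaf of forms on `X ∖ Y` that become
smooth on `X` after multiplication by a power of `μ`. A form on `X ∖ Y` is represented by its
extension by zero to `Y`. -/
def IsSingularForm (μ : MorseBott Y) (α : Form n X p) : Prop :=
  (∀ x ∈ Y.carrier, α x = 0) ∧ (∀ x ∉ Y.carrier, SmoothFormAt α x) ∧
    ∀ x, ∃ (N : ℕ) (η : Form n X p), ∀ᶠ y in 𝓝 x,
      SmoothFormAt η y ∧ (y ∉ Y.carrier → η y = μ.toFun y ^ N • α y)

open Classical in
/-- The exterior derivative of a form on `X ∖ Y`, extended by zero to `Y`. -/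
def derivOff (Y : ClosedSubmanifold n m X) (α : Form n X p) : Form n X (p + 1) :=
  fun x => if x ∈ Y.carrier then 0 else formDeriv α x

theorem derivOff_of_mem {α : Form n X p} {x : X} (hx : x ∈ Y.carrier) : derivOff Y α x = 0 :=
  if_pos hx

theorem derivOff_of_notMem {α : Form n X p} {x : X} (hx : x ∉ Y.carrier) :
    derivOff Y α x = formDeriv α x := if_neg hx

theorem eventually_notMem {x : X} (hx : x ∉ Y.carrier) : ∀ᶠ y in 𝓝 x, y ∉ Y.carrier :=
  Y.isClosed.isOpen_compl.mem_nhds hx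

variable [IsManifold (𝓡 n) ∞ X]

/-- The complex vector space of `p`-forms on `X ∖ Y` with singularities of finite order on `Y`. -/
def singularForms (μ : MorseBott Y) (p : ℕ) : Submodule ℂ (Form n X p) where
  carrier := {α | IsSingularForm μ α}
  zero_mem' := ⟨fun _ _ => rfl, fun x _ => smoothFormAt_zero x,
    fun _ => ⟨0, 0, Eventually.of_forall fun y => ⟨smoothFormAt_zero y, fun _ => by simp⟩⟩⟩
  add_mem' := by
    rintro α β ⟨hα0, hα1, hα2⟩ ⟨hβ0, hβ1, hβ2⟩
    refine ⟨fun x hx => ?_, fun x hx => (hα1 x hx).add (hβ1 x hx), fun x => ?_⟩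
    · rw [Pi.add_apply, hα0 x hx, hβ0 x hx, add_zero]
    · obtain ⟨N, η, h⟩ := hα2 x
      obtain ⟨M, θ, h'⟩ := hβ2 x
      refine ⟨N + M, (fun y => μ.toFun y ^ M • η y) + (fun y => μ.toFun y ^ N • θ y), ?_⟩
      filter_upwards [h, h'] with y hy hy'
      refine ⟨(hy.1.funSmul (μ.smooth.pow M)).add (hy'.1.funSmul (μ.smooth.pow N)), fun hyY => ?_⟩
      rw [Pi.add_apply, hy.2 hyY, hy'.2 hyY, Pi.add_apply]
      module
  smul_mem' := by
    rintro a α ⟨hα0, hα1, hα2⟩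
    refine ⟨fun x hx => ?_, fun x hx => (hα1 x hx).smul a, fun x => ?_⟩
    · rw [Pi.smul_apply, hα0 x hx]
      exact smul_zero (A := TangentSpace (𝓡 n) x [⋀^Fin p]→L[ℝ] ℂ) a
    · obtain ⟨N, η, h⟩ := hα2 x
      refine ⟨N, a • η, ?_⟩
      filter_upwards [h] with y hy
      refine ⟨hy.1.smul a, fun hyY => ?_⟩
      rw [Pi.smul_apply, hy.2 hyY, Pi.smul_apply, smul_comm]

theorem IsSingularForm.derivOff {μ : MorseBott Y} {α : Form n X p} (hα : IsSingularForm μ α) :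
    IsSingularForm μ (derivOff Y α) := by
  obtain ⟨_, hα1, hα2⟩ := hα
  refine ⟨fun x hx => derivOff_of_mem hx, fun x hx => ?_, fun x => ?_⟩
  · have h1 : ∀ᶠ y in 𝓝 x, SmoothFormAt α y := (eventually_notMem hx).mono fun y hy => hα1 y hy
    refine (SmoothFormAt.formDeriv h1).congr ?_
    exact (eventually_notMem hx).mono fun y hy => (derivOff_of_notMem hy).symm
  · obtain ⟨N, η, h⟩ := hα2 x
    refine ⟨N + 1, (fun y => ((N + 1 : ℝ) : ℂ) • μ.toFun y • formDeriv η y) -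
      (fun y => ((N : ℝ) : ℂ) • formDeriv (fun z => μ.toFun z • η z) y), ?_⟩
    filter_upwards [eventually_eventually_nhds.2 h] with y hy
    have hs : ∀ᶠ z in 𝓝 y, SmoothFormAt η z := hy.mono fun z hz => hz.1
    refine ⟨?_, fun hyY => ?_⟩
    · rw [sub_eq_add_neg, ← neg_one_smul ℂ]
      exact (((SmoothFormAt.formDeriv hs).funSmul μ.smooth).smul _).add
        (((SmoothFormAt.formDeriv (hs.mono fun z hz => hz.funSmul μ.smooth)).smul _).smul _)
    · have hoff := (eventually_notMem hyY).and hy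
      obtain ⟨B, hB⟩ := formDeriv_pow_smul μ.smooth (hα1 y hyY)
      have h1 : formDeriv η y = formDeriv (fun z => μ.toFun z ^ N • α z) y :=
        formDeriv_congr (hoff.mono fun z hz => hz.2.2 hz.1)
      have h2 : formDeriv (fun z => μ.toFun z • η z) y =
          formDeriv (fun z => μ.toFun z ^ (N + 1) • α z) y :=
        formDeriv_congr (hoff.mono fun z hz => by rw [hz.2.2 hz.1, smul_smul, pow_succ'])
      rw [derivOff_of_notMem hyY, Pi.sub_apply, h1, h2, hB, hB]
      have h3 : (N : ℝ) * μ.toFun y ^ (N - 1) * μ.toFun y = N * μ.toFun y ^ N := by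
        cases N with
        | zero => simp
        | succ N => simp [pow_succ, mul_assoc]
      simp only [Complex.coe_smul, Nat.add_sub_cancel, smul_add, smul_smul]
      rw [show (N + 1 : ℝ) * (μ.toFun y * (N * μ.toFun y ^ (N - 1))) =
        (N + 1) * (N * μ.toFun y ^ N) by rw [← h3]; ring]
      push_cast
      module

/-- The de Rham differential on forms with singularities. -/
def singularD (μ : MorseBott Y) (p : ℕ) : singularForms μ p →ₗ[ℂ] singularForms μ (p + 1) where
  toFun α := ⟨derivOff Y α.1, α.2.derivOff⟩
  map_add' α β := by
    ext1
    funext x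
    by_cases hx : x ∈ Y.carrier
    · change derivOff Y (α.1 + β.1) x = derivOff Y α.1 x + derivOff Y β.1 x
      simp only [derivOff_of_mem hx, add_zero]
    · change derivOff Y (α.1 + β.1) x = derivOff Y α.1 x + derivOff Y β.1 x
      simp only [derivOff_of_notMem hx]
      exact formDeriv_add (α.2.2.1 x hx) (β.2.2.1 x hx)
  map_smul' a α := by
    ext1
    funext x
    by_cases hx : x ∈ Y.carrier
    · change derivOff Y (a • α.1) x = a • derivOff Y α.1 x
      rw [derivOff_of_mem hx, derivOff_of_mem hx]
      exact (smul_zero (A := TangentSpace (𝓡 n) x [⋀^Fin (p + 1)]→L[ℝ] ℂ) a).symm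
    · change derivOff Y (a • α.1) x = a • derivOff Y α.1 x
      simp only [derivOff_of_notMem hx]
      exact formDeriv_smul (α.2.2.1 x hx) a

theorem singularD_comp (μ : MorseBott Y) (p : ℕ) :
    singularD μ (p + 1) ∘ₗ singularD μ p = 0 := by
  ext α : 2
  funext x
  change derivOff Y (derivOff Y α.1) x = 0
  by_cases hx : x ∈ Y.carrier
  · exact derivOff_of_mem hx
  · rw [derivOff_of_notMem hx, formDeriv_congr (β := formDeriv α.1)
      ((eventually_notMem hx).mono fun y hy => derivOff_of_notMem hy)]
    exact formDeriv_formDeriv ((eventually_notMem hx).mono fun y hy => α.2.2.1 y hy)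

/-- The de Rham complex of forms on `X ∖ Y` with singularities of finite order on `Y`. -/
def singularComplex (μ : MorseBott Y) : CochainComplex (ModuleCat.{u} ℂ) ℕ :=
  CochainComplex.of (fun p => ModuleCat.of ℂ (singularForms μ p))
    (fun p => ModuleCat.ofHom (singularD μ p)) fun p => by
      rw [← ModuleCat.ofHom_comp, singularD_comp]; rfl

end Singular

end ResidueCurrents

namespace ResidueCurrents

theorem norm_iteratedFDeriv_extDeriv_le {E : Type*} [NormedAddCommGroup E] [NormedSpace ℝ E]
    {q : ℕ} {f : E → E [⋀^Fin q]→L[ℝ] ℂ} {z : E} (hf : ContDiffAt ℝ ∞ f z) (k : ℕ) :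
    ‖iteratedFDeriv ℝ k (extDeriv f) z‖ ≤ (q + 1) * ‖iteratedFDeriv ℝ (k + 1) f z‖ := by
  have h4 : ContDiffAt ℝ ∞ (fderiv ℝ f) z := hf.fderiv_right (by simp)
  have h5 := ContinuousLinearMap.norm_iteratedFDeriv_comp_left
    (ContinuousAlternatingMap.alternatizeUncurryFinCLM (n := q) ℝ E ℂ) (n := k) h4
    (by exact_mod_cast (le_top : (k : ℕ∞) ≤ ⊤))
  rw [norm_iteratedFDeriv_fderiv] at h5
  exact h5.trans (mul_le_mul_of_nonneg_right
    ContinuousAlternatingMap.norm_alternatizeUncurryFinCLM_le (norm_nonneg _))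

/-! ### Test forms and de Rham currents -/

section Currents

variable {n : ℕ} {X : Type u} [TopologicalSpace X] [ChartedSpace (Euc n) X] {p q : ℕ}

/-- The support of a form. -/
def formSupport (φ : Form n X q) : Set X := closure {x | φ x ≠ 0}

theorem formSupport_formDeriv_subset (φ : Form n X q) :
    formSupport (formDeriv φ) ⊆ formSupport φ := by
  refine closure_minimal (fun x hx => ?_) isClosed_closure
  by_contra hcon
  have h0 : ∀ᶠ y in 𝓝 x, φ y = (0 : Form n X q) y := by
    filter_upwards [isClosed_closure.isOpen_compl.mem_nhds hcon] with y hy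
    by_contra h
    exact hy (subset_closure h)
  apply hx
  rw [formDeriv_congr h0]
  have h1 := formDeriv_add (smoothFormAt_zero (n := n) (p := q) x) (smoothFormAt_zero x)
  rw [add_zero] at h1
  exact left_eq_add.1 h1

variable (n X) in
/-- Smooth compactly supported `q`-forms. -/
def testForms [T2Space X] (q : ℕ) : Submodule ℂ (Form n X q) where
  carrier := {φ | (∀ x, SmoothFormAt φ x) ∧ IsCompact (formSupport φ)}
  zero_mem' := ⟨fun x => smoothFormAt_zero x, by simp [formSupport]⟩
  add_mem' := by
    rintro φ ψ ⟨h1, h2⟩ ⟨h3, h4⟩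
    refine ⟨fun x => (h1 x).add (h3 x), (h2.union h4).of_isClosed_subset isClosed_closure ?_⟩
    rw [formSupport, formSupport, formSupport, ← closure_union]
    refine closure_mono fun x hx => ?_
    by_contra hcon
    simp only [mem_union, mem_ofPred_eq, not_or, not_not] at hcon
    exact hx (by rw [Pi.add_apply, hcon.1, hcon.2, add_zero])
  smul_mem' := by
    rintro a φ ⟨h1, h2⟩
    refine ⟨fun x => (h1 x).smul a, h2.of_isClosed_subset isClosed_closure ?_⟩
    refine closure_mono fun x hx h0 => hx ?_
    rw [Pi.smul_apply, h0]
    exact smul_zero (A := TangentSpace (𝓡 n) x [⋀^Fin q]→L[ℝ] ℂ) a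

variable [T2Space X]

variable (n X) in
/-- The space `𝓓^q(X)` of smooth compactly supported `q`-forms; its topology is defined below. -/
def TestForm (q : ℕ) : Type u := testForms n X q

instance : AddCommGroup (TestForm n X q) := inferInstanceAs (AddCommGroup (testForms n X q))
instance : Module ℂ (TestForm n X q) := inferInstanceAs (Module ℂ (testForms n X q))

/-- The underlying form of a test form. -/
def TestForm.form (φ : TestForm n X q) : Form n X q := Subtype.val (p := (· ∈ testForms n X q)) φ

/-- The supremum over `L` of the norm of the `k`-th derivative of `φ` in the chart at `c`. -/
def chartSeminorm (c : X) (L : Set (Euc n)) (k : ℕ) (φ : TestForm n X q) : ℝ :=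
  ⨆ z : L, ‖iteratedFDeriv ℝ k (chartRep φ.form c) z‖

/-- A seminorm on `𝓓^q(X)` whose restriction to the space `𝓓^q_K(X)` of forms supported in `K` is
continuous for every compact set `K`, where `𝓓^q_K(X)` has the Fréchet topology defined by the
suprema over compact subsets of charts of the derivatives of all orders. -/
def IsAdmissible (P : Seminorm ℂ (TestForm n X q)) : Prop :=
  ∀ K : Set X, IsCompact K →
    ∃ (N : ℕ) (c : Fin N → X) (L : Fin N → Set (Euc n)) (k : Fin N → ℕ) (C : ℝ), 0 ≤ C ∧
      (∀ i, IsCompact (L i) ∧ L i ⊆ (extChartAt (𝓡 n) (c i)).target) ∧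
      ∀ φ : TestForm n X q, formSupport φ.form ⊆ K →
        P φ ≤ C * ∑ i, chartSeminorm (c i) (L i) (k i) φ

theorem chartSeminorm_nonneg (c : X) (L : Set (Euc n)) (k : ℕ) (φ : TestForm n X q) :
    0 ≤ chartSeminorm c L k φ := Real.iSup_nonneg fun _ => norm_nonneg _

variable (n X q) in
/-- The family of all admissible seminorms. -/
def admissibleSeminorms :
    SeminormFamily ℂ (TestForm n X q) {P : Seminorm ℂ (TestForm n X q) // IsAdmissible P} :=
  Subtype.val

instance : Nonempty {P : Seminorm ℂ (TestForm n X q) // IsAdmissible P} :=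
  ⟨0, fun _ _ => ⟨0, Fin.elim0, Fin.elim0, Fin.elim0, 0, le_rfl, fun i => i.elim0, fun _ _ => by
    simp⟩⟩

/-- The topology of `𝓓^q(X)`: the locally convex inductive limit of the Fréchet spaces
`𝓓^q_K(X)`, that is, the locally convex topology whose continuous seminorms are those with
continuous restriction to each `𝓓^q_K(X)`. -/
instance : TopologicalSpace (TestForm n X q) :=
  (admissibleSeminorms n X q).moduleFilterBasis.topology

theorem withSeminorms_testForm : WithSeminorms (admissibleSeminorms n X q) := ⟨rfl⟩

instance : IsTopologicalAddGroup (TestForm n X q) := withSeminorms_testForm.topologicalAddGroup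
instance : ContinuousSMul ℂ (TestForm n X q) := withSeminorms_testForm.continuousSMul

variable [IsManifold (𝓡 n) ∞ X]

variable (n X q) in
/-- The exterior derivative on test forms, as a linear map. -/
def testDLin : TestForm n X q →ₗ[ℂ] TestForm n X (q + 1) where
  toFun φ := ⟨formDeriv φ.form, fun _ => SmoothFormAt.formDeriv (Eventually.of_forall φ.2.1),
    φ.2.2.of_isClosed_subset isClosed_closure (formSupport_formDeriv_subset _)⟩
  map_add' φ ψ := Subtype.ext (funext fun x => formDeriv_add (φ.2.1 x) (ψ.2.1 x))
  map_smul' a φ := Subtype.ext (funext fun x => formDeriv_smul (φ.2.1 x) a)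

theorem chartSeminorm_d_le (c : X) {L : Set (Euc n)} (hL : IsCompact L)
    (hLc : L ⊆ (extChartAt (𝓡 n) c).target) (k : ℕ) (φ : TestForm n X q) :
    chartSeminorm c L k (testDLin n X q φ) ≤
      (q + 1) * chartSeminorm c L (k + 1) φ := by
  have hsm : ∀ z ∈ L, ContDiffAt ℝ ∞ (chartRep φ.form c) z ∧
      chartRep (formDeriv φ.form) c =ᶠ[𝓝 z] extDeriv (chartRep φ.form c) := by
    intro z hz
    have hx : (extChartAt (𝓡 n) c).symm z ∈ (chartAt (Euc n) c).source := by
      rw [← extChartAt_source (𝓡 n)]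
      exact (extChartAt (𝓡 n) c).map_target (hLc hz)
    have h1 := φ.2.1 _ c hx
    have h2 := chartRep_formDeriv_eventually (Eventually.of_forall φ.2.1) hx
    rw [(extChartAt (𝓡 n) c).right_inv (hLc hz)] at h1 h2
    exact ⟨h1, h2⟩
  have hbdd : BddAbove (range fun z : L => ‖iteratedFDeriv ℝ (k + 1) (chartRep φ.form c) z‖) := by
    have hc : ContinuousOn (fun z => ‖iteratedFDeriv ℝ (k + 1) (chartRep φ.form c) z‖) L := by
      intro z hz
      have h3 : ContDiffAt ℝ 0 (iteratedFDeriv ℝ (k + 1) (chartRep φ.form c)) z :=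
        (hsm z hz).1.iteratedFDeriv_right (by
          rw [zero_add]; exact_mod_cast (le_top : ((k + 1 : ℕ) : ℕ∞) ≤ ⊤))
      exact h3.continuousAt.norm.continuousWithinAt
    have := (hL.image_of_continuousOn hc).bddAbove
    rwa [image_eq_range] at this
  refine Real.iSup_le (fun z => ?_)
    (mul_nonneg (by positivity) (chartSeminorm_nonneg c L (k + 1) φ))
  obtain ⟨h1, h2⟩ := hsm z z.2
  change ‖iteratedFDeriv ℝ k (chartRep (formDeriv φ.form) c) z‖ ≤ _
  rw [(h2.iteratedFDeriv ℝ k).self_of_nhds]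
  refine (norm_iteratedFDeriv_extDeriv_le h1 k).trans ?_
  exact mul_le_mul_of_nonneg_left (le_ciSup hbdd z) (by positivity)

theorem IsAdmissible.comp_d {P : Seminorm ℂ (TestForm n X (q + 1))} (hP : IsAdmissible P) :
    IsAdmissible (P.comp (testDLin n X q)) := by
  intro K hK
  obtain ⟨N, c, L, k, C, hC, hL, h⟩ := hP K hK
  refine ⟨N, c, L, fun i => k i + 1, C * (q + 1), mul_nonneg hC (by positivity), hL,
    fun φ hφ => ?_⟩
  have h1 : P (testDLin n X q φ) ≤ _ :=
    h (testDLin n X q φ) ((formSupport_formDeriv_subset φ.form).trans hφ)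
  refine h1.trans ?_
  rw [mul_assoc, Finset.mul_sum _ _ ((q : ℝ) + 1)]
  exact mul_le_mul_of_nonneg_left (Finset.sum_le_sum fun i _ =>
    chartSeminorm_d_le (c i) (hL i).1 (hL i).2 (k i) φ) hC

theorem continuous_testDLin : Continuous (testDLin n X q) := by
  refine withSeminorms_testForm.continuous_of_continuous_comp (testDLin n X q) fun i => ?_
  exact withSeminorms_testForm.continuous_seminorm ⟨i.1.comp (testDLin n X q), i.2.comp_d⟩

variable (n X q) in
/-- The exterior derivative `𝓓^q(X) → 𝓓^{q+1}(X)` as a continuous linear map. -/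
def testD : TestForm n X q →L[ℂ] TestForm n X (q + 1) where
  toLinearMap := testDLin n X q
  cont := continuous_testDLin

theorem testD_comp : (testD n X (q + 1)).comp (testD n X q) = 0 := by
  ext φ
  exact Subtype.ext (funext fun x => formDeriv_formDeriv (Eventually.of_forall φ.2.1))

variable (n X) in
/-- De Rham currents of degree `p`: continuous linear forms on `𝓓^{n-p}(X)`. (The index ranges over
the at most one `q` with `p + q = n`; for `p > n` the space is zero.) -/
abbrev Current (p : ℕ) : Type u := (q : {q : ℕ // p + q = n}) → (TestForm n X q →L[ℂ] ℂ)

/-- A current is supported on the closed set `Y` if it vanishes on all test forms with support in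
the complement of `Y`. -/
def SupportedOn (κ : Current n X p) (Y : Set X) : Prop :=
  ∀ (q : {q : ℕ // p + q = n}) (φ : TestForm n X q), formSupport φ.form ⊆ Yᶜ → κ q φ = 0

variable (n X) in
/-- The differential of currents, `(dκ)(φ) = (-1)^{p+1} κ(dφ)` for `κ` of degree `p`. -/
def currentD (p : ℕ) : Current n X p →ₗ[ℂ] Current n X (p + 1) where
  toFun κ := fun q => (-1 : ℂ) ^ (p + 1) • (κ ⟨q + 1, by have := q.2; omega⟩).comp (testD n X q)
  map_add' κ κ' := by
    funext q
    ext φ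
    simp
  map_smul' a κ := by
    funext q
    ext φ
    simp only [Pi.smul_apply, ContinuousLinearMap.comp_apply, smul_apply, RingHom.id_apply,
      smul_eq_mul]
    ring

theorem currentD_comp (p : ℕ) : currentD n X (p + 1) ∘ₗ currentD n X p = 0 := by
  ext κ q φ
  change (-1 : ℂ) ^ (p + 1 + 1) * ((-1 : ℂ) ^ (p + 1) *
    κ ⟨q + 1 + 1, _⟩ ((testD n X (q + 1)).comp (testD n X q) φ)) = 0
  rw [testD_comp]
  simp

variable (n X) in
/-- The complex `𝓓'(X)` of de Rham currents. -/
def currentComplex : CochainComplex (ModuleCat.{u} ℂ) ℕ :=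
  CochainComplex.of (fun p => ModuleCat.of ℂ (Current n X p))
    (fun p => ModuleCat.ofHom (currentD n X p)) fun p => by
      rw [← ModuleCat.ofHom_comp, currentD_comp]; rfl

end Currents

/-! ### Orientation, integration, the zeta function and its residue -/

section Integration

open MeasureTheory

variable {n : ℕ} {X : Type u} [TopologicalSpace X] [ChartedSpace (Euc n) X]

/-- The sign (`1` or `-1`) of the coordinate frame of the chart at `c`, at the point with
coordinates `z`, with respect to a choice of orientations of the tangent spaces. -/
def frameSign (o : (x : X) → Orientation ℝ (TangentSpace (𝓡 n) x) (Fin n)) (c : X) (z : Euc n) :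
    ℝ :=
  if 0 < (o ((extChartAt (𝓡 n) c).symm z)).someVector fun i : Fin n =>
    mfderiv 𝓘(ℝ, Euc n) (𝓡 n) (extChartAt (𝓡 n) c).symm z (EuclideanSpace.single i (1 : ℝ))
  then 1 else -1

variable (n X) in
/-- An orientation of `X`: orientations of the tangent spaces that vary continuously, that is,
for which the sign of each coordinate frame is locally constant. -/
structure ManifoldOrientation where
  orient : (x : X) → Orientation ℝ (TangentSpace (𝓡 n) x) (Fin n)
  locallyConstant : ∀ c : X, ∀ z ∈ (extChartAt (𝓡 n) c).target,
    ∀ᶠ w in 𝓝 z, frameSign orient c w = frameSign orient c z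

variable [T2Space X] [SigmaCompactSpace X] [IsManifold (𝓡 n) ∞ X]

variable (n X) in
/-- A smooth partition of unity subordinate to the covering of `X` by the chart domains. -/
def chartPartition : SmoothPartitionOfUnity X (𝓡 n) X univ :=
  Classical.choose (SmoothPartitionOfUnity.exists_isSubordinate_chartAt_source (𝓡 n) X)

/-- The integral over the oriented manifold `X` of a compactly supported form of top degree. -/
def formIntegral (o : ManifoldOrientation n X) (α : Form n X n) : ℂ :=
  ∑ᶠ c : X, ∫ z in (extChartAt (𝓡 n) c).target,
    ((chartPartition n X c ((extChartAt (𝓡 n) c).symm z) * frameSign o.orient c z : ℝ) : ℂ) *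
      chartRep α c z fun i => EuclideanSpace.single i (1 : ℝ)

/-- `Z` is a meromorphic continuation to `ℂ` of `ζ(s; μ, α) = ∫_X μ^{s/2} α`, `Re s ≫ 0`. -/
def IsZetaContinuation (o : ManifoldOrientation n X) (μ : X → ℝ) (α : Form n X n) (Z : ℂ → ℂ) :
    Prop :=
  (∀ s, MeromorphicAt Z s) ∧ ∃ R : ℝ, ∀ s : ℂ, R < s.re →
    Z s = formIntegral o fun x => ((μ x : ℂ) ^ (s / 2)) • α x

/-- The residue of `f` at an isolated singularity `a`. -/
def residue (f : ℂ → ℂ) (a : ℂ) : ℂ :=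
  limUnder (𝓝[>] (0 : ℝ)) fun r => (2 * Real.pi * Complex.I)⁻¹ * ∮ z in C(a, r), f z

open Classical in
/-- `I₀(μ, α)`: the residue at `0` of the meromorphically continued zeta function. -/
def I0 (o : ManifoldOrientation n X) (μ : X → ℝ) (α : Form n X n) : ℂ :=
  if h : ∃ Z, IsZetaContinuation o μ α Z then residue h.choose 0 else 0

end Integration

end ResidueCurrents

end

open ResidueCurrents

/-!
# Residue currents of forms with singularities along a submanifold

Integration by parts against the Euler vector field of the normal directions continues the zeta
function. Near a point of `Y` there are coordinates in which `Y` is the vanishing of `x₁, …, x_m`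
(`MorseBott.exists_sliceChart`), and since the Hessian has rank `m`, `μ` is bounded below by a
multiple of `x₁ ^ 2 + ⋯ + x_m ^ 2` (`exists_quadratic_lower_bound`). Let
`E = x₁ ∂₁ + ⋯ + x_m ∂_m`, whose divergence is `m`. On functions vanishing to order `j` along `Y`,
`E - j` raises the order of vanishing by one (`VanOrd.euler`); in particular the remainder
`ρ = E μ - 2 μ` vanishes to order three. Hence, for a compactly supported `f` vanishing to order
`j`, integration by parts (`VanFam.integral_euler`) gives
`(2 w + m + j) ∫ μ ^ w f = - ∫ μ ^ w (E f - j f) - w ∫ μ ^ (w - 1) ρ f`.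
In both terms on the right the order of vanishing plus twice the exponent has grown by one, and the
lower bound for `μ` makes `∫ μ ^ w f` converge as soon as `2 Re w + j > 0`. Iteration
(`VanFam.exists_continuation`) gives the meromorphic continuation without any resolution or normal
form of `μ`: it is a holomorphic function divided by a product of distinct linear factors, so poles
are simple, and at `0` the residue is bounded on families of functions whose derivatives are bounded
in each order. Partitions of unity carry this to `X` (`zetaFam_chart`, `exists_bounded_residue`).

* Linearity of `I₀` follows from uniqueness of continuation (`HasSimpleResidue.unique`).
* Continuity (`isAdmissible_residueLin`): a seminorm on test forms that is bounded on each sequence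
  with supports in a compact set and bounded derivatives is continuous.
* Support: away from `Y` the zeta function is entire (`zeta_of_pos`).
* Compatibility with `d` (`I0_stokes`): for `Re s` large, `μ ^ (s / 2) α ∧ φ` is continuously
  differentiable, so the integral of its differential vanishes. By the Leibniz rule this is the
  integral of `μ ^ (s / 2) (dα ∧ φ + (-1) ^ p α ∧ dφ + (s / 2) μ⁻¹ dμ ∧ α ∧ φ)`. The form
  `μ⁻¹ dμ ∧ α` again has singularities of finite order, so the zeta function of the last term has a simple pole times
  `s`, hence residue `0`, and `I₀(dα ∧ φ) = - (-1) ^ p I₀(α ∧ dφ)`. For test forms supported in a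
  chart this is a computation on `ℝⁿ` (`I0_stokes_of_chart`), for which the integral over `X`,
  defined by a fixed partition of unity, is expressed in one chart (`zetaFun_wedge_eq_integral`).
-/

noncomputable section

namespace ResidueCurrents

/-! ### Meromorphic continuation and residues at simple poles -/

/-- `Z` is a meromorphic continuation to the half-plane `Re s > -k` of a function `F`, of which only
the values for `Re s` sufficiently large matter. -/
def IsHalfPlaneContinuation (F : ℂ → ℂ) (k : ℕ) (Z : ℂ → ℂ) : Prop :=
  (∀ s : ℂ, -(k : ℝ) < s.re → MeromorphicAt Z s) ∧ ∃ R : ℝ, ∀ s : ℂ, R < s.re → Z s = F s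

/-- `F` has meromorphic continuations to all half-planes, with at most a simple pole at `0`, and the
residue there is `a`. -/
def HasSimpleResidue (F : ℂ → ℂ) (a : ℂ) : Prop :=
  (∀ k, ∃ Z, IsHalfPlaneContinuation F k Z) ∧
    ∃ Z, IsHalfPlaneContinuation F 1 Z ∧
      ∃ A : ℂ → ℂ, AnalyticAt ℂ A 0 ∧ A 0 = a ∧ ∀ᶠ s in 𝓝[≠] (0 : ℂ), Z s = A s / s

theorem isPreconnected_re_gt (r : ℝ) : IsPreconnected {s : ℂ | r < s.re} :=
  (convex_halfSpace_re_gt r).isPreconnected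

/-- Identity theorem: two meromorphic continuations agree near each point of their common
half-plane, except perhaps at that point. -/
theorem IsHalfPlaneContinuation.eventuallyEq {F Z Z' : ℂ → ℂ} {k k' : ℕ}
    (h : IsHalfPlaneContinuation F k Z) (h' : IsHalfPlaneContinuation F k' Z') {s : ℂ}
    (hs : -(k : ℝ) < s.re) (hs' : -(k' : ℝ) < s.re) : Z =ᶠ[𝓝[≠] s] Z' := by
  obtain ⟨hm, R, hR⟩ := h
  obtain ⟨hm', R', hR'⟩ := h'
  set r : ℝ := max (-(k : ℝ)) (-(k' : ℝ)) with hr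
  have hU : MeromorphicOn (Z - Z') {s : ℂ | r < s.re} := fun z hz =>
    (hm z (lt_of_le_of_lt (le_max_left _ _) hz)).sub (hm' z (lt_of_le_of_lt (le_max_right _ _) hz))
  set t : ℝ := max (max R R') r + 1 with ht
  have htt : meromorphicOrderAt (Z - Z') (t : ℂ) = ⊤ := by
    rw [meromorphicOrderAt_eq_top_iff]
    refine Filter.Eventually.filter_mono nhdsWithin_le_nhds ?_
    have hop : IsOpen {s : ℂ | max R R' < s.re} := isOpen_lt continuous_const Complex.continuous_re
    have htm : (t : ℂ) ∈ {s : ℂ | max R R' < s.re} := by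
      simp only [mem_ofPred_eq, Complex.ofReal_re]
      exact lt_of_le_of_lt (le_max_left _ _) (lt_add_one _)
    filter_upwards [hop.mem_nhds htm] with z hz
    rw [Pi.sub_apply, hR z (lt_of_le_of_lt (le_max_left _ _) hz),
      hR' z (lt_of_le_of_lt (le_max_right _ _) hz), sub_self]
  have hst : meromorphicOrderAt (Z - Z') s = ⊤ := by
    by_contra hcon
    refine hU.meromorphicOrderAt_ne_top_of_isPreconnected (isPreconnected_re_gt r) (x := s)
      (y := (t : ℂ)) (max_lt hs hs') ?_ hcon htt
    simp only [mem_ofPred_eq, Complex.ofReal_re]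
    exact lt_of_le_of_lt (le_max_right _ _) (lt_add_one _)
  rw [meromorphicOrderAt_eq_top_iff] at hst
  filter_upwards [hst] with z hz
  exact sub_eq_zero.1 hz

theorem eq_of_div_eventuallyEq {A B : ℂ → ℂ} (hA : ContinuousAt A 0) (hB : ContinuousAt B 0)
    (h : ∀ᶠ s in 𝓝[≠] (0 : ℂ), A s / s = B s / s) : A 0 = B 0 := by
  have h1 : A =ᶠ[𝓝[≠] (0 : ℂ)] B := by
    filter_upwards [h, self_mem_nhdsWithin] with s hs hs0
    exact (div_left_inj' hs0).1 hs
  exact tendsto_nhds_unique ((hA.tendsto.mono_left nhdsWithin_le_nhds).congr' h1)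
    (hB.tendsto.mono_left nhdsWithin_le_nhds)

theorem HasSimpleResidue.unique {F : ℂ → ℂ} {a b : ℂ} (ha : HasSimpleResidue F a)
    (hb : HasSimpleResidue F b) : a = b := by
  obtain ⟨-, Z, hZ, A, hA, rfl, hZA⟩ := ha
  obtain ⟨-, Z', hZ', B, hB, rfl, hZB⟩ := hb
  refine eq_of_div_eventuallyEq hA.continuousAt hB.continuousAt ?_
  have h := hZ.eventuallyEq hZ' (s := 0) (by simp) (by simp)
  filter_upwards [h, hZA, hZB] with s h1 h2 h3
  rw [← h2, ← h3, h1]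

theorem IsHalfPlaneContinuation.congr {F G Z : ℂ → ℂ} {k : ℕ} {R : ℝ}
    (h : IsHalfPlaneContinuation F k Z) (hFG : ∀ s : ℂ, R < s.re → F s = G s) :
    IsHalfPlaneContinuation G k Z := by
  obtain ⟨hm, R', hR'⟩ := h
  refine ⟨hm, max R R', fun s hs => ?_⟩
  rw [hR' s (lt_of_le_of_lt (le_max_right _ _) hs), hFG s (lt_of_le_of_lt (le_max_left _ _) hs)]

theorem HasSimpleResidue.congr {F G : ℂ → ℂ} {a : ℂ} {R : ℝ} (h : HasSimpleResidue F a)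
    (hFG : ∀ s : ℂ, R < s.re → F s = G s) : HasSimpleResidue G a := by
  obtain ⟨h1, Z, hZ, h2⟩ := h
  exact ⟨fun k => (h1 k).imp fun Z hZ => hZ.congr hFG, Z, hZ.congr hFG, h2⟩

theorem IsHalfPlaneContinuation.add {F G Z W : ℂ → ℂ} {k : ℕ}
    (h : IsHalfPlaneContinuation F k Z) (h' : IsHalfPlaneContinuation G k W) :
    IsHalfPlaneContinuation (F + G) k (Z + W) := by
  obtain ⟨hm, R, hR⟩ := h
  obtain ⟨hm', R', hR'⟩ := h'
  refine ⟨fun s hs => (hm s hs).add (hm' s hs), max R R', fun s hs => ?_⟩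
  rw [Pi.add_apply, Pi.add_apply, hR s (lt_of_le_of_lt (le_max_left _ _) hs),
    hR' s (lt_of_le_of_lt (le_max_right _ _) hs)]

theorem HasSimpleResidue.add {F G : ℂ → ℂ} {a b : ℂ} (h : HasSimpleResidue F a)
    (h' : HasSimpleResidue G b) : HasSimpleResidue (F + G) (a + b) := by
  obtain ⟨h1, Z, hZ, A, hA, rfl, hZA⟩ := h
  obtain ⟨h1', W, hW, B, hB, rfl, hWB⟩ := h'
  refine ⟨fun k => ?_, Z + W, hZ.add hW, A + B, hA.add hB, rfl, ?_⟩
  · obtain ⟨Z, hZ⟩ := h1 k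
    obtain ⟨W, hW⟩ := h1' k
    exact ⟨Z + W, hZ.add hW⟩
  · filter_upwards [hZA, hWB] with s h2 h3
    rw [Pi.add_apply, Pi.add_apply, h2, h3, add_div]

theorem IsHalfPlaneContinuation.mul {F Z : ℂ → ℂ} {k : ℕ} (h : IsHalfPlaneContinuation F k Z)
    {c : ℂ → ℂ} (hc : ∀ s, AnalyticAt ℂ c s) :
    IsHalfPlaneContinuation (fun s => c s * F s) k (fun s => c s * Z s) := by
  obtain ⟨hm, R, hR⟩ := h
  exact ⟨fun s hs => (hc s).meromorphicAt.mul (hm s hs), R, fun s hs => by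
    simp only [hR s hs]⟩

theorem HasSimpleResidue.mul {F : ℂ → ℂ} {a : ℂ} (h : HasSimpleResidue F a)
    {c : ℂ → ℂ} (hc : ∀ s, AnalyticAt ℂ c s) :
    HasSimpleResidue (fun s => c s * F s) (c 0 * a) := by
  obtain ⟨h1, Z, hZ, A, hA, rfl, hZA⟩ := h
  refine ⟨fun k => ?_, _, hZ.mul hc, fun s => c s * A s, (hc 0).mul hA, rfl, ?_⟩
  · obtain ⟨Z, hZ⟩ := h1 k
    exact ⟨_, hZ.mul hc⟩
  · filter_upwards [hZA] with s h2
    rw [h2, mul_div_assoc]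

theorem HasSimpleResidue.const_mul {F : ℂ → ℂ} {a : ℂ} (h : HasSimpleResidue F a) (c : ℂ) :
    HasSimpleResidue (fun s => c * F s) (c * a) :=
  h.mul (c := fun _ => c) fun _ => analyticAt_const

theorem hasSimpleResidue_zero : HasSimpleResidue 0 0 := by
  have h : ∀ k, IsHalfPlaneContinuation 0 k 0 := fun k =>
    ⟨fun s _ => MeromorphicAt.const 0 s, 0, fun _ _ => rfl⟩
  exact ⟨fun k => ⟨0, h k⟩, 0, h 1, 0, analyticAt_const, rfl, Eventually.of_forall fun s => by simp⟩

theorem HasSimpleResidue.sum {ι : Type*} (S : Finset ι) {F : ι → ℂ → ℂ} {a : ι → ℂ}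
    (h : ∀ i ∈ S, HasSimpleResidue (F i) (a i)) :
    HasSimpleResidue (fun s => ∑ i ∈ S, F i s) (∑ i ∈ S, a i) := by
  classical
  induction S using Finset.induction_on with
  | empty =>
    simp only [Finset.sum_empty]
    exact hasSimpleResidue_zero
  | insert i S hi ih =>
    have := (h i (Finset.mem_insert_self i S)).add
      (ih fun j hj => h j (Finset.mem_insert_of_mem hj))
    simp only [Finset.sum_insert hi]
    exact this

/-- The continuations to the half-planes `Re s > -k` glue to a meromorphic function on `ℂ`. -/
theorem exists_meromorphic_of_halfPlanes {F : ℂ → ℂ}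
    (h : ∀ k, ∃ Z, IsHalfPlaneContinuation F k Z) :
    ∃ Z : ℂ → ℂ, (∀ s, MeromorphicAt Z s) ∧ ∃ R : ℝ, ∀ s : ℂ, R < s.re → Z s = F s := by
  choose Z hZ using h
  -- The margin `2` keeps a neighbourhood of `s` in the half-plane of index `κ s`.
  set κ : ℂ → ℕ := fun s => ⌈-s.re⌉₊ + 2 with hκ
  have hκlt : ∀ s : ℂ, -(κ s : ℝ) + 1 < s.re := fun s => by
    have h1 := Nat.le_ceil (-s.re)
    simp only [hκ]
    push_cast
    linarith
  refine ⟨fun s => Z (κ s) s, fun s => ?_, ?_⟩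
  · set k := κ s + 1 with hk
    refine ((hZ k).1 s (by have := hκlt s; simp only [hk]; push_cast; linarith)).congr ?_
    have hall : ∀ᶠ z in 𝓝[≠] s, ∀ j ∈ Finset.range (k + 1), κ z = j → Z k z = Z j z := by
      rw [Filter.eventually_all_finset]
      intro j hj
      by_cases hs : -(j : ℝ) < s.re
      · have hks : -(k : ℝ) < s.re := by
          have := hκlt s; simp only [hk]; push_cast; linarith
        filter_upwards [(hZ k).eventuallyEq (hZ j) hks hs] with z hz _
        exact hz
      · have : ∀ᶠ z in 𝓝 s, z.re < -(j : ℝ) + 1 :=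
          Complex.continuous_re.continuousAt.eventually (gt_mem_nhds (by linarith))
        filter_upwards [this.filter_mono nhdsWithin_le_nhds] with z hz hzj
        have := hκlt z
        rw [hzj] at this
        linarith
    have hle : ∀ᶠ z in 𝓝 s, s.re - 1 < z.re :=
      Complex.continuous_re.continuousAt.eventually (lt_mem_nhds (by linarith))
    filter_upwards [hall, hle.filter_mono nhdsWithin_le_nhds] with z hz hz1
    refine hz (κ z) ?_ rfl
    rw [Finset.mem_range, hk]
    have h2 : ⌈-z.re⌉₊ ≤ ⌈-s.re⌉₊ + 1 := by
      refine Nat.ceil_le.2 ?_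
      have := Nat.le_ceil (-s.re)
      push_cast
      linarith
    simp only [hκ]
    omega
  · obtain ⟨R, hR⟩ := (hZ 2).2
    refine ⟨max R 0, fun s hs => ?_⟩
    have h0 : 0 < s.re := lt_of_le_of_lt (le_max_right _ _) hs
    have hκs : κ s = 2 := by
      simp only [hκ, Nat.add_eq_right]
      exact Nat.ceil_eq_zero.2 (by linarith)
    change Z (κ s) s = F s
    rw [hκs]
    exact hR s (lt_of_le_of_lt (le_max_left _ _) hs)

/-- The contour integrals defining the residue have, for small radii, the value given by Cauchy's
formula. -/
theorem residue_eq_of_simple {f A : ℂ → ℂ} (hA : AnalyticAt ℂ A 0)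
    (h : ∀ᶠ s in 𝓝[≠] (0 : ℂ), f s = A s / s) : residue f 0 = A 0 := by
  have hd : ∀ᶠ s in 𝓝 (0 : ℂ), DifferentiableAt ℂ A s :=
    hA.eventually_analyticAt.mono fun s hs => hs.differentiableAt
  rw [eventually_nhdsWithin_iff] at h
  obtain ⟨ε, hε, hball⟩ := Metric.eventually_nhds_iff.1 (h.and hd)
  refine Tendsto.limUnder_eq (tendsto_const_nhds.congr' ?_)
  filter_upwards [Ioo_mem_nhdsGT hε] with r hr
  have h1 : (∮ z in C((0 : ℂ), r), f z) = ∮ z in C((0 : ℂ), r), (z - 0)⁻¹ • A z := by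
    refine circleIntegral.integral_congr hr.1.le fun z hz => ?_
    have hz' : dist z 0 = r := hz
    have hz0 : z ≠ 0 := by
      rintro rfl
      rw [dist_self] at hz'
      exact hr.1.ne hz'
    rw [(hball (y := z) (by rw [hz']; exact hr.2)).1 hz0, sub_zero, smul_eq_mul]
    ring
  have hdr : ∀ z ∈ Metric.closedBall (0 : ℂ) r, DifferentiableAt ℂ A z := fun z hz =>
    (hball (lt_of_le_of_lt (Metric.mem_closedBall.1 hz) hr.2)).2
  rw [h1, Complex.circleIntegral_sub_inv_smul_of_differentiable_on_off_countable
    Set.countable_empty (Metric.mem_ball_self hr.1)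
    (fun z hz => (hdr z hz).continuousAt.continuousWithinAt)
    (fun z hz => hdr z (Metric.ball_subset_closedBall hz.1)), smul_eq_mul, ← mul_assoc,
    inv_mul_cancel₀ Complex.two_pi_I_ne_zero, one_mul]

/-- By the identity theorem, every meromorphic continuation has the same residue. -/
theorem HasSimpleResidue.residue_eq {F Z : ℂ → ℂ} {a : ℂ} (h : HasSimpleResidue F a)
    (hZ : ∀ s, MeromorphicAt Z s) {R : ℝ} (hR : ∀ s : ℂ, R < s.re → Z s = F s) :
    residue Z 0 = a := by
  obtain ⟨-, W, hW, A, hA, rfl, hWA⟩ := h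
  have hZ1 : IsHalfPlaneContinuation F 1 Z := ⟨fun s _ => hZ s, R, hR⟩
  refine residue_eq_of_simple hA ?_
  filter_upwards [hZ1.eventuallyEq hW (s := 0) (by simp) (by simp), hWA] with s h1 h2
  rw [h1, h2]

/-- A factor `s` cancels a simple pole at `0`. -/
theorem HasSimpleResidue.id_mul {F : ℂ → ℂ} {a : ℂ} (h : HasSimpleResidue F a) :
    HasSimpleResidue (fun s => s * F s) 0 := by
  simpa using h.mul (c := fun s => s) fun s => analyticAt_id

/-- A function with holomorphic extensions to all half-planes has residue `0` at `0`. -/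
theorem hasSimpleResidue_of_analytic {F : ℂ → ℂ} (hF : ∀ s, AnalyticAt ℂ F s) :
    HasSimpleResidue F 0 := by
  have h : ∀ k, IsHalfPlaneContinuation F k F := fun k =>
    ⟨fun s _ => (hF s).meromorphicAt, 0, fun _ _ => rfl⟩
  refine ⟨fun k => ⟨F, h k⟩, F, h 1, fun s => s * F s, analyticAt_id.mul (hF 0), by simp, ?_⟩
  filter_upwards [self_mem_nhdsWithin] with s hs
  rw [mul_div_cancel_left₀ _ hs]

/-- At `0`, the product of a finite number of distinct factors `(s + d + i)⁻¹` has at most a simple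
pole. -/
theorem exists_analyticAt_div_prod (d : ℤ) (k : ℕ) :
    ∃ q : ℂ → ℂ, AnalyticAt ℂ q 0 ∧
      ∀ᶠ s in 𝓝[≠] (0 : ℂ), (∏ i ∈ Finset.range k, (s + (d : ℂ) + (i : ℂ)))⁻¹ = q s / s := by
  have hfac : ∀ i : ℕ, (d + i : ℤ) ≠ 0 → AnalyticAt ℂ (fun s : ℂ => (s + d + i)⁻¹) 0 := by
    intro i hi
    refine AnalyticAt.inv (by fun_prop) ?_
    rw [zero_add]
    exact_mod_cast hi
  by_cases h : ∃ i ∈ Finset.range k, (d + i : ℤ) = 0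
  · obtain ⟨i, hi, hdi⟩ := h
    refine ⟨fun s => ∏ j ∈ (Finset.range k).erase i, (s + d + j)⁻¹, ?_, ?_⟩
    · refine Finset.analyticAt_fun_prod _ fun j hj => hfac j fun hj0 => ?_
      have := Finset.ne_of_mem_erase hj
      omega
    · refine Eventually.of_forall fun s => ?_
      rw [← Finset.mul_prod_erase _ _ hi, mul_inv, ← Finset.prod_inv_distrib]
      have : s + d + i = s := by
        have : (d : ℂ) + i = 0 := by exact_mod_cast hdi
        rw [add_assoc, this, add_zero]
      rw [this]
      ring
  · push Not at h
    refine ⟨fun s => s * ∏ j ∈ Finset.range k, (s + d + j)⁻¹, ?_, ?_⟩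
    · exact analyticAt_id.mul (Finset.analyticAt_fun_prod _ fun j hj => hfac j (h j hj))
    · filter_upwards [self_mem_nhdsWithin] with s hs
      rw [mul_div_cancel_left₀ _ hs, Finset.prod_inv_distrib]

end ResidueCurrents

end

noncomputable section

namespace ResidueCurrents

/-! ### Smooth functions with compact support on `ℝⁿ` -/

section Calculus

open MeasureTheory

variable {n : ℕ}

theorem exists_smooth_cutoff {L U : Set (Euc n)} (hL : IsCompact L) (hU : IsOpen U) (hLU : L ⊆ U) :
    ∃ χ : Euc n → ℝ, ContDiff ℝ ∞ χ ∧ HasCompactSupport χ ∧ tsupport χ ⊆ U ∧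
      ∀ x ∈ L, χ x = 1 := by
  obtain ⟨K, hK, hLK, hKU⟩ := exists_compact_between hL hU hLU
  obtain ⟨f, hf0, hf1, -⟩ := exists_contMDiffMap_zero_one_of_isClosed (n := (⊤ : ℕ∞)) 𝓘(ℝ, Euc n)
    (isOpen_interior (s := K)).isClosed_compl hL.isClosed
    (disjoint_left.2 fun x hx hxL => hx (hLK hxL))
  have hsupp : tsupport f ⊆ K := by
    refine closure_minimal (fun x hx => ?_) hK.isClosed
    by_contra hxK
    exact hx (hf0 fun h => hxK (interior_subset h))
  exact ⟨f, f.contMDiff.contDiff, hK.of_isClosed_subset (isClosed_tsupport _) hsupp,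
    hsupp.trans hKU, fun x hx => hf1 hx⟩

/-- A function that is smooth on an open set and vanishes off a closed subset of it is smooth. -/
theorem contDiff_of_contDiffOn {F : Type*} [NormedAddCommGroup F] [NormedSpace ℝ F]
    {k : WithTop ℕ∞} {f : Euc n → F} {U L : Set (Euc n)} (hU : IsOpen U) (hL : IsClosed L)
    (hLU : L ⊆ U) (hf : ContDiffOn ℝ k f U) (h0 : ∀ x, x ∉ L → f x = 0) : ContDiff ℝ k f := by
  rw [contDiff_iff_contDiffAt]
  intro x
  by_cases hx : x ∈ U
  · exact hf.contDiffAt (hU.mem_nhds hx)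
  · have : f =ᶠ[𝓝 x] fun _ => 0 := by
      filter_upwards [hL.isOpen_compl.mem_nhds fun h => hx (hLU h)] with y hy
      exact h0 y hy
    exact contDiffAt_const.congr_of_eventuallyEq this

theorem hasCompactSupport_of_forall_notMem {F : Type*} [Zero F] {f : Euc n → F} {L : Set (Euc n)}
    (hL : IsCompact L) (h0 : ∀ x, x ∉ L → f x = 0) : HasCompactSupport f :=
  HasCompactSupport.intro hL h0

/-- The derivatives of a family of functions are bounded in each order, uniformly in the family. -/
def UnifBdd {Λ : Type*} {F : Type*} [NormedAddCommGroup F] [NormedSpace ℝ F]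
    (f : Λ → Euc n → F) : Prop :=
  ∀ i : ℕ, ∃ C : ℝ, ∀ a x, ‖iteratedFDeriv ℝ i (f a) x‖ ≤ C

section UnifBdd

variable {Λ : Type*} {f g : Λ → Euc n → ℂ}

theorem UnifBdd.add (hf : UnifBdd f) (hg : UnifBdd g) (hfs : ∀ a, ContDiff ℝ ∞ (f a))
    (hgs : ∀ a, ContDiff ℝ ∞ (g a)) : UnifBdd fun a x => f a x + g a x := by
  intro i
  obtain ⟨C, hC⟩ := hf i
  obtain ⟨D, hD⟩ := hg i
  refine ⟨C + D, fun a x => ?_⟩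
  have hi : ((i : ℕ∞) : WithTop ℕ∞) ≤ ∞ := by exact_mod_cast le_top
  have := iteratedFDeriv_add_apply (𝕜 := ℝ) (i := i) (x := x) (f := f a) (g := g a)
    ((hfs a).of_le hi).contDiffAt ((hgs a).of_le hi).contDiffAt
  change ‖iteratedFDeriv ℝ i (f a + g a) x‖ ≤ _
  rw [this]
  exact (norm_add_le _ _).trans (add_le_add (hC a x) (hD a x))

theorem UnifBdd.mul (hf : UnifBdd f) (hg : UnifBdd g) (hfs : ∀ a, ContDiff ℝ ∞ (f a))
    (hgs : ∀ a, ContDiff ℝ ∞ (g a)) : UnifBdd fun a x => f a x * g a x := by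
  intro i
  choose C hC using hf
  choose D hD using hg
  refine ⟨∑ j ∈ Finset.range (i + 1), (i.choose j) * C j * D (i - j), fun a x => ?_⟩
  refine (norm_iteratedFDeriv_mul_le (hfs a) (hgs a) x
    (n := i) (by exact_mod_cast le_top)).trans ?_
  refine Finset.sum_le_sum fun j _ => ?_
  have h0 : 0 ≤ C j := (norm_nonneg _).trans (hC j a x)
  exact mul_le_mul (mul_le_mul_of_nonneg_left (hC j a x) (Nat.cast_nonneg _)) (hD _ a x)
    (norm_nonneg _) (mul_nonneg (Nat.cast_nonneg _) h0)

theorem UnifBdd.const {c : Euc n → ℂ} (hc : ContDiff ℝ ∞ c) (hcs : HasCompactSupport c) :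
    UnifBdd fun _ : Λ => c := by
  intro i
  have h1 : Continuous (iteratedFDeriv ℝ i c) :=
    hc.continuous_iteratedFDeriv (by exact_mod_cast le_top)
  obtain ⟨C, hC⟩ := h1.bounded_above_of_compact_support (hcs.iteratedFDeriv i)
  exact ⟨C, fun _ x => hC x⟩

theorem UnifBdd.const_mul (hf : UnifBdd f) (hfs : ∀ a, ContDiff ℝ ∞ (f a)) (c : ℂ) :
    UnifBdd fun a x => c * f a x := by
  intro i
  obtain ⟨C, hC⟩ := hf i
  refine ⟨‖c‖ * C, fun a x => ?_⟩
  have := iteratedFDeriv_const_smul_apply (𝕜 := ℝ) (a := c) (i := i) (x := x) (f := f a)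
    ((hfs a).of_le (by exact_mod_cast le_top)).contDiffAt
  change ‖iteratedFDeriv ℝ i (c • f a) x‖ ≤ _
  rw [this, norm_smul]
  exact mul_le_mul_of_nonneg_left (hC a x) (norm_nonneg _)

theorem contDiff_fderiv_apply {f : Euc n → ℂ} (hf : ContDiff ℝ ∞ f) (v : Euc n) :
    ContDiff ℝ ∞ fun x => fderiv ℝ f x v :=
  (hf.fderiv_right (m := ∞) (by simp)).clm_apply contDiff_const

theorem UnifBdd.fderiv_apply (hf : UnifBdd f) (hfs : ∀ a, ContDiff ℝ ∞ (f a)) (v : Euc n) :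
    UnifBdd fun a x => fderiv ℝ (f a) x v := by
  intro i
  obtain ⟨C, hC⟩ := hf (i + 1)
  refine ⟨‖ContinuousLinearMap.apply ℝ ℂ v‖ * C, fun a x => ?_⟩
  have h1 : ContDiff ℝ ∞ (fderiv ℝ (f a)) := (hfs a).fderiv_right (m := ∞) (by simp)
  have h2 := ContinuousLinearMap.norm_iteratedFDeriv_comp_left
    (ContinuousLinearMap.apply ℝ ℂ v) (n := i) (x := x) h1.contDiffAt (by exact_mod_cast le_top)
  rw [norm_iteratedFDeriv_fderiv] at h2
  exact h2.trans (mul_le_mul_of_nonneg_left (hC a x) (norm_nonneg _))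

theorem UnifBdd.sum {ι : Type*} (S : Finset ι) {f : ι → Λ → Euc n → ℂ}
    (hf : ∀ i ∈ S, UnifBdd (f i)) (hfs : ∀ i ∈ S, ∀ a, ContDiff ℝ ∞ (f i a)) :
    UnifBdd fun a x => ∑ i ∈ S, f i a x := by
  classical
  induction S using Finset.induction_on with
  | empty =>
    simp only [Finset.sum_empty]
    exact fun i => ⟨0, fun a x => by simp⟩
  | insert i S hi ih =>
    simp only [Finset.sum_insert hi]
    have hS : ∀ j ∈ S, j ∈ insert i S := fun j hj => Finset.mem_insert_of_mem hj
    exact (hf i (Finset.mem_insert_self i S)).add (ih (fun j hj => hf j (hS j hj))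
      fun j hj => hfs j (hS j hj)) (hfs i (Finset.mem_insert_self i S))
      fun a => ContDiff.sum fun j hj => hfs j (hS j hj) a

end UnifBdd

/-! ### Complex powers and integrals depending on a complex parameter -/

/-- A power with exponent of real part larger than `1` is continuously differentiable on the whole
real line, also at `0`. -/
theorem hasDerivAt_ofReal_cpow {a : ℂ} (ha : 1 < a.re) (t : ℝ) :
    HasDerivAt (fun y : ℝ => (y : ℂ) ^ a) (a * (t : ℂ) ^ (a - 1)) t := by
  have ha0 : a ≠ 0 := by
    rintro rfl
    simp at ha
    linarith
  have ha1 : 0 < (a - 1).re := by simpa using ha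
  have ha1' : a - 1 ≠ 0 := by
    intro h
    rw [h] at ha1
    simp at ha1
  by_cases ht : t = 0
  · subst ht
    have h1 : HasDerivAt (fun y : ℝ => (y : ℂ) * (y : ℂ) ^ (a - 1)) 0 0 := by
      rw [hasDerivAt_iff_isLittleO_nhds_zero]
      have h2 : Tendsto (fun y : ℝ => (y : ℂ) ^ (a - 1)) (𝓝 0) (𝓝 0) := by
        have := (Complex.continuous_ofReal_cpow_const ha1).tendsto 0
        simpa [Complex.zero_cpow ha1'] using this
      have h3 : (fun y : ℝ => (y : ℂ) ^ (a - 1)) =o[𝓝 0] fun _ => (1 : ℝ) :=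
        (Asymptotics.isLittleO_one_iff ℝ).2 h2
      have h4 : (fun y : ℝ => (y : ℂ)) =O[𝓝 0] fun y : ℝ => y :=
        Asymptotics.IsBigO.of_bound 1 (Eventually.of_forall fun y => by simp)
      simpa using h4.mul_isLittleO h3
    have h5 : (fun y : ℝ => (y : ℂ) ^ a) = fun y : ℝ => (y : ℂ) * (y : ℂ) ^ (a - 1) := by
      funext y
      by_cases hy : (y : ℂ) = 0
      · rw [hy, Complex.zero_cpow ha0, zero_mul]
      · rw [Complex.cpow_sub _ _ hy, Complex.cpow_one, mul_div_cancel₀ _ hy]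
    rw [h5]
    simpa [Complex.zero_cpow ha1'] using h1
  · exact hasDerivAt_ofReal_cpow_const ht ha0

theorem contDiff_ofReal_cpow {a : ℂ} (ha : 1 < a.re) :
    ContDiff ℝ 1 fun y : ℝ => (y : ℂ) ^ a := by
  rw [contDiff_one_iff_deriv]
  refine ⟨fun t => (hasDerivAt_ofReal_cpow ha t).differentiableAt, ?_⟩
  have : deriv (fun y : ℝ => (y : ℂ) ^ a) = fun t : ℝ => a * (t : ℂ) ^ (a - 1) :=
    funext fun t => (hasDerivAt_ofReal_cpow ha t).deriv
  rw [this]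
  exact continuous_const.mul (Complex.continuous_ofReal_cpow_const (by simpa using ha))

/-- Integrals of functions that depend holomorphically on a parameter are holomorphic when the
integrand is locally dominated; the derivative is controlled by Cauchy's estimate. -/
theorem differentiableOn_integral_of_dominated {α : Type*} [MeasurableSpace α] {ν : Measure α}
    {F : ℂ → α → ℂ} {Ω : Set ℂ} (hΩ : IsOpen Ω)
    (hmeas : ∀ w ∈ Ω, AEStronglyMeasurable (F w) ν)
    (hhol : ∀ x, DifferentiableOn ℂ (fun w => F w x) Ω)
    (hdom : ∀ w₀ ∈ Ω, ∃ bound : α → ℝ, Integrable bound ν ∧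
      ∀ᶠ w in 𝓝 w₀, ∀ x, ‖F w x‖ ≤ bound x) :
    DifferentiableOn ℂ (fun w => ∫ x, F w x ∂ν) Ω := by
  intro w₀ hw₀
  obtain ⟨bound, hint, hb⟩ := hdom w₀ hw₀
  obtain ⟨δ, hδ, hball⟩ := Metric.eventually_nhds_iff.1 (hb.and (hΩ.mem_nhds hw₀))
  have hF : ∀ w ∈ Metric.ball w₀ (δ / 2), ∀ x,
      HasDerivAt (fun w => F w x) (deriv (fun w => F w x) w) w := fun w hw x =>
    ((hhol x).differentiableAt (hΩ.mem_nhds (hball (lt_trans hw (half_lt_self hδ))).2)).hasDerivAt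
  have hder : ∀ w ∈ Metric.ball w₀ (δ / 2), ∀ x,
      ‖deriv (fun w => F w x) w‖ ≤ bound x / (δ / 3) := by
    intro w hw x
    have hsub : Metric.closedBall w (δ / 3) ⊆ Metric.ball w₀ δ := fun z hz => by
      have h1 := Metric.mem_closedBall.1 hz
      have h2 := Metric.mem_ball.1 hw
      have := dist_triangle z w w₀
      rw [Metric.mem_ball]
      linarith
    refine Complex.norm_deriv_le_of_forall_mem_sphere_norm_le (by positivity) ?_ fun z hz =>
      (hball (hsub (Metric.sphere_subset_closedBall hz))).1 x
    refine DifferentiableOn.diffContOnCl fun z hz => ?_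
    rw [closure_ball _ (by positivity)] at hz
    exact ((hhol x).differentiableAt (hΩ.mem_nhds (hball (hsub hz)).2)).differentiableWithinAt
  have hmeas' : ∀ᶠ w in 𝓝 w₀, AEStronglyMeasurable (F w) ν :=
    Filter.mem_of_superset (hΩ.mem_nhds hw₀) hmeas
  have hderiv_meas : AEStronglyMeasurable (fun x => deriv (fun w => F w x) w₀) ν := by
    -- The derivative is a limit of difference quotients along a sequence.
    obtain ⟨u, hu0, hul⟩ : ∃ u : ℕ → ℂ, (∀ k, u k ≠ 0 ∧ w₀ + u k ∈ Ω) ∧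
        Tendsto u atTop (𝓝 0) := by
      refine ⟨fun k => ((δ / 2 / (k + 1 : ℝ) : ℝ) : ℂ), fun k => ⟨?_, ?_⟩, ?_⟩
      · exact Complex.ofReal_ne_zero.2 (by positivity)
      · refine (hball (y := w₀ + _) ?_).2
        rw [dist_eq_norm, add_sub_cancel_left, Complex.norm_real,
          Real.norm_of_nonneg (by positivity)]
        exact lt_of_le_of_lt (div_le_self (by positivity) (by
          have : (0 : ℝ) ≤ k := Nat.cast_nonneg k
          linarith)) (half_lt_self hδ)
      · rw [← Complex.ofReal_zero]
        refine (Complex.continuous_ofReal.tendsto 0).comp ?_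
        have := (tendsto_one_div_add_atTop_nhds_zero_nat (𝕜 := ℝ)).const_mul (δ / 2)
        rw [mul_zero] at this
        exact this.congr fun k => mul_one_div _ _
    refine aestronglyMeasurable_of_tendsto_ae atTop
      (f := fun k x => (u k)⁻¹ * (F (w₀ + u k) x - F w₀ x)) (fun k => ?_)
      (Eventually.of_forall fun x => ?_)
    · exact ((hmeas _ (hu0 k).2).sub (hmeas _ hw₀)).const_mul _
    · have h1 := hasDerivAt_iff_tendsto_slope_zero.1
        (hF w₀ (Metric.mem_ball_self (by positivity)) x)
      exact h1.comp (tendsto_nhdsWithin_iff.2 ⟨hul, Eventually.of_forall fun k => (hu0 k).1⟩)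
  have := hasDerivAt_integral_of_dominated_loc_of_deriv_le (μ := ν) (F := F)
    (F' := fun w x => deriv (fun w => F w x) w) (bound := fun x => bound x / (δ / 3))
    (Metric.ball_mem_nhds w₀ (half_pos hδ)) hmeas'
    (hint.mono' (hmeas w₀ hw₀) (Eventually.of_forall fun x => (hball (by simpa using hδ)).1 x))
    hderiv_meas (Eventually.of_forall fun x w hw => hder w hw x) (hint.div_const _)
    (Eventually.of_forall fun x w hw => hF w hw x)
  exact this.2.differentiableAt.differentiableWithinAt

/-! ### The Euler vector field -/

/-- The projection of `ℝⁿ` on the span of the first `m` coordinate vectors. -/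
def normalProj (n m : ℕ) : Euc n →L[ℝ] Euc n :=
  LinearMap.toContinuousLinearMap
    { toFun := fun x => WithLp.toLp 2 fun i => if (i : ℕ) < m then x i else 0
      map_add' := fun x y => by
        ext i
        by_cases h : (i : ℕ) < m <;> simp [h]
      map_smul' := fun a x => by
        ext i
        by_cases h : (i : ℕ) < m <;> simp [h] }

theorem normalProj_apply (m : ℕ) (x : Euc n) (i : Fin n) :
    normalProj n m x i = if (i : ℕ) < m then x i else 0 := rfl

theorem normalProj_normalProj (m : ℕ) (x : Euc n) :
    normalProj n m (normalProj n m x) = normalProj n m x := by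
  ext i
  by_cases h : (i : ℕ) < m <;> simp [normalProj_apply, h]

theorem normalProj_eq_sum (m : ℕ) (x : Euc n) :
    normalProj n m x =
      ∑ i with (i : Fin n).val < m, x i • EuclideanSpace.single i (1 : ℝ) := by
  ext j
  simp only [normalProj_apply, WithLp.ofLp_sum, WithLp.ofLp_smul, Finset.sum_apply, Pi.smul_apply,
    PiLp.single_apply, smul_eq_mul, mul_ite, mul_one, mul_zero, Finset.sum_ite_eq,
    Finset.mem_filter, Finset.mem_univ, true_and]

theorem normalProj_eq_zero_iff (m : ℕ) (x : Euc n) :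
    normalProj n m x = 0 ↔ ∀ i : Fin n, (i : ℕ) < m → x i = 0 := by
  constructor
  · intro h i hi
    have := congrArg (fun y : Euc n => y i) h
    simpa [normalProj_apply, hi] using this
  · intro h
    ext i
    by_cases hi : (i : ℕ) < m <;> simp [normalProj_apply, hi, h]

theorem integral_fderiv_apply_eq_zero {F : Euc n → ℂ} (hF : ContDiff ℝ 1 F)
    (hc : HasCompactSupport F) (v : Euc n) : ∫ x, fderiv ℝ F x v = 0 := by
  have hd : Continuous fun x => fderiv ℝ F x v :=
    (hF.continuous_fderiv one_ne_zero).clm_apply continuous_const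
  have h := integral_mul_fderiv_eq_neg_fderiv_mul_of_integrable (μ := volume) (𝕜 := ℂ)
    (f := fun _ : Euc n => (1 : ℂ)) (g := F) (v := v) (by simp)
    (by simpa using hd.integrable_of_hasCompactSupport (hc.fderiv_apply ℝ v))
    (by simpa using hF.continuous.integrable_of_hasCompactSupport hc)
    (fun x _ => differentiableAt_const _) (fun x _ => hF.differentiable one_ne_zero x)
  simpa using h

/-- The divergence of the Euler vector field `x ↦ normalProj n m x` is `m`. -/
theorem integral_fderiv_normalProj {m : ℕ} (hm : m ≤ n) {F : Euc n → ℂ} (hF : ContDiff ℝ 1 F)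
    (hc : HasCompactSupport F) :
    ∫ x, fderiv ℝ F x (normalProj n m x) = -(m : ℂ) * ∫ x, F x := by
  have hd : ∀ v, Continuous fun x => fderiv ℝ F x v := fun v =>
    (hF.continuous_fderiv one_ne_zero).clm_apply continuous_const
  have hcoord : ∀ i : Fin n, Continuous fun x : Euc n => (x i : ℂ) := fun i =>
    Complex.continuous_ofReal.comp (EuclideanSpace.proj (𝕜 := ℝ) i).continuous
  have hint : ∀ i : Fin n, Integrable fun x : Euc n =>
      (x i : ℂ) * fderiv ℝ F x (EuclideanSpace.single i (1 : ℝ)) := fun i =>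
    ((hcoord i).mul (hd _)).integrable_of_hasCompactSupport (hc.fderiv_apply ℝ _).mul_left
  have hterm : ∀ i : Fin n, ∫ x : Euc n,
      (x i : ℂ) * fderiv ℝ F x (EuclideanSpace.single i (1 : ℝ)) = -∫ x, F x := by
    intro i
    have hder : ∀ x : Euc n, HasFDerivAt (fun x : Euc n => (x i : ℂ))
        (Complex.ofRealCLM.comp (EuclideanSpace.proj (𝕜 := ℝ) i)) x := fun x =>
      (Complex.ofRealCLM.comp (EuclideanSpace.proj (𝕜 := ℝ) i)).hasFDerivAt
    have hone : ∀ x : Euc n, fderiv ℝ (fun x : Euc n => (x i : ℂ)) x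
        (EuclideanSpace.single i (1 : ℝ)) = 1 := fun x => by
      rw [(hder x).fderiv]
      simp
    have h := integral_mul_fderiv_eq_neg_fderiv_mul_of_integrable (μ := volume) (𝕜 := ℂ)
      (f := fun x : Euc n => (x i : ℂ)) (g := F) (v := EuclideanSpace.single i (1 : ℝ))
      (by simpa only [hone, one_mul] using hF.continuous.integrable_of_hasCompactSupport hc)
      (hint i)
      (((hcoord i).mul hF.continuous).integrable_of_hasCompactSupport hc.mul_left)
      (fun x _ => (hder x).differentiableAt) (fun x _ => hF.differentiable one_ne_zero x)
    simpa only [hone, one_mul] using h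
  have hsum : ∀ x, fderiv ℝ F x (normalProj n m x) =
      ∑ i with (i : Fin n).val < m, (x i : ℂ) * fderiv ℝ F x (EuclideanSpace.single i (1 : ℝ)) := by
    intro x
    rw [normalProj_eq_sum, map_sum]
    exact Finset.sum_congr rfl fun i _ => by rw [map_smul, Complex.real_smul]
  simp only [hsum]
  rw [integral_finsetSum _ fun i _ => hint i, Finset.sum_congr rfl fun i _ => hterm i,
    Finset.sum_const, Fin.card_filter_val_lt, min_eq_right hm, nsmul_eq_mul]
  ring

end Calculus

end ResidueCurrents

end

noncomputable section

namespace ResidueCurrents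

/-! ### Order of vanishing along a coordinate subspace -/

section Vanishing

variable {n m : ℕ}

/-- The functions that vanish to order `j` at the points `x` of `B` with `x₁ = ⋯ = x_m = 0`: all
iterated directional derivatives of order less than `j` vanish there. -/
def VanOrd (m : ℕ) (B : Set (Euc n)) : ℕ → (Euc n → ℂ) → Prop
  | 0, _ => True
  | j + 1, f => (∀ x ∈ B, normalProj n m x = 0 → f x = 0) ∧
      ∀ v, VanOrd m B j fun x => fderiv ℝ f x v

variable {B : Set (Euc n)}

theorem VanOrd.congr (hB : IsOpen B) : ∀ {j : ℕ} {f g : Euc n → ℂ}, VanOrd m B j f →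
    (∀ x ∈ B, f x = g x) → VanOrd m B j g
  | 0, _, _, _, _ => trivial
  | j + 1, f, g, hf, h => by
    refine ⟨fun x hx hx0 => (h x hx).symm.trans (hf.1 x hx hx0), fun v => ?_⟩
    refine (hf.2 v).congr hB fun x hx => ?_
    have : f =ᶠ[𝓝 x] g := by
      filter_upwards [hB.mem_nhds hx] with y hy
      exact h y hy
    rw [this.fderiv_eq]

theorem VanOrd.pred : ∀ {j : ℕ} {f : Euc n → ℂ}, VanOrd m B (j + 1) f → VanOrd m B j f
  | 0, _, _ => trivial
  | _ + 1, _, hf => ⟨hf.1, fun v => (hf.2 v).pred⟩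

theorem contDiffOn_fderiv_apply (hB : IsOpen B) {f : Euc n → ℂ} (hf : ContDiffOn ℝ ∞ f B)
    (v : Euc n) : ContDiffOn ℝ ∞ (fun x => fderiv ℝ f x v) B :=
  (hf.fderiv_of_isOpen hB (m := ∞) (by simp)).clm_apply contDiffOn_const

theorem ContDiffOn.differentiableAt_of_isOpen (hB : IsOpen B) {f : Euc n → ℂ}
    (hf : ContDiffOn ℝ ∞ f B) {x : Euc n} (hx : x ∈ B) : DifferentiableAt ℝ f x :=
  (hf.contDiffAt (hB.mem_nhds hx)).differentiableAt (by simp)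

theorem VanOrd.add (hB : IsOpen B) : ∀ {j : ℕ} {f g : Euc n → ℂ}, ContDiffOn ℝ ∞ f B →
    ContDiffOn ℝ ∞ g B → VanOrd m B j f → VanOrd m B j g → VanOrd m B j fun x => f x + g x
  | 0, _, _, _, _, _, _ => trivial
  | j + 1, f, g, hfs, hgs, hf, hg => by
    refine ⟨fun x hx hx0 => by
      simp only [hf.1 x hx hx0, hg.1 x hx hx0, add_zero], fun v => ?_⟩
    refine ((hf.2 v).add hB (contDiffOn_fderiv_apply hB hfs v) (contDiffOn_fderiv_apply hB hgs v)
      (hg.2 v)).congr hB fun x hx => ?_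
    rw [fderiv_fun_add (ContDiffOn.differentiableAt_of_isOpen hB hfs hx)
      (ContDiffOn.differentiableAt_of_isOpen hB hgs hx)]
    rfl

/-- Induction on the sum of the orders, by the product rule. -/
theorem VanOrd.mul_aux (hB : IsOpen B) : ∀ {N i j : ℕ} {f g : Euc n → ℂ}, i + j = N →
    ContDiffOn ℝ ∞ f B → ContDiffOn ℝ ∞ g B → VanOrd m B i f → VanOrd m B j g →
    VanOrd m B N fun x => f x * g x
  | 0, _, _, _, _, _, _, _, _, _ => trivial
  | N + 1, i, j, f, g, hij, hfs, hgs, hf, hg => by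
    refine ⟨fun x hx hx0 => ?_, fun v => ?_⟩
    · obtain _ | i := i
      · obtain _ | j := j
        · omega
        · simp only [hg.1 x hx hx0, mul_zero]
      · simp only [hf.1 x hx hx0, zero_mul]
    · have h1 : VanOrd m B N fun x => f x * fderiv ℝ g x v := by
        obtain _ | j := j
        · obtain _ | i := i
          · omega
          · exact VanOrd.mul_aux hB (by omega) hfs (contDiffOn_fderiv_apply hB hgs v) hf.pred
              (j := 0) trivial
        · exact VanOrd.mul_aux hB (by omega) hfs (contDiffOn_fderiv_apply hB hgs v) hf (hg.2 v)
      have h2 : VanOrd m B N fun x => fderiv ℝ f x v * g x := by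
        obtain _ | i := i
        · obtain _ | j := j
          · omega
          · exact VanOrd.mul_aux hB (i := 0) (by omega) (contDiffOn_fderiv_apply hB hfs v) hgs
              trivial hg.pred
        · exact VanOrd.mul_aux hB (by omega) (contDiffOn_fderiv_apply hB hfs v) hgs (hf.2 v) hg
      refine (h1.add hB (hfs.mul (contDiffOn_fderiv_apply hB hgs v))
        ((contDiffOn_fderiv_apply hB hfs v).mul hgs) h2).congr hB fun x hx => ?_
      rw [fderiv_fun_mul (ContDiffOn.differentiableAt_of_isOpen hB hfs hx)
        (ContDiffOn.differentiableAt_of_isOpen hB hgs hx)]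
      simp only [_root_.add_apply, _root_.smul_apply, smul_eq_mul]
      ring

theorem VanOrd.mul (hB : IsOpen B) {i j : ℕ} {f g : Euc n → ℂ} (hfs : ContDiffOn ℝ ∞ f B)
    (hgs : ContDiffOn ℝ ∞ g B) (hf : VanOrd m B i f) (hg : VanOrd m B j g) :
    VanOrd m B (i + j) fun x => f x * g x :=
  VanOrd.mul_aux hB rfl hfs hgs hf hg

theorem fderiv_fderiv_apply_comm (hB : IsOpen B) {f : Euc n → ℂ} (hfs : ContDiffOn ℝ ∞ f B)
    (v w : Euc n) {x : Euc n} (hx : x ∈ B) :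
    fderiv ℝ (fun y => fderiv ℝ f y v) x w = fderiv ℝ (fun y => fderiv ℝ f y w) x v := by
  have hf := hfs.contDiffAt (hB.mem_nhds hx)
  have hd : DifferentiableAt ℝ (fderiv ℝ f) x :=
    (hf.fderiv_right (m := ∞) (by simp)).differentiableAt (by simp)
  rw [fderiv_clm_apply hd (differentiableAt_const _),
    fderiv_clm_apply hd (differentiableAt_const _)]
  simpa using (hf.isSymmSndFDerivAt two_le_smooth) w v

/-- Derivatives in tangential directions preserve the order of vanishing. -/
theorem VanOrd.tangent (hB : IsOpen B) {w : Euc n} (hw : normalProj n m w = 0) :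
    ∀ {j : ℕ} {f : Euc n → ℂ}, ContDiffOn ℝ ∞ f B → VanOrd m B j f →
      VanOrd m B j fun x => fderiv ℝ f x w
  | 0, _, _, _ => trivial
  | j + 1, f, hfs, hf => by
    refine ⟨fun x hx hx0 => ?_, fun v => ?_⟩
    · have h1 : HasDerivAt (fun t : ℝ => x + t • w) w 0 := by
        simpa using ((hasDerivAt_id (0 : ℝ)).smul_const w).const_add x
      have h2 := (ContDiffOn.differentiableAt_of_isOpen hB hfs hx).hasFDerivAt
      have h3 : HasDerivAt (fun t : ℝ => f (x + t • w)) (fderiv ℝ f x w) 0 :=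
        HasFDerivAt.comp_hasDerivAt (0 : ℝ) (l := f) (l' := fderiv ℝ f x)
          (by simpa using h2) h1
      have h4 : (fun t : ℝ => f (x + t • w)) =ᶠ[𝓝 0] fun _ => 0 := by
        have h5 : Tendsto (fun t : ℝ => x + t • w) (𝓝 0) (𝓝 x) := by
          simpa using h1.continuousAt.tendsto
        filter_upwards [h5.eventually (hB.mem_nhds hx)] with t ht
        exact hf.1 _ ht (by rw [map_add, map_smul, hw, hx0, smul_zero, add_zero])
      exact h3.unique ((hasDerivAt_const (0 : ℝ) (0 : ℂ)).congr_of_eventuallyEq h4)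
    · refine (VanOrd.tangent hB hw (contDiffOn_fderiv_apply hB hfs v) (hf.2 v)).congr hB
        fun x hx => fderiv_fderiv_apply_comm hB hfs v w hx

theorem contDiffOn_fderiv_normalProj (hB : IsOpen B) {f : Euc n → ℂ} (hf : ContDiffOn ℝ ∞ f B) :
    ContDiffOn ℝ ∞ (fun x => fderiv ℝ f x (normalProj n m x)) B :=
  (hf.fderiv_of_isOpen hB (m := ∞) (by simp)).clm_apply (normalProj n m).contDiff.contDiffOn

/-- Euler's identity up to terms of higher order: on functions vanishing to order `j`, the Euler
vector field acts as multiplication by `j`, up to functions vanishing to order `j + 1`. -/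
theorem VanOrd.euler (hB : IsOpen B) : ∀ {j : ℕ} {f : Euc n → ℂ}, ContDiffOn ℝ ∞ f B →
    VanOrd m B j f →
    VanOrd m B (j + 1) fun x => fderiv ℝ f x (normalProj n m x) + (-(j : ℂ)) * f x
  | 0, f, _, _ => ⟨fun x _ hx0 => by simp [hx0], fun _ => trivial⟩
  | j + 1, f, hfs, hf => by
    refine ⟨fun x hx hx0 => by
      simp only [hx0, hf.1 x hx hx0, map_zero, mul_zero, add_zero], fun v => ?_⟩
    have hv : normalProj n m (normalProj n m v - v) = 0 := by
      rw [map_sub, normalProj_normalProj, sub_self]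
    have hfv := contDiffOn_fderiv_apply hB hfs v
    have h1 := VanOrd.euler hB hfv (hf.2 v)
    have h2 := VanOrd.tangent hB hv hfs hf
    refine (h1.add hB ((contDiffOn_fderiv_normalProj hB hfv).add (contDiffOn_const.mul hfv))
      (contDiffOn_fderiv_apply hB hfs _) h2).congr hB fun x hx => ?_
    have hfx := hfs.contDiffAt (hB.mem_nhds hx)
    have hd : DifferentiableAt ℝ (fderiv ℝ f) x :=
      (hfx.fderiv_right (m := ∞) (by simp)).differentiableAt (by simp)
    have hfd := ContDiffOn.differentiableAt_of_isOpen hB hfs hx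
    have hsymm := (hfx.isSymmSndFDerivAt two_le_smooth) v (normalProj n m x)
    rw [fderiv_fun_add (hd.clm_apply (normalProj n m).differentiableAt) (hfd.const_mul _),
      fderiv_const_mul hfd, fderiv_clm_apply hd (normalProj n m).differentiableAt,
      fderiv_clm_apply hd (differentiableAt_const _)]
    simp only [ContinuousLinearMap.fderiv, fderiv_fun_const, Pi.zero_apply, _root_.add_apply,
      ContinuousLinearMap.comp_apply, ContinuousLinearMap.flip_apply, _root_.smul_apply,
      smul_eq_mul, map_sub, _root_.zero_apply, map_zero, zero_add]
    rw [hsymm]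
    push_cast
    ring

/-- A function vanishing to order `j` is bounded by the `j`-th power of the distance to the
subspace, uniformly in families with uniformly bounded derivatives. -/
theorem VanOrd.exists_norm_le {Λ : Type*} (hB : Convex ℝ B)
    (hBP : ∀ x ∈ B, x - normalProj n m x ∈ B) : ∀ {j : ℕ} {f : Λ → Euc n → ℂ},
    (∀ a, ContDiff ℝ ∞ (f a)) → UnifBdd f → (∀ a, VanOrd m B j (f a)) →
    ∃ C : ℝ, 0 ≤ C ∧ ∀ a, ∀ x ∈ B, ‖f a x‖ ≤ C * ‖normalProj n m x‖ ^ j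
  | 0, f, _, hf, _ => by
    obtain ⟨C, hC⟩ := hf 0
    refine ⟨max C 0, le_max_right _ _, fun a x _ => ?_⟩
    rw [pow_zero, mul_one]
    have := hC a x
    rw [norm_iteratedFDeriv_zero] at this
    exact this.trans (le_max_left _ _)
  | j + 1, f, hfs, hf, hv => by
    have hi : ∀ i : Fin n, ∃ C : ℝ, 0 ≤ C ∧ ∀ a, ∀ x ∈ B,
        ‖fderiv ℝ (f a) x (EuclideanSpace.single i (1 : ℝ))‖ ≤ C * ‖normalProj n m x‖ ^ j :=
      fun i => VanOrd.exists_norm_le hB hBP (fun a => contDiff_fderiv_apply (hfs a) _)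
        (hf.fderiv_apply hfs _) fun a => (hv a).2 _
    choose C hC0 hC using hi
    refine ⟨∑ i, C i, Finset.sum_nonneg fun i _ => hC0 i, fun a x hx => ?_⟩
    set u := normalProj n m x with hu
    have hx0B := hBP x hx
    have hPu : normalProj n m u = u := normalProj_normalProj m x
    have hx0 : normalProj n m (x - u) = 0 := by rw [map_sub, hPu, sub_self]
    have hseg : ∀ t ∈ Icc (0 : ℝ) 1, x - u + t • u ∈ B := by
      intro t ht
      have := hB hx0B hx (sub_nonneg.2 ht.2) ht.1 (sub_add_cancel 1 t)
      convert! this using 1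
      module
    have hder : ∀ t ∈ Icc (0 : ℝ) 1, HasDerivWithinAt (fun t : ℝ => f a (x - u + t • u))
        (fderiv ℝ (f a) (x - u + t • u) u) (Icc 0 1) t := by
      intro t _
      have h1 : HasDerivAt (fun t : ℝ => x - u + t • u) u t := by
        simpa using ((hasDerivAt_id t).smul_const u).const_add (x - u)
      exact (((hfs a).differentiable (by simp) _).hasFDerivAt.comp_hasDerivAt t h1).hasDerivWithinAt
    have hbound : ∀ t ∈ Ico (0 : ℝ) 1,
        ‖fderiv ℝ (f a) (x - u + t • u) u‖ ≤ (∑ i, C i) * ‖u‖ ^ (j + 1) := by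
      intro t ht
      have hz := hseg t ⟨ht.1, ht.2.le⟩
      set z := x - u + t • u with hzdef
      have hPz : ‖normalProj n m z‖ ≤ ‖u‖ := by
        rw [hzdef, map_add, hx0, map_smul, hPu, zero_add, norm_smul, Real.norm_of_nonneg ht.1]
        exact mul_le_of_le_one_left (norm_nonneg _) ht.2.le
      have husum : u = ∑ i, u i • EuclideanSpace.single i (1 : ℝ) := by
        ext k
        simp [Pi.single_apply]
      have hcoord : ∀ i, ‖u i‖ ≤ ‖u‖ := fun i => PiLp.norm_apply_le u i
      calc ‖fderiv ℝ (f a) z u‖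
          = ‖∑ i, u i • fderiv ℝ (f a) z (EuclideanSpace.single i (1 : ℝ))‖ := by
            conv_lhs => rw [husum]
            rw [map_sum]
            simp only [map_smul]
        _ ≤ ∑ i, ‖u‖ * (C i * ‖u‖ ^ j) := by
            refine (norm_sum_le _ _).trans (Finset.sum_le_sum fun i _ => ?_)
            rw [norm_smul]
            refine mul_le_mul (hcoord i) ((hC i a z hz).trans ?_) (norm_nonneg _) (norm_nonneg _)
            exact mul_le_mul_of_nonneg_left (pow_le_pow_left₀ (norm_nonneg _) hPz j) (hC0 i)
        _ = (∑ i, C i) * ‖u‖ ^ (j + 1) := by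
            rw [Finset.sum_mul]
            exact Finset.sum_congr rfl fun i _ => by ring
    have h := norm_image_sub_le_of_norm_deriv_le_segment_01' hder hbound
    simp only [one_smul, sub_add_cancel, zero_smul, add_zero] at h
    rwa [(hv a).1 _ hx0B hx0, sub_zero] at h

end Vanishing

end ResidueCurrents

end

noncomputable section

namespace ResidueCurrents

/-! ### The zeta function in slice coordinates -/

section Slice

open MeasureTheory

variable {n m : ℕ}

/-- A function `G` on a convex open subset `B` of `ℝⁿ` that behaves like a nonnegative Morse--Bott
function with zero set `x₁ = ⋯ = x_m = 0`. -/
structure SliceData (n m : ℕ) where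
  B : Set (Euc n)
  G : Euc n → ℝ
  codim_le : m ≤ n
  isOpen : IsOpen B
  convex : Convex ℝ B
  sub_mem : ∀ x ∈ B, x - normalProj n m x ∈ B
  measurable : Measurable G
  smooth : ContDiffOn ℝ ∞ G B
  eq_zero : ∀ x ∈ B, normalProj n m x = 0 → G x = 0
  c : ℝ
  c_pos : 0 < c
  lower : ∀ x ∈ B, c * ‖normalProj n m x‖ ^ 2 ≤ G x

namespace SliceData

theorem nonneg (S : SliceData n m) {x : Euc n} (hx : x ∈ S.B) : 0 ≤ S.G x :=
  (mul_nonneg S.c_pos.le (sq_nonneg _)).trans (S.lower x hx)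

/-- The failure of Euler's identity for quadratic forms. -/
def rem (S : SliceData n m) (x : Euc n) : ℂ :=
  fderiv ℝ (fun y => (S.G y : ℂ)) x (normalProj n m x) + (-(2 : ℕ) : ℂ) * S.G x

theorem smooth_ofReal (S : SliceData n m) : ContDiffOn ℝ ∞ (fun y => (S.G y : ℂ)) S.B :=
  Complex.ofRealCLM.contDiff.comp_contDiffOn S.smooth

theorem fderiv_ofReal (S : SliceData n m) {x : Euc n} (hx : x ∈ S.B) (v : Euc n) :
    fderiv ℝ (fun y => (S.G y : ℂ)) x v = (fderiv ℝ S.G x v : ℝ) := by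
  have h : DifferentiableAt ℝ S.G x :=
    (S.smooth.contDiffAt (S.isOpen.mem_nhds hx)).differentiableAt (by simp)
  have := (Complex.ofRealCLM.hasFDerivAt.comp x h.hasFDerivAt).fderiv
  change fderiv ℝ (Complex.ofRealCLM ∘ S.G) x v = _
  rw [this]
  rfl

/-- Zeros are minima of `G`, so the first derivatives vanish there as well. -/
theorem vanOrd_two (S : SliceData n m) : VanOrd m S.B 2 fun y => (S.G y : ℂ) := by
  refine ⟨fun x hx hx0 => by simp [S.eq_zero x hx hx0], fun v => ⟨fun x hx hx0 => ?_,
    fun _ => trivial⟩⟩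
  have hmin : IsLocalMin S.G x := by
    filter_upwards [S.isOpen.mem_nhds hx] with y hy
    rw [S.eq_zero x hx hx0]
    exact S.nonneg hy
  change fderiv ℝ (fun y => (S.G y : ℂ)) x v = 0
  rw [S.fderiv_ofReal hx, hmin.fderiv_eq_zero]
  simp

theorem contDiffOn_rem (S : SliceData n m) : ContDiffOn ℝ ∞ S.rem S.B :=
  (contDiffOn_fderiv_normalProj S.isOpen S.smooth_ofReal).add
    (contDiffOn_const.mul S.smooth_ofReal)

/-- In the normal directions `G` is quadratic to leading order, so Euler's identity holds up to
third order. -/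
theorem vanOrd_rem (S : SliceData n m) : VanOrd m S.B 3 S.rem :=
  VanOrd.euler S.isOpen S.smooth_ofReal S.vanOrd_two

end SliceData

/-- A family of smooth functions supported in `L`, with uniformly bounded derivatives, that vanish
to order `j` along the zero set of `S.G`. -/
structure VanFam {Λ : Type*} (S : SliceData n m) (L : Set (Euc n)) (j : ℕ)
    (f : Λ → Euc n → ℂ) : Prop where
  smooth : ∀ a, ContDiff ℝ ∞ (f a)
  supp : ∀ a, ∀ x ∉ L, f a x = 0
  bdd : UnifBdd f
  van : ∀ a, VanOrd m S.B j (f a)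

variable {Λ : Type*} {S : SliceData n m} {L : Set (Euc n)} {j : ℕ} {f : Λ → Euc n → ℂ}

theorem contDiff_mul_of_support {B : Set (Euc n)} (hB : IsOpen B) (hL : IsCompact L) (hLB : L ⊆ B)
    {r g : Euc n → ℂ} (hr : ContDiffOn ℝ ∞ r B) (hg : ContDiff ℝ ∞ g) (hs : ∀ x ∉ L, g x = 0) :
    ContDiff ℝ ∞ fun x => r x * g x :=
  contDiff_of_contDiffOn hB hL.isClosed hLB (hr.mul hg.contDiffOn) fun x hx => by
    rw [hs x hx, mul_zero]

/-- Multiplication by a fixed function, smooth near the supports, preserves uniform bounds. -/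
theorem UnifBdd.smooth_mul {B : Set (Euc n)} (hB : IsOpen B) (hL : IsCompact L) (hLB : L ⊆ B)
    {r : Euc n → ℂ} (hr : ContDiffOn ℝ ∞ r B) (hfs : ∀ a, ContDiff ℝ ∞ (f a)) (hf : UnifBdd f)
    (hs : ∀ a, ∀ x ∉ L, f a x = 0) : UnifBdd fun a x => r x * f a x := by
  obtain ⟨χ, hχ, hχc, hχs, hχ1⟩ := exists_smooth_cutoff hL hB hLB
  have hχC : ContDiff ℝ ∞ fun x => (χ x : ℂ) := Complex.ofRealCLM.contDiff.comp hχ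
  have hρ : ContDiff ℝ ∞ fun x => r x * χ x :=
    contDiff_mul_of_support hB hχc.isCompact hχs hr hχC fun x hx => by
      rw [image_eq_zero_of_notMem_tsupport hx, Complex.ofReal_zero]
  have hρc : HasCompactSupport fun x => r x * (χ x : ℂ) :=
    hasCompactSupport_of_forall_notMem hχc.isCompact fun x hx => by
      rw [image_eq_zero_of_notMem_tsupport hx, Complex.ofReal_zero, mul_zero]
  have h := (UnifBdd.const (Λ := Λ) hρ hρc).mul hf (fun _ => hρ) hfs
  convert! h using 3 with a x
  by_cases hx : x ∈ L
  · rw [hχ1 x hx, Complex.ofReal_one, mul_one]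
  · rw [hs a x hx, mul_zero, mul_zero]

theorem fderiv_eq_zero_of_support (hL : IsCompact L) {g : Euc n → ℂ} (hs : ∀ x ∉ L, g x = 0)
    {x : Euc n} (hx : x ∉ L) : fderiv ℝ g x = 0 := by
  have : g =ᶠ[𝓝 x] fun _ => 0 := by
    filter_upwards [hL.isClosed.isOpen_compl.mem_nhds hx] with y hy
    exact hs y hy
  rw [this.fderiv_eq]
  simp

theorem VanFam.smooth_mul (hL : IsCompact L) (hLB : L ⊆ S.B) (hf : VanFam S L j f) {i : ℕ}
    {r : Euc n → ℂ} (hr : ContDiffOn ℝ ∞ r S.B) (hri : VanOrd m S.B i r) :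
    VanFam S L (i + j) fun a x => r x * f a x where
  smooth a := contDiff_mul_of_support S.isOpen hL hLB hr (hf.smooth a) (hf.supp a)
  supp a x hx := by rw [hf.supp a x hx, mul_zero]
  bdd := UnifBdd.smooth_mul S.isOpen hL hLB hr hf.smooth hf.bdd hf.supp
  van a := hri.mul S.isOpen hr (hf.smooth a).contDiffOn (hf.van a)

/-- The Euler vector field minus `j` raises the order of vanishing of a bounded family by one. -/
theorem VanFam.euler (hL : IsCompact L) (hLB : L ⊆ S.B) (hf : VanFam S L j f) :
    VanFam S L (j + 1) fun a x => fderiv ℝ (f a) x (normalProj n m x) + (-(j : ℂ)) * f a x where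
  smooth a := by
    have h1 := contDiffOn_fderiv_normalProj (m := m) isOpen_univ (hf.smooth a).contDiffOn
    exact (contDiffOn_univ.1 h1).add (contDiff_const.mul (hf.smooth a))
  supp a x hx := by
    rw [fderiv_eq_zero_of_support hL (hf.supp a) hx, hf.supp a x hx]
    simp
  bdd := by
    have hsum : (fun a x => fderiv ℝ (f a) x (normalProj n m x)) = fun a x =>
        ∑ i with (i : Fin n).val < m,
          (x i : ℂ) * fderiv ℝ (f a) x (EuclideanSpace.single i (1 : ℝ)) := by
      funext a x
      rw [normalProj_eq_sum, map_sum]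
      exact Finset.sum_congr rfl fun i _ => by rw [map_smul, Complex.real_smul]
    have hcoord : ∀ i : Fin n, ContDiff ℝ ∞ fun x : Euc n => (x i : ℂ) := fun i =>
      Complex.ofRealCLM.contDiff.comp (EuclideanSpace.proj (𝕜 := ℝ) i).contDiff
    refine UnifBdd.add ?_ (hf.bdd.const_mul hf.smooth _) (fun a => ?_)
      fun a => contDiff_const.mul (hf.smooth a)
    · rw [hsum]
      refine UnifBdd.sum _ (fun i _ => ?_) fun i _ a =>
        (hcoord i).mul (contDiff_fderiv_apply (hf.smooth a) _)
      refine UnifBdd.smooth_mul S.isOpen hL hLB (hcoord i).contDiffOn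
        (fun a => contDiff_fderiv_apply (hf.smooth a) _) (hf.bdd.fderiv_apply hf.smooth _) ?_
      intro a x hx
      rw [fderiv_eq_zero_of_support hL (hf.supp a) hx]
      rfl
    · exact contDiffOn_univ.1
        (contDiffOn_fderiv_normalProj (m := m) isOpen_univ (hf.smooth a).contDiffOn)
  van a := VanOrd.euler S.isOpen (hf.smooth a).contDiffOn (hf.van a)

/-- Near the zero set, `G` controls the square of the distance, so a function vanishing to order `j`
compensates the power `G ^ (-j / 2)`. -/
theorem VanFam.exists_bound (hL : IsCompact L) (hLB : L ⊆ S.B) (hf : VanFam S L j f) :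
    ∃ C M : ℝ, 0 ≤ C ∧ 1 ≤ M ∧ ∀ a, ∀ w : ℂ, 0 < 2 * w.re + j → ∀ x,
      ‖(S.G x : ℂ) ^ w * f a x‖ ≤ L.indicator (fun _ => C * M ^ (w.re + j / 2)) x := by
  obtain ⟨C, hC0, hC⟩ := VanOrd.exists_norm_le S.convex S.sub_mem hf.smooth hf.bdd hf.van
  obtain ⟨M, hM⟩ := (hL.image_of_continuousOn (S.smooth.continuousOn.mono hLB)).bddAbove
  have hM' : ∀ x ∈ L, S.G x ≤ max M 1 := fun x hx =>
    (hM (mem_image_of_mem _ hx)).trans (le_max_left _ _)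
  refine ⟨C * (S.c ^ ((j : ℝ) / 2))⁻¹, max M 1, by have := S.c_pos; positivity, le_max_right _ _,
    fun a w hw x => ?_⟩
  by_cases hx : x ∈ L
  swap
  · rw [indicator_of_notMem hx, hf.supp a x hx, mul_zero, norm_zero]
  rw [indicator_of_mem hx]
  have hcpos : 0 < S.c ^ ((j : ℝ) / 2) := Real.rpow_pos_of_pos S.c_pos _
  have hMpos : (0 : ℝ) < max M 1 := lt_of_lt_of_le one_pos (le_max_right _ _)
  have hRnonneg : 0 ≤ C * (S.c ^ ((j : ℝ) / 2))⁻¹ * max M 1 ^ (w.re + j / 2) := by positivity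
  have hxB := hLB hx
  have hG0 := S.nonneg hxB
  have hfx : ‖f a x‖ ≤ C * (S.c ^ ((j : ℝ) / 2))⁻¹ * S.G x ^ ((j : ℝ) / 2) := by
    refine (hC a x hxB).trans ?_
    rw [mul_assoc]
    refine mul_le_mul_of_nonneg_left ?_ hC0
    rw [inv_mul_eq_div, le_div_iff₀ hcpos]
    have h1 : ‖normalProj n m x‖ ^ j = (‖normalProj n m x‖ ^ 2) ^ ((j : ℝ) / 2) := by
      rw [← Real.rpow_natCast _ 2, ← Real.rpow_mul (norm_nonneg _), ← Real.rpow_natCast _ j]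
      congr 1
      push_cast
      ring
    rw [h1, mul_comm, ← Real.mul_rpow S.c_pos.le (sq_nonneg _)]
    exact Real.rpow_le_rpow (by have := S.c_pos; positivity) (S.lower x hxB) (by positivity)
  rcases hG0.eq_or_lt with h0 | hpos
  · -- On the zero set either `f` vanishes, or `j = 0` and then the power of `G` vanishes.
    refine le_of_eq_of_le ?_ hRnonneg
    rw [norm_eq_zero]
    by_cases hj : j = 0
    · subst hj
      have hw0 : w ≠ 0 := by
        rintro rfl
        simp at hw
      rw [← h0, Complex.ofReal_zero, Complex.zero_cpow hw0, zero_mul]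
    · rw [← h0, Real.zero_rpow (by positivity), mul_zero] at hfx
      rw [norm_le_zero_iff.1 hfx, mul_zero]
  · rw [norm_mul, Complex.norm_cpow_eq_rpow_re_of_pos hpos]
    calc S.G x ^ w.re * ‖f a x‖
        ≤ S.G x ^ w.re * (C * (S.c ^ ((j : ℝ) / 2))⁻¹ * S.G x ^ ((j : ℝ) / 2)) :=
          mul_le_mul_of_nonneg_left hfx (Real.rpow_nonneg hG0 _)
      _ = C * (S.c ^ ((j : ℝ) / 2))⁻¹ * S.G x ^ (w.re + j / 2) := by
          rw [Real.rpow_add hpos]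
          ring
      _ ≤ _ := mul_le_mul_of_nonneg_left
          (Real.rpow_le_rpow hG0 (hM' x hx) (by linarith)) (by positivity)

theorem SliceData.measurable_cpow (S : SliceData n m) (w : ℂ) :
    Measurable fun x => (S.G x : ℂ) ^ w :=
  (Complex.measurable_ofReal.comp S.measurable).pow_const w

theorem VanFam.aestronglyMeasurable (hf : VanFam S L j f) (a : Λ) (w : ℂ) :
    AEStronglyMeasurable (fun x => (S.G x : ℂ) ^ w * f a x) volume :=
  ((S.measurable_cpow w).mul (hf.smooth a).continuous.measurable).aestronglyMeasurable

theorem VanFam.integrable (hL : IsCompact L) (hLB : L ⊆ S.B) (hf : VanFam S L j f) (a : Λ) {w : ℂ}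
    (hw : 0 < 2 * w.re + j) : Integrable fun x => (S.G x : ℂ) ^ w * f a x := by
  obtain ⟨C, M, -, -, h⟩ := hf.exists_bound hL hLB
  refine Integrable.mono' (g := L.indicator fun _ => C * M ^ (w.re + j / 2)) ?_
    (hf.aestronglyMeasurable a w) (Eventually.of_forall fun x => h a w hw x)
  exact (integrableOn_const hL.measure_lt_top.ne).integrable_indicator hL.measurableSet

theorem VanFam.exists_integral_le (hL : IsCompact L) (hLB : L ⊆ S.B) (hf : VanFam S L j f) {w : ℂ}
    (hw : 0 < 2 * w.re + j) : ∃ C : ℝ, ∀ a, ‖∫ x, (S.G x : ℂ) ^ w * f a x‖ ≤ C := by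
  obtain ⟨C, M, -, -, h⟩ := hf.exists_bound hL hLB
  refine ⟨∫ x, L.indicator (fun _ => C * M ^ (w.re + j / 2)) x, fun a => ?_⟩
  exact norm_integral_le_of_norm_le
    ((integrableOn_const hL.measure_lt_top.ne).integrable_indicator hL.measurableSet)
    (Eventually.of_forall fun x => h a w hw x)

theorem VanFam.differentiableOn_integral (hL : IsCompact L) (hLB : L ⊆ S.B) (hf : VanFam S L j f)
    (a : Λ) : DifferentiableOn ℂ (fun w : ℂ => ∫ x, (S.G x : ℂ) ^ w * f a x)
      {w | 0 < 2 * w.re + j} := by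
  obtain ⟨C, M, hC, hM, h⟩ := hf.exists_bound hL hLB
  refine differentiableOn_integral_of_dominated (isOpen_lt continuous_const (by fun_prop))
    (fun w _ => hf.aestronglyMeasurable a w) (fun x => ?_) fun w₀ hw₀ => ?_
  · by_cases h0 : S.G x = 0
    · refine (differentiableOn_const (0 : ℂ)).congr fun w hw => ?_
      by_cases hw0 : w = 0
      · -- The value at the exponent `0` vanishes because `f` does.
        subst hw0
        have hj : j ≠ 0 := by
          rintro rfl
          simp at hw
        by_cases hx : x ∈ L
        · have hPx : normalProj n m x = 0 := by
            have := S.lower x (hLB hx)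
            rw [h0] at this
            have h2 : ‖normalProj n m x‖ ^ 2 ≤ 0 := by
              have := S.c_pos
              nlinarith [sq_nonneg ‖normalProj n m x‖]
            simpa using le_antisymm h2 (sq_nonneg _)
          obtain ⟨i, rfl⟩ := Nat.exists_eq_succ_of_ne_zero hj
          rw [(hf.van a).1 x (hLB hx) hPx, mul_zero]
        · rw [hf.supp a x hx, mul_zero]
      · rw [h0, Complex.ofReal_zero, Complex.zero_cpow hw0, zero_mul]
    · have h0' : (S.G x : ℂ) ≠ 0 := by exact_mod_cast h0
      exact fun w _ => ((differentiableAt_id.const_cpow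
        (Or.inl h0')).mul_const _).differentiableWithinAt
  · refine ⟨L.indicator fun _ => C * M ^ (w₀.re + 1 + j / 2),
      (integrableOn_const hL.measure_lt_top.ne).integrable_indicator hL.measurableSet, ?_⟩
    have h1 : ∀ᶠ w : ℂ in 𝓝 w₀, w.re < w₀.re + 1 :=
      Complex.continuous_re.continuousAt.eventually (gt_mem_nhds (lt_add_one _))
    have hop : IsOpen {w : ℂ | 0 < 2 * w.re + j} := isOpen_lt continuous_const (by fun_prop)
    filter_upwards [h1, hop.mem_nhds hw₀] with w hw hw' x
    refine (h a w hw' x).trans (indicator_le_indicator ?_)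
    exact mul_le_mul_of_nonneg_left (Real.rpow_le_rpow_of_exponent_le hM (by linarith)) hC

/-- Integration by parts against the Euler vector field. -/
theorem VanFam.integral_euler (hL : IsCompact L) (hLB : L ⊆ S.B) (hf : VanFam S L j f) (a : Λ)
    {w : ℂ} (hw : 2 < w.re) :
    (2 * w + m + j) * ∫ x, (S.G x : ℂ) ^ w * f a x =
      -(∫ x, (S.G x : ℂ) ^ w *
        (fderiv ℝ (f a) x (normalProj n m x) + (-(j : ℂ)) * f a x)) -
      w * ∫ x, (S.G x : ℂ) ^ (w - 1) * (S.rem x * f a x) := by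
  set F : Euc n → ℂ := fun x => (S.G x : ℂ) ^ w * f a x with hF
  have hw0 : w ≠ 0 := by
    rintro rfl
    simp at hw
    linarith
  have hw1 : w - 1 ≠ 0 := by
    intro h
    have : (w - 1).re = 0 := by rw [h]; rfl
    simp at this
    linarith
  have hsupp : ∀ x ∉ L, F x = 0 := fun x hx => by simp only [hF, hf.supp a x hx, mul_zero]
  have hpow : ContDiffOn ℝ 1 (fun x => (S.G x : ℂ) ^ w) S.B :=
    (contDiff_ofReal_cpow (by linarith)).comp_contDiffOn (S.smooth.of_le (by simp))
  -- For `Re w > 1` the integrand is continuously differentiable, also on the zero set of `G`, so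
  -- the divergence theorem for the Euler vector field applies to it.
  have hFs : ContDiff ℝ 1 F := contDiff_of_contDiffOn S.isOpen hL.isClosed hLB
    (hpow.mul ((hf.smooth a).of_le (by simp)).contDiffOn) hsupp
  have hdiv := integral_fderiv_normalProj S.codim_le hFs
    (hasCompactSupport_of_forall_notMem hL hsupp)
  have hpt : ∀ x, fderiv ℝ F x (normalProj n m x) =
      (2 * w + j) * ((S.G x : ℂ) ^ w * f a x) + (S.G x : ℂ) ^ w *
        (fderiv ℝ (f a) x (normalProj n m x) + (-(j : ℂ)) * f a x) +
      w * ((S.G x : ℂ) ^ (w - 1) * (S.rem x * f a x)) := by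
    intro x
    by_cases hx : x ∈ L
    · have hxB := hLB hx
      have hG : DifferentiableAt ℝ S.G x :=
        (S.smooth.contDiffAt (S.isOpen.mem_nhds hxB)).differentiableAt (by simp)
      have h1 : HasFDerivAt (fun y => (S.G y : ℂ) ^ w)
          ((ContinuousLinearMap.toSpanSingleton ℝ (w * (S.G x : ℂ) ^ (w - 1))).comp
            (fderiv ℝ S.G x)) x :=
        (hasDerivAt_ofReal_cpow (by linarith) (S.G x)).hasFDerivAt.comp x hG.hasFDerivAt
      have h2 := (h1.mul ((hf.smooth a).differentiable (by simp) x).hasFDerivAt).fderiv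
      have h3 : (S.G x : ℂ) ^ (w - 1) * S.G x = (S.G x : ℂ) ^ w := by
        by_cases h0 : (S.G x : ℂ) = 0
        · rw [h0, Complex.zero_cpow hw0, mul_zero]
        · rw [Complex.cpow_sub _ _ h0, Complex.cpow_one, div_mul_cancel₀ _ h0]
      change fderiv ℝ ((fun y => (S.G y : ℂ) ^ w) * f a) x _ = _
      rw [h2, SliceData.rem, S.fderiv_ofReal hxB]
      simp only [_root_.add_apply, _root_.smul_apply, smul_eq_mul,
        ContinuousLinearMap.comp_apply, ContinuousLinearMap.toSpanSingleton_apply,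
        Complex.real_smul]
      rw [← h3]
      push_cast
      ring
    · rw [fderiv_eq_zero_of_support hL hsupp hx, fderiv_eq_zero_of_support hL (hf.supp a) hx,
        hf.supp a x hx]
      simp
  have i1 := hf.integrable hL hLB a (w := w) (by
    have : (0 : ℝ) ≤ j := Nat.cast_nonneg j
    linarith)
  have i2 := (hf.euler hL hLB).integrable hL hLB a (w := w) (by
    have : (0 : ℝ) ≤ (j + 1 : ℕ) := Nat.cast_nonneg _
    linarith)
  have i3 := (hf.smooth_mul hL hLB S.contDiffOn_rem S.vanOrd_rem).integrable hL hLB a (w := w - 1)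
    (by
      have : (0 : ℝ) ≤ (3 + j : ℕ) := Nat.cast_nonneg _
      rw [Complex.sub_re, Complex.one_re]
      linarith)
  simp only [hpt] at hdiv
  rw [integral_add (f := fun x => (2 * w + j) * ((S.G x : ℂ) ^ w * f a x) + (S.G x : ℂ) ^ w *
        (fderiv ℝ (f a) x (normalProj n m x) + (-(j : ℂ)) * f a x))
      ((i1.const_mul _).add i2) (i3.const_mul _), integral_add (i1.const_mul _) i2,
    integral_const_mul, integral_const_mul] at hdiv
  linear_combination hdiv

/-- Each integration by parts raises the weight `j - 2 l` by one and contributes one linear factor;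
after `k` steps the integral converges on a half-plane extended by `k / 2`. -/
theorem VanFam.exists_continuation (hL : IsCompact L) (hLB : L ⊆ S.B) (k : ℕ) :
    ∀ (l j : ℕ) (f : Λ → Euc n → ℂ), VanFam S L j f → ∃ H : Λ → ℂ → ℂ,
      (∀ a, DifferentiableOn ℂ (H a) {w | 0 < 2 * w.re + j - 2 * l + k}) ∧
      (∀ a, ∀ w : ℂ, l + k + 2 < w.re →
        (∏ i ∈ Finset.range k, (2 * w + (m + j - 2 * l + i))) *
          ∫ x, (S.G x : ℂ) ^ (w - l) * f a x = H a w) ∧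
      ((0 : ℝ) < j - 2 * l + k → ∃ C : ℝ, ∀ a, ‖H a 0‖ ≤ C) := by
  induction k with
  | zero =>
    intro l j f hf
    refine ⟨fun a w => ∫ x, (S.G x : ℂ) ^ (w - l) * f a x, fun a => ?_, fun a w _ => by simp,
      fun hlj => ?_⟩
    · refine (hf.differentiableOn_integral hL hLB a).comp (f := fun w : ℂ => w - l)
        (by fun_prop) fun w hw => ?_
      simp only [mem_ofPred_eq, Complex.sub_re, Complex.natCast_re, Nat.cast_zero] at hw ⊢
      linarith
    · refine hf.exists_integral_le hL hLB ?_
      simp only [Complex.sub_re, Complex.zero_re, Complex.natCast_re, Nat.cast_zero] at hlj ⊢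
      linarith
  | succ k ih =>
    intro l j f hf
    obtain ⟨H₁, hd₁, he₁, hb₁⟩ := ih l (j + 1) _ (hf.euler hL hLB)
    obtain ⟨H₂, hd₂, he₂, hb₂⟩ := ih (l + 1) (3 + j) _
      (hf.smooth_mul hL hLB S.contDiffOn_rem S.vanOrd_rem)
    refine ⟨fun a w => -H₁ a w - (w - l) * H₂ a w, fun a => ?_, fun a w hw => ?_, fun hlj => ?_⟩
    · refine DifferentiableOn.sub ((hd₁ a).mono fun w hw => ?_).neg (DifferentiableOn.mul
        (by fun_prop) ((hd₂ a).mono fun w hw => ?_)) <;>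
      · simp only [mem_ofPred_eq] at hw ⊢
        push_cast at hw ⊢
        linarith
    · push_cast at hw
      have hIBP := hf.integral_euler hL hLB a (w := w - l) (by
        rw [Complex.sub_re, Complex.natCast_re]
        have : (0 : ℝ) ≤ k := Nat.cast_nonneg k
        linarith)
      beta_reduce
      rw [← he₁ a w (by linarith), ← he₂ a w (by push_cast; linarith), Finset.prod_range_succ']
      have hprod1 : ∏ i ∈ Finset.range k, (2 * w + (m + j - 2 * l + (i + 1 : ℕ))) =
          ∏ i ∈ Finset.range k, (2 * w + (m + (j + 1 : ℕ) - 2 * l + i) : ℂ) :=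
        Finset.prod_congr rfl fun i _ => by push_cast; ring
      have hprod2 : ∏ i ∈ Finset.range k, (2 * w + (m + (3 + j : ℕ) - 2 * (l + 1 : ℕ) + i) : ℂ) =
          ∏ i ∈ Finset.range k, (2 * w + (m + (j + 1 : ℕ) - 2 * l + i) : ℂ) :=
        Finset.prod_congr rfl fun i _ => by push_cast; ring
      rw [hprod1, hprod2]
      have hexp : w - ((l + 1 : ℕ) : ℂ) = w - l - 1 := by push_cast; ring
      rw [hexp]
      push_cast at hIBP ⊢
      linear_combination
        (∏ i ∈ Finset.range k, (2 * w + (m + (j + 1 : ℂ) - 2 * l + i) : ℂ)) * hIBP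
    · obtain ⟨C₁, hC₁⟩ := hb₁ (by push_cast at hlj ⊢; linarith)
      obtain ⟨C₂, hC₂⟩ := hb₂ (by push_cast at hlj ⊢; linarith)
      refine ⟨C₁ + ‖(0 : ℂ) - l‖ * C₂, fun a => ?_⟩
      refine (norm_sub_le _ _).trans (add_le_add ?_ ?_)
      · rw [norm_neg]
        exact hC₁ a
      · rw [norm_mul]
        exact mul_le_mul_of_nonneg_left (hC₂ a) (norm_nonneg _)

/-- The zeta function of a bounded family in slice coordinates: its poles at `0` are simple and the
residues are bounded. -/
theorem VanFam.hasSimpleResidue (hL : IsCompact L) (hLB : L ⊆ S.B) (hf : VanFam S L 0 f) (N : ℕ) :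
    ∃ r : Λ → ℂ, (∃ C : ℝ, ∀ a, ‖r a‖ ≤ C) ∧ ∀ a, HasSimpleResidue
      (fun s => ∫ x, (S.G x : ℂ) ^ (s / 2 - N) * f a x) (r a) := by
  -- With `l = N`, `2 N + k` integrations by parts give the continuation to `Re s > -k`; the linear
  -- factors `s + m - 2 N + i` are distinct, so that one of them at most vanishes at `s = 0`.
  have key : ∀ k : ℕ, ∃ H : Λ → ℂ → ℂ,
      (∀ a, DifferentiableOn ℂ (H a) {w | 0 < 2 * w.re + k}) ∧
      (∀ a, IsHalfPlaneContinuation (fun s => ∫ x, (S.G x : ℂ) ^ (s / 2 - N) * f a x) k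
        fun s => (∏ i ∈ Finset.range (2 * N + k), (s + ((m - 2 * N : ℤ) : ℂ) + (i : ℂ)))⁻¹ *
          H a (s / 2)) ∧ (0 < k → ∃ C : ℝ, ∀ a, ‖H a 0‖ ≤ C) := by
    intro k
    obtain ⟨H, hd, he, hb⟩ := VanFam.exists_continuation hL hLB (2 * N + k) N 0 f hf
    have hset : {w : ℂ | 0 < 2 * w.re + (0 : ℕ) - 2 * N + (2 * N + k : ℕ)} =
        {w : ℂ | 0 < 2 * w.re + k} := by
      ext w
      simp only [mem_ofPred_eq]
      push_cast
      rw [show 2 * w.re + 0 - 2 * (N : ℝ) + (2 * N + k) = 2 * w.re + k by ring]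
    simp only [hset] at hd
    refine ⟨H, hd, fun a => ⟨fun s hs => ?_, 2 * (N + (2 * N + k) + 2), fun s hs => ?_⟩,
      fun hk => hb ?_⟩
    · refine MeromorphicAt.mul (MeromorphicAt.inv (AnalyticAt.meromorphicAt (by fun_prop))) ?_
      have h1 : AnalyticAt ℂ (H a) (s / 2) := by
        refine (hd a).analyticAt ((isOpen_lt continuous_const (by fun_prop)).mem_nhds ?_)
        simp only [mem_ofPred_eq, Complex.div_ofNat_re]
        linarith
      have h2 : AnalyticAt ℂ (fun s : ℂ => s / 2) s := by fun_prop
      exact (AnalyticAt.fun_comp (g := H a) (f := fun s : ℂ => s / 2) h1 h2).meromorphicAt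
    · have h1 := he a (s / 2) (by
        rw [Complex.div_ofNat_re]
        push_cast
        linarith)
      have hN : (0 : ℝ) ≤ N := Nat.cast_nonneg N
      have hk : (0 : ℝ) ≤ k := Nat.cast_nonneg k
      have hm : (0 : ℝ) ≤ m := Nat.cast_nonneg m
      have hne : (∏ i ∈ Finset.range (2 * N + k), (s + ((m - 2 * N : ℤ) : ℂ) + (i : ℂ))) ≠ 0 := by
        refine Finset.prod_ne_zero_iff.2 fun i _ h0 => ?_
        have h2 := congrArg Complex.re h0
        have hi : (0 : ℝ) ≤ i := Nat.cast_nonneg i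
        simp at h2
        linarith
      beta_reduce
      rw [← h1, ← mul_assoc]
      have h3 : ∏ i ∈ Finset.range (2 * N + k), (2 * (s / 2) + (m + (0 : ℕ) - 2 * N + i)) =
          ∏ i ∈ Finset.range (2 * N + k), (s + ((m - 2 * N : ℤ) : ℂ) + (i : ℂ)) :=
        Finset.prod_congr rfl fun i _ => by push_cast; ring
      rw [h3, inv_mul_cancel₀ hne, one_mul]
    · have : (0 : ℝ) < k := by exact_mod_cast hk
      push_cast
      linarith
  obtain ⟨H, hd, hc, hb⟩ := key 1
  obtain ⟨q, hq, hqe⟩ := exists_analyticAt_div_prod (m - 2 * N : ℤ) (2 * N + 1)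
  refine ⟨fun a => q 0 * H a 0, ?_, fun a => ⟨fun k => ?_, _, hc a,
    fun s => q s * H a (s / 2), ?_, by simp, ?_⟩⟩
  · obtain ⟨C, hC⟩ := hb one_pos
    exact ⟨‖q 0‖ * C, fun a => by
      rw [norm_mul]
      exact mul_le_mul_of_nonneg_left (hC a) (norm_nonneg _)⟩
  · obtain ⟨H', -, hc', -⟩ := key k
    exact ⟨_, hc' a⟩
  · have h1 : AnalyticAt ℂ (H a) (0 / 2) := by
      refine (hd a).analyticAt ((isOpen_lt continuous_const (by fun_prop)).mem_nhds ?_)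
      simp
    have h2 : AnalyticAt ℂ (fun s : ℂ => s / 2) 0 := by fun_prop
    exact hq.mul (AnalyticAt.fun_comp (g := H a) (f := fun s : ℂ => s / 2) h1 h2)
  · filter_upwards [hqe] with s hs
    rw [hs]
    ring

end Slice

end ResidueCurrents

end

noncomputable section

namespace ResidueCurrents

/-! ### The zeta function in a chart -/

section Chart

open MeasureTheory

variable {n m : ℕ} {Λ : Type*}

/-- The zeta integrals `∫ g ^ (s / 2) b` of a family `b` converge for `Re s` large, uniformly in the
family, have a meromorphic continuation with at most simple poles at `0`, and their residues are
bounded, and zero if `P` holds. -/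
structure ZetaFam (g : Euc n → ℝ) (b : Λ → Euc n → ℂ) (P : Prop) : Prop where
  integrable : ∃ R : ℝ, ∀ a, ∀ s : ℂ, R < s.re → Integrable fun x => (g x : ℂ) ^ (s / 2) * b a x
  residue : ∃ r : Λ → ℂ, (∃ C : ℝ, ∀ a, ‖r a‖ ≤ C) ∧
    (∀ a, HasSimpleResidue (fun s => ∫ x, (g x : ℂ) ^ (s / 2) * b a x) (r a)) ∧
    (P → ∀ a, r a = 0)

variable {g : Euc n → ℝ} {P : Prop}

theorem zetaFam_zero : ZetaFam g (fun (_ : Λ) _ => 0) P where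
  integrable := ⟨0, fun a s _ => by simp⟩
  residue := ⟨fun _ => 0, ⟨0, fun _ => by simp⟩, fun a => by
    simp only [mul_zero, integral_zero]
    exact hasSimpleResidue_zero, fun _ _ => rfl⟩

theorem ZetaFam.add {b c : Λ → Euc n → ℂ} (hb : ZetaFam g b P) (hc : ZetaFam g c P) :
    ZetaFam g (fun a x => b a x + c a x) P := by
  obtain ⟨⟨R, hR⟩, r, ⟨C, hC⟩, hr, h0⟩ := hb
  obtain ⟨⟨R', hR'⟩, r', ⟨C', hC'⟩, hr', h0'⟩ := hc
  refine ⟨⟨max R R', fun a s hs => ?_⟩, fun a => r a + r' a, ⟨C + C', fun a =>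
    (norm_add_le _ _).trans (add_le_add (hC a) (hC' a))⟩, fun a => ?_, fun hP a => by
      simp only [h0 hP, h0' hP, add_zero]⟩
  · simp only [mul_add]
    exact (hR a s (lt_of_le_of_lt (le_max_left _ _) hs)).add
      (hR' a s (lt_of_le_of_lt (le_max_right _ _) hs))
  · refine ((hr a).add (hr' a)).congr (R := max R R') fun s hs => ?_
    simp only [mul_add, Pi.add_apply]
    exact (integral_add (hR a s (lt_of_le_of_lt (le_max_left _ _) hs))
      (hR' a s (lt_of_le_of_lt (le_max_right _ _) hs))).symm

theorem ZetaFam.sum {ι : Type*} (A : Finset ι) {b : ι → Λ → Euc n → ℂ}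
    (hb : ∀ i ∈ A, ZetaFam g (b i) P) : ZetaFam g (fun a x => ∑ i ∈ A, b i a x) P := by
  classical
  induction A using Finset.induction_on with
  | empty =>
    simp only [Finset.sum_empty]
    exact zetaFam_zero
  | insert i A hi ih =>
    simp only [Finset.sum_insert hi]
    exact (hb i (Finset.mem_insert_self i A)).add
      (ih fun j hj => hb j (Finset.mem_insert_of_mem hj))

/-- Away from the zero set of `g`, the zeta integral is an entire function. -/
theorem zeta_of_pos {g : Euc n → ℝ} {W T : Set (Euc n)} (hW : IsOpen W) (hT : IsCompact T)
    (hTW : T ⊆ W) (hg : ContinuousOn g W) (hpos : ∀ x ∈ W, 0 < g x) {F : Euc n → ℂ}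
    (hF : Continuous F) (hs : ∀ x ∉ T, F x = 0) (N : ℕ) :
    (∀ s : ℂ, Integrable fun x => (g x : ℂ) ^ (s / 2 - N) * F x) ∧
      HasSimpleResidue (fun s => ∫ x, (g x : ℂ) ^ (s / 2 - N) * F x) 0 := by
  have hslit : ∀ x ∈ W, (g x : ℂ) ∈ Complex.slitPlane := fun x hx =>
    Complex.ofReal_mem_slitPlane.2 (hpos x hx)
  have hgC : ContinuousOn (fun x => (g x : ℂ)) W := Complex.continuous_ofReal.comp_continuousOn hg
  have hcont : ∀ w : ℂ, Continuous fun x => (g x : ℂ) ^ w * F x := by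
    intro w
    have h1 : ContinuousOn (fun x => (g x : ℂ) ^ w * F x) W :=
      (hgC.cpow continuousOn_const hslit).mul hF.continuousOn
    exact (contDiff_of_contDiffOn (k := 0) hW hT.isClosed hTW (contDiffOn_zero.2 h1) fun x hx => by
      rw [hs x hx, mul_zero]).continuous
  have hint : ∀ w : ℂ, Integrable fun x => (g x : ℂ) ^ w * F x := fun w =>
    (hcont w).integrable_of_hasCompactSupport (hasCompactSupport_of_forall_notMem hT fun x hx => by
      rw [hs x hx, mul_zero])
  refine ⟨fun s => hint _, hasSimpleResidue_of_analytic fun s => ?_⟩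
  have hd : DifferentiableOn ℂ (fun w : ℂ => ∫ x, (g x : ℂ) ^ w * F x) univ := by
    refine differentiableOn_integral_of_dominated isOpen_univ
      (fun w _ => (hcont w).aestronglyMeasurable) (fun x => ?_) fun w₀ _ => ?_
    · by_cases hx : x ∈ T
      · have h0 : (g x : ℂ) ≠ 0 := Complex.ofReal_ne_zero.2 (hpos x (hTW hx)).ne'
        exact fun w _ => ((differentiableAt_id.const_cpow
          (Or.inl h0)).mul_const _).differentiableWithinAt
      · simp only [hs x hx, mul_zero]
        exact differentiableOn_const _
    · have hc2 : ContinuousOn (fun p : ℂ × Euc n => (g p.2 : ℂ) ^ p.1 * F p.2)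
          (Metric.closedBall w₀ 1 ×ˢ T) := by
        refine ContinuousOn.mul (ContinuousOn.cpow (hgC.comp continuousOn_snd fun p hp => hTW hp.2)
          continuousOn_fst fun p hp => hslit _ (hTW hp.2)) (hF.comp continuous_snd).continuousOn
      obtain ⟨C, hC⟩ := ((isCompact_closedBall w₀ 1).prod hT).exists_bound_of_continuousOn hc2
      refine ⟨T.indicator fun _ => C,
        (integrableOn_const hT.measure_lt_top.ne).integrable_indicator hT.measurableSet, ?_⟩
      filter_upwards [Metric.closedBall_mem_nhds w₀ one_pos] with w hw x
      by_cases hx : x ∈ T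
      · rw [indicator_of_mem hx]
        exact hC (w, x) ⟨hw, hx⟩
      · rw [indicator_of_notMem hx, hs x hx, mul_zero, norm_zero]
  have h1 : AnalyticAt ℂ (fun w : ℂ => ∫ x, (g x : ℂ) ^ w * F x) (s / 2 - N) :=
    hd.analyticAt univ_mem
  have h2 : AnalyticAt ℂ (fun s : ℂ => s / 2 - N) s := by fun_prop
  exact AnalyticAt.fun_comp (f := fun s : ℂ => s / 2 - N) h1 h2

/-! ### Slice coordinates -/

/-- Coordinates near `z` in which the function `g` is described by slice data: `σ` is a smooth
parametrization with inverse `τ`, defined on the neighbourhood `W` of `z`. -/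
structure SliceChart (m : ℕ) (g : Euc n → ℝ) (z : Euc n) where
  S : SliceData n m
  σ : Euc n → Euc n
  τ : Euc n → Euc n
  W : Set (Euc n)
  isOpen_W : IsOpen W
  mem_W : z ∈ W
  smooth : ContDiffOn ℝ ∞ σ S.B
  injOn : InjOn σ S.B
  det_ne_zero : ∀ x ∈ S.B, (fderiv ℝ σ x).det ≠ 0
  continuousOn_τ : ContinuousOn τ W
  τ_mem : ∀ x ∈ W, τ x ∈ S.B
  σ_τ : ∀ x ∈ W, σ (τ x) = x
  G_eq : ∀ x ∈ S.B, S.G x = g (σ x)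

theorem contDiff_det : ContDiff ℝ ∞ fun A : Euc n →L[ℝ] Euc n => A.det := by
  have h : (fun A : Euc n →L[ℝ] Euc n => A.det) = fun A : Euc n →L[ℝ] Euc n =>
      ∑ π : Equiv.Perm (Fin n), ((Equiv.Perm.sign π : ℤ) : ℝ) *
        ∏ i, (A (EuclideanSpace.single i (1 : ℝ))) (π i) := by
    funext A
    rw [ContinuousLinearMap.det,
      ← LinearMap.det_toMatrix (EuclideanSpace.basisFun (Fin n) ℝ).toBasis,
      Matrix.det_apply']
    refine Finset.sum_congr rfl fun π _ => ?_
    congr 1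
  rw [h]
  refine ContDiff.sum fun π _ => contDiff_const.mul (contDiff_prod fun i _ => ?_)
  have h1 : ContDiff ℝ ∞ fun A : Euc n →L[ℝ] Euc n => A (EuclideanSpace.single i (1 : ℝ)) :=
    contDiff_id.clm_apply contDiff_const
  exact (EuclideanSpace.proj (𝕜 := ℝ) (π i)).contDiff.comp h1

/-- Composition with a fixed smooth map with bounded derivatives preserves uniform bounds. -/
theorem UnifBdd.comp {F : Λ → Euc n → ℂ} (hF : UnifBdd F) (hFs : ∀ a, ContDiff ℝ ∞ (F a))
    {σ : Euc n → Euc n} (hσ : ContDiff ℝ ∞ σ) (hσc : HasCompactSupport σ) :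
    UnifBdd fun a x => F a (σ x) := by
  intro i
  choose C hC using hF
  have hD : ∀ j : ℕ, ∃ D : ℝ, ∀ x, ‖iteratedFDeriv ℝ j σ x‖ ≤ D := fun j =>
    (hσ.continuous_iteratedFDeriv (by exact_mod_cast le_top)).bounded_above_of_compact_support
      (hσc.iteratedFDeriv j)
  choose D hD using hD
  set C' : ℝ := ∑ j ∈ Finset.range (i + 1), |C j| with hC'
  set D' : ℝ := 1 + ∑ j ∈ Finset.range (i + 1), |D j| with hD'
  refine ⟨i.factorial * C' * D' ^ i, fun a x => ?_⟩
  refine norm_iteratedFDeriv_comp_le (hFs a) hσ (n := i) (by exact_mod_cast le_top) x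
    (fun j hj => ?_) fun j hj1 hj => ?_
  · refine (hC j a _).trans ((le_abs_self _).trans ?_)
    exact Finset.single_le_sum (f := fun j => |C j|) (fun _ _ => abs_nonneg _)
      (Finset.mem_range.2 (by omega))
  · have h1 : |D j| ≤ ∑ j ∈ Finset.range (i + 1), |D j| :=
      Finset.single_le_sum (f := fun j => |D j|) (fun _ _ => abs_nonneg _)
        (Finset.mem_range.2 (by omega))
    have h2 : (0 : ℝ) ≤ ∑ j ∈ Finset.range (i + 1), |D j| :=
      Finset.sum_nonneg fun _ _ => abs_nonneg _
    have h3 : D' ≤ D' ^ j := le_self_pow₀ (by linarith) (by omega)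
    exact (hD j x).trans ((le_abs_self _).trans (by linarith))

/-- The zeta integral of a bounded family supported near a point with slice coordinates. -/
theorem SliceChart.zeta {z : Euc n} (Q : SliceChart m g z) {T : Set (Euc n)} (hT : IsCompact T)
    (hTW : T ⊆ Q.W) {F : Λ → Euc n → ℂ} (hFs : ∀ a, ContDiff ℝ ∞ (F a)) (hF : UnifBdd F)
    (hs : ∀ a, ∀ x ∉ T, F a x = 0) (N : ℕ) :
    (∀ a, ∀ s : ℂ, 2 * N < s.re → Integrable fun x => (g x : ℂ) ^ (s / 2 - N) * F a x) ∧
    ∃ r : Λ → ℂ, (∃ C : ℝ, ∀ a, ‖r a‖ ≤ C) ∧ ∀ a,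
      HasSimpleResidue (fun s => ∫ x, (g x : ℂ) ^ (s / 2 - N) * F a x) (r a) := by
  set B := Q.S.B with hB
  have hBo : IsOpen B := Q.S.isOpen
  set L := Q.τ '' T with hLdef
  have hL : IsCompact L := hT.image_of_continuousOn (Q.continuousOn_τ.mono hTW)
  have hLB : L ⊆ B := by
    rintro _ ⟨x, hx, rfl⟩
    exact Q.τ_mem x (hTW hx)
  have hmemL : ∀ x ∈ B, Q.σ x ∈ T → x ∈ L := fun x hx hxT =>
    ⟨Q.σ x, hxT, Q.injOn (Q.τ_mem _ (hTW hxT)) hx (Q.σ_τ _ (hTW hxT))⟩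
  obtain ⟨χ, hχ, hχc, hχs, hχ1⟩ := exists_smooth_cutoff hL hBo hLB
  obtain ⟨χ', hχ', hχc', hχs', hχ1'⟩ := exists_smooth_cutoff hχc.isCompact hBo hχs
  -- A compactly supported modification of `σ` and of its Jacobian.
  set σ' : Euc n → Euc n := fun x => χ' x • Q.σ x with hσ'def
  have hσ' : ContDiff ℝ ∞ σ' := contDiff_of_contDiffOn hBo (isClosed_tsupport χ') hχs'
    (hχ'.contDiffOn.smul Q.smooth) fun x hx => by
      simp only [hσ'def, image_eq_zero_of_notMem_tsupport hx, zero_smul]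
  have hσc' : HasCompactSupport σ' := hχc'.smul_right
  set J : Euc n → ℂ := fun x => ((|(fderiv ℝ Q.σ x).det| * χ x : ℝ) : ℂ) with hJdef
  have hJ : ContDiff ℝ ∞ J := by
    refine Complex.ofRealCLM.contDiff.comp (contDiff_of_contDiffOn hBo (isClosed_tsupport χ) hχs
      (f := fun x => |(fderiv ℝ Q.σ x).det| * χ x) ?_ fun x hx => by
        rw [image_eq_zero_of_notMem_tsupport hx, mul_zero])
    refine ContDiffOn.mul (fun x hx => ?_) hχ.contDiffOn
    have h1 : ContDiffAt ℝ ∞ (fun x => (fderiv ℝ Q.σ x).det) x :=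
      contDiff_det.contDiffAt.comp x
        (((Q.smooth.fderiv_of_isOpen hBo (m := ∞) (by simp))).contDiffAt (hBo.mem_nhds hx))
    exact (h1.abs (Q.det_ne_zero x hx)).contDiffWithinAt
  have hJc : HasCompactSupport J := hasCompactSupport_of_forall_notMem hχc.isCompact fun x hx => by
    simp only [hJdef, image_eq_zero_of_notMem_tsupport hx, mul_zero, Complex.ofReal_zero]
  set h : Λ → Euc n → ℂ := fun a x => J x * F a (σ' x) with hhdef
  have hh : ∀ a, ∀ x ∈ B, h a x = |(fderiv ℝ Q.σ x).det| * F a (Q.σ x) := by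
    intro a x hx
    by_cases hxχ : x ∈ tsupport χ
    · have h1 : σ' x = Q.σ x := by simp only [hσ'def, hχ1' x hxχ, one_smul]
      simp only [hhdef, h1, hJdef]
      by_cases hxT : Q.σ x ∈ T
      · rw [hχ1 x (hmemL x hx hxT), mul_one]
      · rw [hs a _ hxT, mul_zero, mul_zero]
    · have hxT : Q.σ x ∉ T := fun hxT => hxχ (subset_tsupport χ (by
        rw [Function.mem_support, hχ1 x (hmemL x hx hxT)]
        exact one_ne_zero))
      simp only [hhdef, hJdef, image_eq_zero_of_notMem_tsupport hxχ, mul_zero, Complex.ofReal_zero,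
        zero_mul, hs a _ hxT]
  have hfam : VanFam Q.S (tsupport χ) 0 h :=
    { smooth := fun a => hJ.mul ((hFs a).comp hσ')
      supp := fun a x hx => by
        simp only [hhdef, hJdef, image_eq_zero_of_notMem_tsupport hx, mul_zero,
          Complex.ofReal_zero, zero_mul]
      bdd := (UnifBdd.const hJ hJc).mul (hF.comp hFs hσ' hσc') (fun _ => hJ)
        fun a => (hFs a).comp hσ'
      van := fun _ => trivial }
  have hder : ∀ x ∈ B, HasFDerivWithinAt Q.σ (fderiv ℝ Q.σ x) B x := fun x hx =>
    ((Q.smooth.contDiffAt (hBo.mem_nhds hx)).differentiableAt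
      (by simp)).hasFDerivAt.hasFDerivWithinAt
  have hTim : ∀ x ∉ Q.σ '' B, x ∉ T := fun x hx hxT =>
    hx ⟨Q.τ x, Q.τ_mem x (hTW hxT), Q.σ_τ x (hTW hxT)⟩
  have hoffB : ∀ a, ∀ x ∉ B, h a x = 0 := fun a x hx => hfam.supp a x fun hxχ => hx (hχs hxχ)
  have hpt : ∀ a, ∀ w : ℂ, ∀ x ∈ B, |(fderiv ℝ Q.σ x).det| • ((g (Q.σ x) : ℂ) ^ w * F a (Q.σ x)) =
      (Q.S.G x : ℂ) ^ w * h a x := by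
    intro a w x hx
    rw [hh a x hx, Q.G_eq x hx, Complex.real_smul]
    ring
  have hint : ∀ a, ∀ w : ℂ, Integrable (fun x => (Q.S.G x : ℂ) ^ w * h a x) →
      Integrable fun x => (g x : ℂ) ^ w * F a x := by
    intro a w hi
    rw [← integrableOn_iff_integrable_of_support_subset (s := Q.σ '' B) fun x hx => by
      by_contra hxB
      exact hx (by simp only [hs a x (hTim x hxB), mul_zero]),
      integrableOn_image_iff_integrableOn_abs_det_fderiv_smul volume hBo.measurableSet hder Q.injOn,
      integrableOn_congr_fun (hpt a w) hBo.measurableSet]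
    exact hi.integrableOn
  have hintegral : ∀ a, ∀ w : ℂ, ∫ x, (g x : ℂ) ^ w * F a x =
      ∫ x, (Q.S.G x : ℂ) ^ w * h a x := by
    intro a w
    rw [← setIntegral_eq_integral_of_forall_compl_eq_zero (s := Q.σ '' B) fun x hx => by
        rw [hs a x (hTim x hx), mul_zero],
      integral_image_eq_integral_abs_det_fderiv_smul volume hBo.measurableSet hder Q.injOn,
      setIntegral_congr_fun hBo.measurableSet (hpt a w),
      setIntegral_eq_integral_of_forall_compl_eq_zero fun x hx => by rw [hoffB a x hx, mul_zero]]
  refine ⟨fun a s hsre => hint a _ (hfam.integrable hχc.isCompact hχs a ?_), ?_⟩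
  · rw [Complex.sub_re, Complex.div_ofNat_re, Complex.natCast_re, Nat.cast_zero]
    linarith
  · obtain ⟨r, hr, hres⟩ := hfam.hasSimpleResidue hχc.isCompact hχs N
    refine ⟨r, hr, fun a => ?_⟩
    simp only [hintegral]
    exact hres a

/-! ### Patching -/

/-- On compact subsets of `W`, the derivatives of a family of functions are bounded in each order,
uniformly in the family. -/
def LocUnifBdd (W : Set (Euc n)) (f : Λ → Euc n → ℂ) : Prop :=
  ∀ T ⊆ W, IsCompact T → ∀ i : ℕ, ∃ C : ℝ, ∀ a, ∀ x ∈ T, ‖iteratedFDeriv ℝ i (f a) x‖ ≤ C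

theorem LocUnifBdd.cutoff {W : Set (Euc n)} (hW : IsOpen W) {f : Λ → Euc n → ℂ}
    (hf : LocUnifBdd W f) (hfs : ∀ a, ContDiffOn ℝ ∞ (f a) W) {χ : Euc n → ℝ}
    (hχ : ContDiff ℝ ∞ χ) (hχc : HasCompactSupport χ) (hχW : tsupport χ ⊆ W) :
    (∀ a, ContDiff ℝ ∞ fun x => (χ x : ℂ) * f a x) ∧ UnifBdd fun a x => (χ x : ℂ) * f a x := by
  have hχC : ContDiff ℝ ∞ fun x => (χ x : ℂ) := Complex.ofRealCLM.contDiff.comp hχ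
  have hoff : ∀ a, ∀ x ∉ tsupport χ, (χ x : ℂ) * f a x = 0 := fun a x hx => by
    rw [image_eq_zero_of_notMem_tsupport hx, Complex.ofReal_zero, zero_mul]
  refine ⟨fun a => contDiff_of_contDiffOn hW (isClosed_tsupport χ) hχW
    (hχC.contDiffOn.mul (hfs a)) (hoff a), fun i => ?_⟩
  have hD : ∀ j : ℕ, ∃ D : ℝ, ∀ x, ‖iteratedFDeriv ℝ j (fun x => (χ x : ℂ)) x‖ ≤ D := fun j =>
    (hχC.continuous_iteratedFDeriv (by exact_mod_cast le_top)).bounded_above_of_compact_support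
      (HasCompactSupport.iteratedFDeriv (hχc.comp_left (g := Complex.ofReal) Complex.ofReal_zero) j)
  choose D hD using hD
  choose C hC using hf _ hχW hχc.isCompact
  have hD0 : ∀ j, 0 ≤ D j := fun j => (norm_nonneg _).trans (hD j 0)
  refine ⟨∑ j ∈ Finset.range (i + 1), (i.choose j) * D j * |C (i - j)|, fun a x => ?_⟩
  by_cases hx : x ∈ tsupport χ
  · have hxW := hχW hx
    have h := norm_iteratedFDerivWithin_mul_le (hχC.contDiffOn (s := W)) (hfs a) hW.uniqueDiffOn
      hxW (n := i) (by exact_mod_cast le_top)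
    rw [iteratedFDerivWithin_of_isOpen i hW hxW] at h
    refine h.trans (Finset.sum_le_sum fun j _ => ?_)
    rw [iteratedFDerivWithin_of_isOpen j hW hxW, iteratedFDerivWithin_of_isOpen _ hW hxW]
    exact mul_le_mul (mul_le_mul_of_nonneg_left (hD j x) (Nat.cast_nonneg _))
      ((hC _ a x hx).trans (le_abs_self _)) (norm_nonneg _)
      (mul_nonneg (Nat.cast_nonneg _) (hD0 j))
  · have h0 : (fun x => (χ x : ℂ) * f a x) =ᶠ[𝓝 x] fun _ => 0 := by
      filter_upwards [(isClosed_tsupport χ).isOpen_compl.mem_nhds hx] with y hy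
      exact hoff a y hy
    rw [(h0.iteratedFDeriv ℝ i).self_of_nhds]
    have : iteratedFDeriv ℝ i (fun _ : Euc n => (0 : ℂ)) x = 0 := by simp
    rw [this, norm_zero]
    exact Finset.sum_nonneg fun j _ =>
      mul_nonneg (mul_nonneg (Nat.cast_nonneg _) (hD0 j)) (abs_nonneg _)

/-- A function `c` with a singularity of order `N` is replaced by the smooth function `F = t ^ N c`
at the price of shifting the exponent. The convention `0 ^ w = 0` for `w ≠ 0` makes this true on the
zero set as well. -/
theorem cpow_mul_eq {t : ℝ} {c F : ℂ} {N : ℕ} {s : ℂ} (hs : 2 * (N : ℝ) < s.re)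
    (h0 : t = 0 → c = 0) (h1 : t ≠ 0 → (t : ℂ) ^ N * c = F) :
    (t : ℂ) ^ (s / 2) * c = (t : ℂ) ^ (s / 2 - N) * F := by
  by_cases ht : t = 0
  · have hne : s / 2 - N ≠ 0 := by
      intro h
      have := congrArg Complex.re h
      rw [Complex.sub_re, Complex.div_ofNat_re, Complex.natCast_re, Complex.zero_re] at this
      linarith
    rw [h0 ht, mul_zero, ht, Complex.ofReal_zero, Complex.zero_cpow hne, zero_mul]
  · have htC : (t : ℂ) ≠ 0 := Complex.ofReal_ne_zero.2 ht
    rw [← h1 ht, Complex.cpow_sub _ _ htC, Complex.cpow_natCast, ← mul_assoc,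
      div_mul_cancel₀ _ (pow_ne_zero N htC)]

/-- The zeta integrals in a chart of a family of functions with singularities of finite order along
the zero set of a function with slice coordinates at its zeros. -/
theorem zetaFam_of_local {U L : Set (Euc n)} (hL : IsCompact L)
    (hg : ContDiffOn ℝ ∞ g U) (hg0 : ∀ x ∈ U, 0 ≤ g x) {b : Λ → Euc n → ℂ}
    (hbL : ∀ a, ∀ x ∉ L, b a x = 0) (hb0 : ∀ a x, g x = 0 → b a x = 0)
    (hslice : ∀ z ∈ L, g z = 0 → Nonempty (SliceChart m g z))
    (hloc : ∀ z ∈ L, ∃ W : Set (Euc n), IsOpen W ∧ z ∈ W ∧ W ⊆ U ∧ ∃ (N : ℕ) (f : Λ → Euc n → ℂ),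
      (∀ a, ContDiffOn ℝ ∞ (f a) W) ∧ LocUnifBdd W f ∧
      ∀ a, ∀ x ∈ W, g x ≠ 0 → (g x : ℂ) ^ N * b a x = f a x) :
    ZetaFam g b (∀ z ∈ L, g z ≠ 0) := by
  have key : ∀ z : L, ∃ W : Set (Euc n), IsOpen W ∧ (z : Euc n) ∈ W ∧ ∀ χ : Euc n → ℝ,
      ContDiff ℝ ∞ χ → HasCompactSupport χ → tsupport χ ⊆ W →
      ZetaFam g (fun a x => (χ x : ℂ) * b a x) (∀ z ∈ L, g z ≠ 0) := by
    rintro ⟨z, hz⟩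
    obtain ⟨W, hW, hzW, hWU, N, f, hfs, hfb, hbf⟩ := hloc z hz
    have hpt : ∀ (χ : Euc n → ℝ), tsupport χ ⊆ W → ∀ a, ∀ s : ℂ, 2 * (N : ℝ) < s.re → ∀ x,
        (g x : ℂ) ^ (s / 2) * ((χ x : ℂ) * b a x) =
          (g x : ℂ) ^ (s / 2 - N) * ((χ x : ℂ) * f a x) := by
      intro χ hχW a s hs x
      by_cases hx : x ∈ tsupport χ
      · refine cpow_mul_eq hs (fun h0 => by rw [hb0 a x h0, mul_zero]) fun h1 => ?_
        rw [← hbf a x (hχW hx) h1]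
        ring
      · rw [image_eq_zero_of_notMem_tsupport hx]
        simp
    by_cases hgz : g z = 0
    · obtain ⟨Q⟩ := hslice z hz hgz
      refine ⟨W ∩ Q.W, hW.inter Q.isOpen_W, ⟨hzW, Q.mem_W⟩, fun χ hχ hχc hχW => ?_⟩
      have hχW1 : tsupport χ ⊆ W := hχW.trans inter_subset_left
      obtain ⟨hFs, hFb⟩ := hfb.cutoff hW hfs hχ hχc hχW1
      obtain ⟨hint, r, hr, hres⟩ := Q.zeta hχc.isCompact (hχW.trans inter_subset_right) hFs hFb
        (fun a x hx => by
          rw [image_eq_zero_of_notMem_tsupport hx, Complex.ofReal_zero, zero_mul]) N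
      refine ⟨⟨2 * N, fun a s hs => ?_⟩, r, hr, fun a => (hres a).congr (R := 2 * N)
        fun s hs => ?_, fun hP => absurd hgz (hP z hz)⟩
      · simp only [hpt χ hχW1 a s hs]
        exact hint a s hs
      · simp only [hpt χ hχW1 a s hs]
    · have hW' : IsOpen (W ∩ g ⁻¹' Ioi 0) :=
        (hg.continuousOn.mono hWU).isOpen_inter_preimage hW isOpen_Ioi
      refine ⟨W ∩ g ⁻¹' Ioi 0, hW', ⟨hzW, lt_of_le_of_ne (hg0 z (hWU hzW)) (Ne.symm hgz)⟩,
        fun χ hχ hχc hχW => ?_⟩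
      have hχW1 : tsupport χ ⊆ W := hχW.trans inter_subset_left
      obtain ⟨hFs, hFb⟩ := hfb.cutoff hW hfs hχ hχc hχW1
      have hz := fun a => zeta_of_pos hW' hχc.isCompact hχW
        (hg.continuousOn.mono (inter_subset_left.trans hWU)) (fun x hx => hx.2)
        (hFs a).continuous (fun x hx => by
          rw [image_eq_zero_of_notMem_tsupport hx, Complex.ofReal_zero, zero_mul]) N
      refine ⟨⟨2 * N, fun a s hs => ?_⟩, fun _ => 0, ⟨0, fun _ => by simp⟩,
        fun a => (hz a).2.congr (R := 2 * N) fun s hs => ?_, fun _ _ => rfl⟩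
      · simp only [hpt χ hχW1 a s hs]
        exact (hz a).1 s
      · simp only [hpt χ hχW1 a s hs]
  -- The balls make the supports of the partition of unity compact.
  choose W hWo hzW hW using key
  obtain ⟨ρ, hρ⟩ := SmoothPartitionOfUnity.exists_isSubordinate 𝓘(ℝ, Euc n) hL.isClosed
    (fun z : L => W z ∩ Metric.ball (z : Euc n) 1) (fun z => (hWo z).inter Metric.isOpen_ball)
    fun z hz => mem_iUnion.2 ⟨⟨z, hz⟩, hzW _, Metric.mem_ball_self one_pos⟩
  have hfin : {i : L | (Function.support (ρ i) ∩ L).Nonempty}.Finite :=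
    ρ.locallyFinite.finite_nonempty_inter_compact hL
  have hbsum : b = fun a x => ∑ i ∈ hfin.toFinset, ((ρ i x : ℝ) : ℂ) * b a x := by
    funext a x
    by_cases hx : x ∈ L
    · have h1 : ∑ i ∈ hfin.toFinset, ρ i x = 1 := by
        rw [← ρ.sum_eq_one hx, finsum_eq_sum_of_support_subset]
        intro i hi
        rw [Finite.coe_toFinset]
        exact ⟨x, hi, hx⟩
      rw [← Finset.sum_mul, ← Complex.ofReal_sum, h1, Complex.ofReal_one, one_mul]
    · simp [hbL a x hx]
  rw [hbsum]
  refine ZetaFam.sum _ fun i _ => hW i _ (ρ i).contMDiff.contDiff ?_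
    ((hρ i).trans inter_subset_left)
  exact Metric.isCompact_of_isClosed_isBounded (isClosed_tsupport _)
    (Metric.isBounded_ball.subset ((hρ i).trans inter_subset_right))

end Chart

end ResidueCurrents

end

noncomputable section

namespace ResidueCurrents

/-! ### The exterior product and the Leibniz rule -/

section Wedge

open Equiv

variable {V : Type*} [NormedAddCommGroup V] [NormedSpace ℝ V] {p q k : ℕ}

/-- The sum over all permutations of the arguments, with signs. -/
def antisymm {ι V : Type*} [Fintype ι] [DecidableEq ι] (F : (ι → V) → ℂ) (v : ι → V) : ℂ :=
  ∑ σ : Perm ι, ((Perm.sign σ : ℤ) : ℂ) * F (v ∘ σ)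

section Antisymm

variable {ι κ V : Type*} [Fintype ι] [DecidableEq ι] [Fintype κ] [DecidableEq κ]

theorem sign_mul_sign (σ : Perm ι) : ((Perm.sign σ : ℤ) : ℂ) * ((Perm.sign σ : ℤ) : ℂ) = 1 := by
  rw [← Int.cast_mul, ← Units.val_mul, Int.units_mul_self]
  simp

theorem antisymm_comp (F : (ι → V) → ℂ) (τ : Perm ι) (v : ι → V) :
    antisymm (fun v => F (v ∘ τ)) v = ((Perm.sign τ : ℤ) : ℂ) * antisymm F v := by
  rw [antisymm, antisymm, Finset.mul_sum]
  refine Fintype.sum_equiv (Equiv.mulRight τ) _ _ fun σ => ?_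
  have h : v ∘ ⇑(Equiv.mulRight τ σ) = (v ∘ σ) ∘ τ := rfl
  rw [h, Equiv.coe_mulRight, Perm.sign_mul, Units.val_mul, Int.cast_mul]
  linear_combination (((Perm.sign σ : ℤ) : ℂ) * F ((v ∘ σ) ∘ τ)) * (-(sign_mul_sign τ))

theorem antisymm_sum_comp (F : (ι → V) → ℂ) (φ : Perm κ → Perm ι)
    (hφ : ∀ τ, Perm.sign (φ τ) = Perm.sign τ) (v : ι → V) :
    antisymm (fun v => ∑ τ : Perm κ, ((Perm.sign τ : ℤ) : ℂ) * F (v ∘ φ τ)) v =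
      (Fintype.card κ).factorial * antisymm F v := by
  have h1 : antisymm (fun v => ∑ τ : Perm κ, ((Perm.sign τ : ℤ) : ℂ) * F (v ∘ φ τ)) v =
      ∑ τ : Perm κ, ((Perm.sign τ : ℤ) : ℂ) * antisymm (fun v => F (v ∘ φ τ)) v := by
    simp only [antisymm, Finset.mul_sum]
    rw [Finset.sum_comm]
    exact Finset.sum_congr rfl fun τ _ => Finset.sum_congr rfl fun σ _ => by ring
  rw [h1]
  simp only [antisymm_comp, hφ, ← mul_assoc, sign_mul_sign, one_mul]
  rw [Finset.sum_const, Finset.card_univ, Fintype.card_perm, nsmul_eq_mul]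

theorem antisymm_const_mul (c : ℂ) (F : (ι → V) → ℂ) (v : ι → V) :
    antisymm (fun v => c * F v) v = c * antisymm F v := by
  simp only [antisymm, Finset.mul_sum]
  exact Finset.sum_congr rfl fun σ _ => by ring

theorem antisymm_sum {α : Type*} (A : Finset α) (F : α → (ι → V) → ℂ) (v : ι → V) :
    antisymm (fun v => ∑ i ∈ A, F i v) v = ∑ i ∈ A, antisymm (F i) v := by
  simp only [antisymm, Finset.mul_sum]
  rw [Finset.sum_comm]

end Antisymm

theorem antisymm_alternating (a : V [⋀^Fin k]→L[ℝ] ℂ) (v : Fin k → V) :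
    antisymm (fun v => a v) v = k.factorial * a v := by
  have h : ∀ σ : Perm (Fin k), ((Perm.sign σ : ℤ) : ℂ) * a (v ∘ σ) = a v := by
    intro σ
    have := a.toAlternatingMap.map_perm v σ
    change a (v ∘ σ) = _ at this
    rw [this, Units.smul_def, zsmul_eq_mul, ← mul_assoc, sign_mul_sign, one_mul]
    rfl
  rw [antisymm, Finset.sum_congr rfl fun σ _ => h σ, Finset.sum_const, Finset.card_univ,
    Fintype.card_perm, Fintype.card_fin, nsmul_eq_mul]

/-- The identification of the index types of the factors of a product with that of the product. -/
def wedgeEquiv (h : p + q = k) : Fin p ⊕ Fin q ≃ Fin k := finSumFinEquiv.trans (finCongr h)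

theorem wedgeEquiv_inl (h : p + q = k) (i : Fin p) : (wedgeEquiv h (Sum.inl i) : ℕ) = i := rfl

theorem wedgeEquiv_inr (h : p + q = k) (j : Fin q) : (wedgeEquiv h (Sum.inr j) : ℕ) = p + j := rfl

/-- The exterior product as a normalized sum over all permutations. -/
theorem factorial_mul_wedgeAt (h : p + q = k) (a : V [⋀^Fin p]→L[ℝ] ℂ) (b : V [⋀^Fin q]→L[ℝ] ℂ)
    (v : Fin k → V) :
    (p.factorial * q.factorial : ℂ) * wedgeAt h a b v =
      antisymm (fun v => a (fun i => v (wedgeEquiv h (Sum.inl i))) *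
        b (fun j => v (wedgeEquiv h (Sum.inr j)))) v := by
  have h1 := congrArg (fun f => LinearMap.mul' ℝ ℂ (f fun i => v (wedgeEquiv h i)))
    (MultilinearMap.domCoprod_alternization_eq a.toAlternatingMap b.toAlternatingMap)
  simp only [Fintype.card_fin] at h1
  have h2 : LinearMap.mul' ℝ ℂ (((p.factorial * q.factorial) •
      (a.toAlternatingMap.domCoprod b.toAlternatingMap)) fun i => v (wedgeEquiv h i)) =
      (p.factorial * q.factorial : ℂ) * wedgeAt h a b v := by
    rw [AlternatingMap.smul_apply, map_nsmul, nsmul_eq_mul]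
    push_cast
    rfl
  rw [← h2, ← h1, MultilinearMap.alternatization_apply, map_sum, antisymm]
  refine Fintype.sum_equiv (wedgeEquiv h).permCongr _ _ fun σ => ?_
  rw [Perm.sign_permCongr, Units.smul_def, map_zsmul, zsmul_eq_mul]
  congr 1
  rw [MultilinearMap.domDomCongr_apply, MultilinearMap.domCoprod_apply, LinearMap.mul'_apply]
  simp only [Function.comp_apply, Equiv.permCongr_apply, Equiv.symm_apply_apply]
  rfl

theorem factorial_ne_zero' (p q : ℕ) : (p.factorial * q.factorial : ℂ) ≠ 0 :=
  mul_ne_zero (by exact_mod_cast p.factorial_ne_zero) (by exact_mod_cast q.factorial_ne_zero)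

theorem wedgeAt_ext (h : p + q = k) (a : V [⋀^Fin p]→L[ℝ] ℂ) (b : V [⋀^Fin q]→L[ℝ] ℂ)
    (v : Fin k → V) :
    wedgeAt h a b v = (p.factorial * q.factorial : ℂ)⁻¹ *
      antisymm (fun v => a (fun i => v (wedgeEquiv h (Sum.inl i))) *
        b (fun j => v (wedgeEquiv h (Sum.inr j)))) v := by
  rw [← factorial_mul_wedgeAt, ← mul_assoc, inv_mul_cancel₀ (factorial_ne_zero' p q), one_mul]

theorem norm_wedgeAt_le (h : p + q = k) (a : V [⋀^Fin p]→L[ℝ] ℂ) (b : V [⋀^Fin q]→L[ℝ] ℂ) :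
    ‖wedgeAt h a b‖ ≤ k.factorial * ‖a‖ * ‖b‖ := by
  refine ContinuousAlternatingMap.opNorm_le_bound _
    (mul_nonneg (mul_nonneg (Nat.cast_nonneg _) (norm_nonneg _)) (norm_nonneg _)) fun v => ?_
  rw [wedgeAt_ext, norm_mul, norm_inv]
  have h1 : (1 : ℝ) ≤ ‖(p.factorial * q.factorial : ℂ)‖ := by
    rw [← Nat.cast_mul, Complex.norm_natCast]
    exact_mod_cast Nat.mul_pos p.factorial_pos q.factorial_pos
  refine (mul_le_of_le_one_left (norm_nonneg _) (inv_le_one_of_one_le₀ h1)).trans ?_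
  rw [antisymm]
  refine (norm_sum_le _ _).trans ?_
  have h2 : ∀ σ : Perm (Fin k), ‖((Perm.sign σ : ℤ) : ℂ) *
      (a (fun i => (v ∘ σ) (wedgeEquiv h (Sum.inl i))) *
        b (fun j => (v ∘ σ) (wedgeEquiv h (Sum.inr j))))‖ ≤ ‖a‖ * ‖b‖ * ∏ i, ‖v i‖ := by
    intro σ
    have hs : ‖((Perm.sign σ : ℤ) : ℂ)‖ = 1 := by
      rcases Int.units_eq_one_or (Perm.sign σ) with h | h <;> simp [h]
    rw [norm_mul, hs, one_mul, norm_mul]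
    refine (mul_le_mul (a.le_opNorm _) (b.le_opNorm _) (norm_nonneg _) (by positivity)).trans
      (le_of_eq ?_)
    have h3 : ∏ i, ‖v i‖ = (∏ i, ‖(v ∘ σ) (wedgeEquiv h (Sum.inl i))‖) *
        ∏ j, ‖(v ∘ σ) (wedgeEquiv h (Sum.inr j))‖ := by
      rw [← Fintype.prod_sum_type fun x => ‖(v ∘ σ) (wedgeEquiv h x)‖,
        Equiv.prod_comp (wedgeEquiv h) fun x => ‖(v ∘ σ) x‖]
      exact (Equiv.prod_comp σ fun x => ‖v x‖).symm
    rw [h3]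
    ring
  refine (Finset.sum_le_sum fun σ _ => h2 σ).trans (le_of_eq ?_)
  rw [Finset.sum_const, Finset.card_univ, Fintype.card_perm, Fintype.card_fin, nsmul_eq_mul]
  ring

/-- The exterior product as a continuous bilinear map. -/
def wedgeCLM (V : Type*) [NormedAddCommGroup V] [NormedSpace ℝ V] (h : p + q = k) :
    (V [⋀^Fin p]→L[ℝ] ℂ) →L[ℝ] (V [⋀^Fin q]→L[ℝ] ℂ) →L[ℝ] (V [⋀^Fin k]→L[ℝ] ℂ) :=
  LinearMap.mkContinuous₂
    (LinearMap.mk₂ ℝ (wedgeAt h)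
      (fun a a' b => by
        ext v
        rw [ContinuousAlternatingMap.add_apply, wedgeAt_ext, wedgeAt_ext, wedgeAt_ext, ← mul_add]
        simp only [antisymm, ← Finset.sum_add_distrib, ContinuousAlternatingMap.add_apply, add_mul,
          mul_add])
      (fun c a b => by
        ext v
        rw [ContinuousAlternatingMap.smul_apply, wedgeAt_ext, wedgeAt_ext, Complex.real_smul]
        simp only [antisymm, Finset.mul_sum, ContinuousAlternatingMap.smul_apply, Complex.real_smul]
        exact Finset.sum_congr rfl fun σ _ => by ring)
      (fun a b b' => by
        ext v
        rw [ContinuousAlternatingMap.add_apply, wedgeAt_ext, wedgeAt_ext, wedgeAt_ext, ← mul_add]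
        simp only [antisymm, ← Finset.sum_add_distrib, ContinuousAlternatingMap.add_apply,
          mul_add])
      (fun c a b => by
        ext v
        rw [ContinuousAlternatingMap.smul_apply, wedgeAt_ext, wedgeAt_ext, Complex.real_smul]
        simp only [antisymm, Finset.mul_sum, ContinuousAlternatingMap.smul_apply, Complex.real_smul]
        exact Finset.sum_congr rfl fun σ _ => by ring))
    k.factorial fun a b => norm_wedgeAt_le h a b

theorem wedgeAt_smul_left (h : p + q = k) (c : ℂ) (a : V [⋀^Fin p]→L[ℝ] ℂ)
    (b : V [⋀^Fin q]→L[ℝ] ℂ) : wedgeAt h (c • a) b = c • wedgeAt h a b := by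
  ext v
  rw [ContinuousAlternatingMap.smul_apply, wedgeAt_ext, wedgeAt_ext, smul_eq_mul]
  simp only [antisymm, Finset.mul_sum, ContinuousAlternatingMap.smul_apply, smul_eq_mul]
  exact Finset.sum_congr rfl fun σ _ => by ring

theorem wedgeAt_smul_right (h : p + q = k) (c : ℂ) (a : V [⋀^Fin p]→L[ℝ] ℂ)
    (b : V [⋀^Fin q]→L[ℝ] ℂ) : wedgeAt h a (c • b) = c • wedgeAt h a b := by
  ext v
  rw [ContinuousAlternatingMap.smul_apply, wedgeAt_ext, wedgeAt_ext, smul_eq_mul]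
  simp only [antisymm, Finset.mul_sum, ContinuousAlternatingMap.smul_apply, smul_eq_mul]
  exact Finset.sum_congr rfl fun σ _ => by ring

theorem wedgeAt_add_smul_right (h : p + q = k) (c : ℂ) (a : V [⋀^Fin p]→L[ℝ] ℂ)
    (b b' : V [⋀^Fin q]→L[ℝ] ℂ) :
    wedgeAt h a (b + c • b') = wedgeAt h a b + c • wedgeAt h a b' := by
  rw [← wedgeAt_smul_right]
  exact map_add (wedgeCLM V h a) b (c • b')

theorem wedgeAt_add_smul_left (h : p + q = k) (c : ℂ) (a a' : V [⋀^Fin p]→L[ℝ] ℂ)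
    (b : V [⋀^Fin q]→L[ℝ] ℂ) :
    wedgeAt h (a + c • a') b = wedgeAt h a b + c • wedgeAt h a' b := by
  rw [← wedgeAt_smul_left]
  exact congrArg (fun L : (V [⋀^Fin q]→L[ℝ] ℂ) →L[ℝ] (V [⋀^Fin k]→L[ℝ] ℂ) => L b)
    (map_add (wedgeCLM V h) a (c • a'))

theorem wedgeAt_zero_right (h : p + q = k) (a : V [⋀^Fin p]→L[ℝ] ℂ) :
    wedgeAt h a (0 : V [⋀^Fin q]→L[ℝ] ℂ) = 0 := map_zero (wedgeCLM V h a)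

theorem wedgeAt_zero_left (h : p + q = k) (b : V [⋀^Fin q]→L[ℝ] ℂ) :
    wedgeAt h (0 : V [⋀^Fin p]→L[ℝ] ℂ) b = 0 :=
  congrArg (fun L : (V [⋀^Fin q]→L[ℝ] ℂ) →L[ℝ] (V [⋀^Fin k]→L[ℝ] ℂ) => L b)
    (map_zero (wedgeCLM V h))

theorem wedgeAt_comp {V' : Type*} [NormedAddCommGroup V'] [NormedSpace ℝ V'] (h : p + q = k)
    (a : V [⋀^Fin p]→L[ℝ] ℂ) (b : V [⋀^Fin q]→L[ℝ] ℂ) (A : V' →L[ℝ] V) :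
    (wedgeAt h a b).compContinuousLinearMap A =
      wedgeAt h (a.compContinuousLinearMap A) (b.compContinuousLinearMap A) := by
  ext v
  rw [wedgeAt_ext, ContinuousAlternatingMap.compContinuousLinearMap_apply, wedgeAt_ext]
  rfl

/-- The alternation of a linear map with alternating values, as a normalized sum over all
permutations. -/
theorem factorial_mul_alternatizeUncurryFin (L : V →L[ℝ] V [⋀^Fin k]→L[ℝ] ℂ)
    (v : Fin (k + 1) → V) :
    (k.factorial : ℂ) * ContinuousAlternatingMap.alternatizeUncurryFin L v =
      antisymm (fun v => L (v 0) (fun i => v i.succ)) v := by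
  have h1 := antisymm_alternating (ContinuousAlternatingMap.alternatizeUncurryFin L) v
  have h2 : ∀ v : Fin (k + 1) → V, ContinuousAlternatingMap.alternatizeUncurryFin L v =
      ∑ i : Fin (k + 1), ((Perm.sign i.cycleRange.symm : ℤ) : ℂ) *
        (fun v : Fin (k + 1) → V => L (v 0) (fun i => v i.succ)) (v ∘ i.cycleRange.symm) := by
    intro v
    rw [ContinuousAlternatingMap.alternatizeUncurryFin_apply]
    refine Finset.sum_congr rfl fun i _ => ?_
    rw [Perm.sign_symm, Fin.sign_cycleRange, zsmul_eq_mul]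
    simp only [Function.comp_apply, Fin.cycleRange_symm_zero, Fin.cycleRange_symm_succ]
    push_cast
    rfl
  have h3 : antisymm (fun v => ContinuousAlternatingMap.alternatizeUncurryFin L v) v =
      (k + 1) * antisymm (fun v => L (v 0) (fun i => v i.succ)) v := by
    set Q : (Fin (k + 1) → V) → ℂ := fun v => L (v 0) (fun i => v i.succ) with hQ
    simp only [h2]
    rw [antisymm_sum, Finset.sum_congr rfl fun i _ => (show _ = antisymm Q v by
      rw [antisymm_const_mul, antisymm_comp Q, ← mul_assoc, sign_mul_sign, one_mul])]
    rw [Finset.sum_const, Finset.card_univ, Fintype.card_fin, nsmul_eq_mul]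
    push_cast
    rfl
  rw [h3, Nat.factorial_succ] at h1
  push_cast at h1
  have hk : (k + 1 : ℂ) ≠ 0 := by exact_mod_cast Nat.succ_ne_zero k
  exact mul_left_cancel₀ hk (by rw [h1]; ring)

/-- Extension of a permutation of `Fin k` to `Fin (k + 1)`, fixing `0`. -/
def extendPerm (τ : Perm (Fin k)) : Perm (Fin (k + 1)) := Perm.decomposeFin.symm (0, τ)

theorem sign_extendPerm (τ : Perm (Fin k)) : Perm.sign (extendPerm τ) = Perm.sign τ := by
  simp [extendPerm]

theorem extendPerm_zero (τ : Perm (Fin k)) : extendPerm τ 0 = 0 := by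
  simp [extendPerm]

theorem extendPerm_succ (τ : Perm (Fin k)) (i : Fin k) : extendPerm τ i.succ = (τ i).succ := by
  simp [extendPerm]

/-- The alternation of a linear function with values in decomposable forms, as a sum over all
permutations. -/
theorem factorial_mul_alternatize_wedge (h : p + q = k)
    (c : V → (V [⋀^Fin p]→L[ℝ] ℂ)) (d : V → (V [⋀^Fin q]→L[ℝ] ℂ))
    (L : V →L[ℝ] V [⋀^Fin k]→L[ℝ] ℂ) (hL : ∀ x, L x = wedgeAt h (c x) (d x))
    (v : Fin (k + 1) → V) :
    (p.factorial * q.factorial : ℂ) * ContinuousAlternatingMap.alternatizeUncurryFin L v =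
      antisymm (fun v => c (v 0) (fun i => v (wedgeEquiv h (Sum.inl i)).succ) *
        d (v 0) (fun j => v (wedgeEquiv h (Sum.inr j)).succ)) v := by
  have hk : (k.factorial : ℂ) ≠ 0 := by exact_mod_cast k.factorial_ne_zero
  refine mul_left_cancel₀ hk ?_
  rw [mul_left_comm, factorial_mul_alternatizeUncurryFin, ← antisymm_const_mul]
  have h1 := antisymm_sum_comp (fun v : Fin (k + 1) → V =>
    c (v 0) (fun i => v (wedgeEquiv h (Sum.inl i)).succ) *
        d (v 0) (fun j => v (wedgeEquiv h (Sum.inr j)).succ)) extendPerm sign_extendPerm v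
  rw [Fintype.card_fin] at h1
  rw [← h1]
  congr 1
  funext v
  rw [hL, factorial_mul_wedgeAt, antisymm]
  simp only [Function.comp_apply, extendPerm_zero, extendPerm_succ]

/-- Differentiation of the first factor: alternation commutes with the exterior product. -/
theorem wedgeAt_alternatize_left (h : p + q = k) (h' : p + 1 + q = k + 1)
    (M : V →L[ℝ] V [⋀^Fin p]→L[ℝ] ℂ) (b : V [⋀^Fin q]→L[ℝ] ℂ)
    (L : V →L[ℝ] V [⋀^Fin k]→L[ℝ] ℂ) (hL : ∀ x, L x = wedgeAt h (M x) b) :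
    ContinuousAlternatingMap.alternatizeUncurryFin L =
      wedgeAt h' (ContinuousAlternatingMap.alternatizeUncurryFin M) b := by
  ext v
  refine mul_left_cancel₀ (factorial_ne_zero' p q) ?_
  rw [factorial_mul_alternatize_wedge h (fun x => M x) (fun _ => b) L hL]
  have hp : ((p + 1 : ℕ) : ℂ) ≠ 0 := by exact_mod_cast Nat.succ_ne_zero p
  refine mul_left_cancel₀ (mul_ne_zero hp (by exact_mod_cast p.factorial_ne_zero :
    (p.factorial : ℂ) ≠ 0)) ?_
  have h2 := factorial_mul_wedgeAt h' (ContinuousAlternatingMap.alternatizeUncurryFin M) b v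
  have h3 : (((p + 1 : ℕ) : ℂ) * p.factorial) * ((p.factorial * q.factorial : ℂ) *
      wedgeAt h' (ContinuousAlternatingMap.alternatizeUncurryFin M) b v) =
      p.factorial * (((p + 1).factorial * q.factorial : ℂ) *
        wedgeAt h' (ContinuousAlternatingMap.alternatizeUncurryFin M) b v) := by
    rw [Nat.factorial_succ]
    push_cast
    ring
  rw [h3, h2, ← antisymm_const_mul (p.factorial : ℂ)]
  -- A permutation of the indices of the first factor is extended by the identity.
  set φ : Perm (Fin (p + 1)) → Perm (Fin (k + 1)) := fun τ =>
    (wedgeEquiv h').permCongr (Perm.sumCongr τ 1) with hφdef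
  have hφ : ∀ τ, Perm.sign (φ τ) = Perm.sign τ := fun τ => by
    simp only [hφdef, Perm.sign_permCongr, Perm.sign_sumCongr, Perm.sign_one, mul_one]
  have h4 := antisymm_sum_comp (fun v : Fin (k + 1) → V =>
    M (v 0) (fun i => v (wedgeEquiv h (Sum.inl i)).succ) *
        b (fun j => v (wedgeEquiv h (Sum.inr j)).succ)) φ hφ v
  rw [Fintype.card_fin, Nat.factorial_succ, Nat.cast_mul] at h4
  rw [← h4]
  congr 1
  funext v
  rw [← mul_assoc, factorial_mul_alternatizeUncurryFin, antisymm, Finset.sum_mul]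
  refine Finset.sum_congr rfl fun τ _ => ?_
  have e0 : (0 : Fin (k + 1)) = wedgeEquiv h' (Sum.inl 0) := Fin.ext rfl
  have e1 : ∀ i : Fin p, (wedgeEquiv h (Sum.inl i)).succ = wedgeEquiv h' (Sum.inl i.succ) :=
    fun i => Fin.ext (by simp [wedgeEquiv_inl])
  have e2 : ∀ j : Fin q, (wedgeEquiv h (Sum.inr j)).succ = wedgeEquiv h' (Sum.inr j) :=
    fun j => Fin.ext (by simp [wedgeEquiv_inr]; omega)
  simp only [Function.comp_apply, e0, e1, e2, hφdef, Equiv.permCongr_apply,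
    Equiv.symm_apply_apply, Perm.sumCongr_apply, Sum.map_inl, Sum.map_inr, Perm.coe_one, id_eq]
  ring

/-- Differentiation of the second factor: the new argument passes the `p` arguments of the first
factor, which gives the sign. -/
theorem wedgeAt_alternatize_right (h : p + q = k) (h' : p + (q + 1) = k + 1)
    (M : V →L[ℝ] V [⋀^Fin q]→L[ℝ] ℂ) (a : V [⋀^Fin p]→L[ℝ] ℂ)
    (L : V →L[ℝ] V [⋀^Fin k]→L[ℝ] ℂ) (hL : ∀ x, L x = wedgeAt h a (M x)) :
    ContinuousAlternatingMap.alternatizeUncurryFin L =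
      (-1 : ℂ) ^ p • wedgeAt h' a (ContinuousAlternatingMap.alternatizeUncurryFin M) := by
  ext v
  rw [ContinuousAlternatingMap.smul_apply, smul_eq_mul]
  refine mul_left_cancel₀ (factorial_ne_zero' p q) ?_
  rw [factorial_mul_alternatize_wedge h (fun _ => a) (fun x => M x) L hL]
  have hq : ((q + 1 : ℕ) : ℂ) ≠ 0 := by exact_mod_cast Nat.succ_ne_zero q
  refine mul_left_cancel₀ (mul_ne_zero hq (by exact_mod_cast q.factorial_ne_zero :
    (q.factorial : ℂ) ≠ 0)) ?_
  have h2 := factorial_mul_wedgeAt h' a (ContinuousAlternatingMap.alternatizeUncurryFin M) v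
  have h3 : (((q + 1 : ℕ) : ℂ) * q.factorial) * ((p.factorial * q.factorial : ℂ) *
      ((-1 : ℂ) ^ p * wedgeAt h' a (ContinuousAlternatingMap.alternatizeUncurryFin M) v)) =
      (-1 : ℂ) ^ p * (q.factorial * ((p.factorial * (q + 1).factorial : ℂ) *
        wedgeAt h' a (ContinuousAlternatingMap.alternatizeUncurryFin M) v)) := by
    rw [Nat.factorial_succ]
    push_cast
    ring
  rw [h3, h2, ← antisymm_const_mul (q.factorial : ℂ)]
  -- A permutation of the indices of the second factor is extended by the identity. The position
  -- of the differentiated slot accounts for the sign of a cycle.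
  set φ : Perm (Fin (q + 1)) → Perm (Fin (k + 1)) := fun τ =>
    (wedgeEquiv h').permCongr (Perm.sumCongr 1 τ) with hφdef
  have hφ : ∀ τ, Perm.sign (φ τ) = Perm.sign τ := fun τ => by
    simp only [hφdef, Perm.sign_permCongr, Perm.sign_sumCongr, Perm.sign_one, one_mul]
  set pp : Fin (k + 1) := ⟨p, by omega⟩ with hpp
  set Z : (Fin (k + 1) → V) → ℂ := fun v =>
    a (fun i => v (wedgeEquiv h (Sum.inl i)).succ) *
        M (v 0) (fun j => v (wedgeEquiv h (Sum.inr j)).succ) with hZ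
  have h4 := antisymm_sum_comp (fun v => Z (v ∘ pp.cycleRange.symm)) φ hφ v
  rw [antisymm_comp, Perm.sign_symm, Fin.sign_cycleRange, Fintype.card_fin, Nat.factorial_succ,
    Nat.cast_mul] at h4
  have h5 : (((((-1 : ℤˣ) ^ (pp : ℕ) : ℤˣ) : ℤ)) : ℂ) = (-1 : ℂ) ^ p := by
    push_cast
    rfl
  rw [h5] at h4
  have h6 : (-1 : ℂ) ^ p * (-1 : ℂ) ^ p = 1 := by
    rw [← mul_pow]
    simp
  have h7 : ((q + 1 : ℕ) : ℂ) * q.factorial * antisymm Z v =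
      (-1 : ℂ) ^ p * antisymm (fun v => ∑ τ : Perm (Fin (q + 1)), ((Perm.sign τ : ℤ) : ℂ) *
        Z ((v ∘ φ τ) ∘ pp.cycleRange.symm)) v := by
    rw [h4]
    linear_combination (-(((q + 1 : ℕ) : ℂ) * q.factorial * antisymm Z v)) * h6
  rw [h7]
  congr 2
  funext v
  rw [mul_left_comm, factorial_mul_alternatizeUncurryFin, antisymm, Finset.mul_sum]
  refine Finset.sum_congr rfl fun τ _ => ?_
  have e0 : pp = wedgeEquiv h' (Sum.inr 0) := Fin.ext rfl
  have e1 : ∀ i : Fin p, pp.succAbove (wedgeEquiv h (Sum.inl i)) = wedgeEquiv h' (Sum.inl i) := by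
    intro i
    rw [Fin.succAbove_of_castSucc_lt _ _ (by
      rw [Fin.lt_def]
      simp only [Fin.val_castSucc, wedgeEquiv_inl, hpp]
      exact i.2)]
    exact Fin.ext rfl
  have e2 : ∀ j : Fin q,
      pp.succAbove (wedgeEquiv h (Sum.inr j)) = wedgeEquiv h' (Sum.inr j.succ) := by
    intro j
    rw [Fin.succAbove_of_le_castSucc _ _ (by
      rw [Fin.le_def]
      simp only [Fin.val_castSucc, wedgeEquiv_inr, hpp]
      omega)]
    exact Fin.ext (by simp [wedgeEquiv_inr]; omega)
  simp only [hZ, Function.comp_apply, Fin.cycleRange_symm_zero, Fin.cycleRange_symm_succ, e1, e2,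
    hφdef, Equiv.permCongr_apply, Equiv.symm_apply_apply, Perm.sumCongr_apply, Sum.map_inl,
    Sum.map_inr, Perm.coe_one, id_eq]
  rw [e0]
  simp only [Equiv.symm_apply_apply, Sum.map_inr]
  ring

/-- The Leibniz rule for the exterior derivative on a vector space. -/
theorem extDeriv_wedgeAt (h : p + q = k) (h' : p + 1 + q = k + 1) (h'' : p + (q + 1) = k + 1)
    {A : V → V [⋀^Fin p]→L[ℝ] ℂ} {B : V → V [⋀^Fin q]→L[ℝ] ℂ} {z : V}
    (hA : DifferentiableAt ℝ A z) (hB : DifferentiableAt ℝ B z) :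
    extDeriv (fun y => wedgeAt h (A y) (B y)) z =
      wedgeAt h' (extDeriv A z) (B z) + (-1 : ℂ) ^ p • wedgeAt h'' (A z) (extDeriv B z) := by
  have hd := ((wedgeCLM V h).hasFDerivAt_of_bilinear hA.hasFDerivAt hB.hasFDerivAt).fderiv
  change fderiv ℝ (fun y => wedgeAt h (A y) (B y)) z = _ at hd
  rw [extDeriv, hd, ContinuousAlternatingMap.alternatizeUncurryFin_add]
  refine (add_comm _ _).trans ?_
  congr 1
  · exact wedgeAt_alternatize_left h h' (fderiv ℝ A z) (B z) _ fun x => rfl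
  · exact wedgeAt_alternatize_right h h'' (fderiv ℝ B z) (A z) _ fun x => rfl

end Wedge

end ResidueCurrents

end

noncomputable section

namespace ResidueCurrents

/-! ### Quadratic lower bounds for nonnegative functions with nondegenerate normal Hessian -/

section Hessian

variable {n m : ℕ} {U : Set (Euc n)} {G : Euc n → ℝ}

theorem norm_sub_normalProj_le (x : Euc n) : ‖x - normalProj n m x‖ ≤ ‖x‖ := by
  rw [EuclideanSpace.norm_eq, EuclideanSpace.norm_eq]
  refine Real.sqrt_le_sqrt (Finset.sum_le_sum fun i _ => ?_)
  rw [PiLp.sub_apply, normalProj_apply]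
  split_ifs
  · simp [sq_nonneg]
  · simp

theorem finrank_range_normalProj_le : Module.finrank ℝ (LinearMap.range
    (normalProj n m).toLinearMap) ≤ m := by
  classical
  set A : Finset (Euc n) := (Finset.univ.filter fun i : Fin n => (i : ℕ) < m).image
    fun i => EuclideanSpace.single i (1 : ℝ) with hA
  have h1 : LinearMap.range (normalProj n m).toLinearMap ≤ Submodule.span ℝ (A : Set (Euc n)) := by
    rintro _ ⟨x, rfl⟩
    change normalProj n m x ∈ _
    rw [normalProj_eq_sum]
    refine Submodule.sum_mem _ fun i hi => Submodule.smul_mem _ _ (Submodule.subset_span ?_)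
    simp only [hA, Finset.coe_image, mem_image]
    exact ⟨i, hi, rfl⟩
  refine (Submodule.finrank_mono h1).trans ((finrank_span_finset_le_card A).trans ?_)
  refine Finset.card_image_le.trans ?_
  have h2 : ((Finset.univ.filter fun i : Fin n => (i : ℕ) < m).image fun i : Fin n => (i : ℕ)) ⊆
      Finset.range m := by
    intro j
    simp only [Finset.mem_image, Finset.mem_filter, Finset.mem_univ, true_and, Finset.mem_range]
    rintro ⟨i, hi, rfl⟩
    exact hi
  have h3 := Finset.card_le_card h2
  rwa [Finset.card_image_of_injective _ Fin.val_injective, Finset.card_range] at h3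

theorem hasDerivAt_line (hU : IsOpen U) (hG : ContDiffOn ℝ ∞ G U) {y v : Euc n} {t : ℝ}
    (h : y + t • v ∈ U) : HasDerivAt (fun t : ℝ => G (y + t • v)) (fderiv ℝ G (y + t • v) v) t := by
  have h1 : HasFDerivAt G (fderiv ℝ G (y + t • v)) (y + t • v) :=
    ((hG.contDiffAt (hU.mem_nhds h)).differentiableAt (by simp)).hasFDerivAt
  have h2 : HasDerivAt (fun t : ℝ => y + t • v) v t := by
    simpa using ((hasDerivAt_id t).smul_const v).const_add y
  exact h1.comp_hasDerivAt t h2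

theorem hasDerivAt_fderiv_line (hU : IsOpen U) (hG : ContDiffOn ℝ ∞ G U) {y v : Euc n} {t : ℝ}
    (h : y + t • v ∈ U) : HasDerivAt (fun t : ℝ => fderiv ℝ G (y + t • v))
      (fderiv ℝ (fderiv ℝ G) (y + t • v) v) t := by
  have h1 : HasFDerivAt (fderiv ℝ G) (fderiv ℝ (fderiv ℝ G) (y + t • v)) (y + t • v) :=
    (((hG.contDiffAt (hU.mem_nhds h)).fderiv_right (m := ∞) (by simp)).differentiableAt
      (by simp)).hasFDerivAt
  have h2 : HasDerivAt (fun t : ℝ => y + t • v) v t := by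
    simpa using ((hasDerivAt_id t).smul_const v).const_add y
  exact h1.comp_hasDerivAt t h2

theorem eventually_line_mem (hU : IsOpen U) {y : Euc n} (hy : y ∈ U) (v : Euc n) :
    ∀ᶠ t : ℝ in 𝓝 0, y + t • v ∈ U := by
  have h : ContinuousAt (fun t : ℝ => y + t • v) 0 := by fun_prop
  refine h.eventually_mem (hU.mem_nhds ?_)
  simpa using hy

theorem fderiv_eq_zero_of_nonneg (hU : IsOpen U) (h0 : ∀ x ∈ U, 0 ≤ G x) {x : Euc n}
    (hx : x ∈ U) (hGx : G x = 0) : fderiv ℝ G x = 0 := by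
  have h : IsLocalMin G x := by
    filter_upwards [hU.mem_nhds hx] with y hy
    rw [hGx]
    exact h0 y hy
  exact h.fderiv_eq_zero

/-- The Hessian of a nonnegative function is positive semidefinite at a zero. -/
theorem hessian_nonneg (hU : IsOpen U) (hG : ContDiffOn ℝ ∞ G U) (h0 : ∀ x ∈ U, 0 ≤ G x)
    {x : Euc n} (hx : x ∈ U) (hGx : G x = 0) (v : Euc n) :
    0 ≤ fderiv ℝ (fderiv ℝ G) x v v := by
  by_contra! hcon
  set f : ℝ → ℝ := fun t => G (x + t • v) with hf
  have hx0 : x + (0 : ℝ) • v ∈ U := by simpa using hx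
  have h1 : deriv f =ᶠ[𝓝 0] fun t => fderiv ℝ G (x + t • v) v := by
    filter_upwards [eventually_line_mem hU hx v] with t ht
    exact (hasDerivAt_line hU hG ht).deriv
  have h2 : deriv (deriv f) 0 = fderiv ℝ (fderiv ℝ G) x v v := by
    rw [h1.deriv_eq]
    have := (hasDerivAt_fderiv_line hU hG hx0).clm_apply (hasDerivAt_const (0 : ℝ) v)
    simpa using this.deriv
  have h3 : deriv f 0 = 0 := by
    rw [h1.self_of_nhds]
    simp [fderiv_eq_zero_of_nonneg hU h0 hx hGx]
  have h4 := isLocalMax_of_deriv_deriv_neg (h2.trans_lt hcon) h3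
    (hasDerivAt_line hU hG hx0).continuousAt
  -- A local maximum with value `0` of the nonnegative function `f` forces `f = 0` near `0`.
  have h5 : f =ᶠ[𝓝 0] fun _ => 0 := by
    filter_upwards [h4, eventually_line_mem hU hx v] with t ht ht'
    refine le_antisymm ?_ (h0 _ ht')
    simpa [hf, hGx] using ht
  rw [h5.deriv.deriv_eq] at h2
  simp only [deriv_const', deriv_const] at h2
  exact hcon.ne h2.symm

theorem hessian_symm (hU : IsOpen U) (hG : ContDiffOn ℝ ∞ G U) {x : Euc n} (hx : x ∈ U)
    (v w : Euc n) : fderiv ℝ (fderiv ℝ G) x v w = fderiv ℝ (fderiv ℝ G) x w v :=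
  (hG.contDiffAt (hU.mem_nhds hx)).isSymmSndFDerivAt two_le_smooth v w

/-- An isotropic vector of a positive semidefinite form lies in its kernel. -/
theorem hessian_apply_eq_zero (hU : IsOpen U) (hG : ContDiffOn ℝ ∞ G U) (h0 : ∀ x ∈ U, 0 ≤ G x)
    {x : Euc n} (hx : x ∈ U) (hGx : G x = 0) {v : Euc n}
    (hv : fderiv ℝ (fderiv ℝ G) x v v = 0) : fderiv ℝ (fderiv ℝ G) x v = 0 := by
  ext w
  set H := fderiv ℝ (fderiv ℝ G) x with hH
  have h1 : ∀ t : ℝ, 0 ≤ 2 * t * H v w + t ^ 2 * H w w := by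
    intro t
    have := hessian_nonneg hU hG h0 hx hGx (v + t • w)
    rw [← hH] at this
    simp only [map_add, map_smul, add_apply, smul_apply, smul_eq_mul, hv,
      hH ▸ hessian_symm hU hG hx w v] at this
    linarith
  have h2 : 0 ≤ H w w := hessian_nonneg hU hG h0 hx hGx w
  have h3 := h1 (-(H v w) / (H w w + 1))
  have h4 : 2 * (-(H v w) / (H w w + 1)) * H v w + (-(H v w) / (H w w + 1)) ^ 2 * H w w =
      -((H v w) ^ 2 * (H w w + 2) / (H w w + 1) ^ 2) := by
    field_simp
    ring
  rw [h4] at h3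
  have h5 : 0 ≤ (H v w) ^ 2 * (H w w + 2) / (H w w + 1) ^ 2 := by positivity
  have h6 : (H v w) ^ 2 * (H w w + 2) / (H w w + 1) ^ 2 = 0 := by linarith
  have h7 : (H w w + 1) ^ 2 ≠ 0 := by positivity
  have h8 : H w w + 2 ≠ 0 := by positivity
  simpa [h7, h8] using h6

/-- A nonnegative function that vanishes on the coordinate subspace of codimension `m`, with
Hessian of rank `m` at `x`, has a nondegenerate Hessian in the normal directions. -/
theorem normalProj_eq_zero_of_hessian (hU : IsOpen U) (hG : ContDiffOn ℝ ∞ G U)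
    (h0 : ∀ x ∈ U, 0 ≤ G x) (hz : ∀ x ∈ U, normalProj n m x = 0 → G x = 0) {x : Euc n}
    (hx : x ∈ U) (hPx : normalProj n m x = 0)
    (hrank : Module.finrank ℝ (LinearMap.range (fderiv ℝ (fderiv ℝ G) x).toLinearMap) = m)
    {v : Euc n} (hv : fderiv ℝ (fderiv ℝ G) x v v = 0) : normalProj n m v = 0 := by
  have hker : LinearMap.ker (normalProj n m).toLinearMap ≤
      LinearMap.ker (fderiv ℝ (fderiv ℝ G) x).toLinearMap := by
    intro u hu
    have hu' : normalProj n m u = 0 := hu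
    change fderiv ℝ (fderiv ℝ G) x u = 0
    have hx0 : x + (0 : ℝ) • u ∈ U := by simpa using hx
    have h1 := (hasDerivAt_fderiv_line hU hG hx0).deriv
    have h2 : (fun t : ℝ => fderiv ℝ G (x + t • u)) =ᶠ[𝓝 0] fun _ => 0 := by
      filter_upwards [eventually_line_mem hU hx u] with t ht
      exact fderiv_eq_zero_of_nonneg hU h0 ht (hz _ ht (by simp [hPx, hu']))
    rw [h2.deriv_eq, deriv_const] at h1
    simpa using h1.symm
  have hr1 := LinearMap.finrank_range_add_finrank_ker (normalProj n m).toLinearMap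
  have hr2 := LinearMap.finrank_range_add_finrank_ker (fderiv ℝ (fderiv ℝ G) x).toLinearMap
  have hr3 := finrank_range_normalProj_le (n := n) (m := m)
  have heq := Submodule.eq_of_le_of_finrank_le hker (by omega)
  have h1 : v ∈ LinearMap.ker (fderiv ℝ (fderiv ℝ G) x).toLinearMap :=
    hessian_apply_eq_zero hU hG h0 hx (hz x hx hPx) hv
  rw [← heq] at h1
  exact h1

/-- Near a zero at which the Hessian has rank `m`, the function is bounded below by a multiple of
the square of the distance from the subspace: the Hessian is positive definite on the normal
space, and stays so nearby. -/
theorem exists_quadratic_lower_bound (hU : IsOpen U) (hG : ContDiffOn ℝ ∞ G U)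
    (h0 : ∀ x ∈ U, 0 ≤ G x) (hz : ∀ x ∈ U, normalProj n m x = 0 → G x = 0) {x : Euc n}
    (hx : x ∈ U) (hPx : normalProj n m x = 0)
    (hrank : Module.finrank ℝ (LinearMap.range (fderiv ℝ (fderiv ℝ G) x).toLinearMap) = m) :
    ∃ r > 0, ∃ c > 0, Metric.ball x r ⊆ U ∧
      ∀ y ∈ Metric.ball x r, c * ‖normalProj n m y‖ ^ 2 ≤ G y := by
  set H := fderiv ℝ (fderiv ℝ G) x with hH
  -- A positive minimum of the Hessian on the unit sphere of the normal space.
  have hpos : ∃ c > 0, ∀ v, normalProj n m v = v → c * ‖v‖ ^ 2 ≤ H v v := by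
    set S := {v : Euc n | normalProj n m v = v} ∩ Metric.sphere 0 1 with hS
    have hSc : IsCompact S := (isCompact_sphere 0 1).inter_left
      (isClosed_eq (normalProj n m).continuous continuous_id)
    have hcont : Continuous fun v => H v v := by fun_prop
    have hscale : ∀ c : ℝ, (∀ v ∈ S, c ≤ H v v) → ∀ v, normalProj n m v = v →
        c * ‖v‖ ^ 2 ≤ H v v := by
      intro c hc v hv
      by_cases hv0 : v = 0
      · simp [hv0]
      have hn : ‖v‖ ≠ 0 := norm_ne_zero_iff.2 hv0
      have h1 := hc (‖v‖⁻¹ • v) ⟨by simp [hv], by simp [norm_smul, hn]⟩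
      simp only [map_smul, smul_apply, smul_eq_mul] at h1
      have h2 : (0 : ℝ) ≤ ‖v‖ ^ 2 := sq_nonneg _
      calc c * ‖v‖ ^ 2 ≤ (‖v‖⁻¹ * (‖v‖⁻¹ * H v v)) * ‖v‖ ^ 2 := mul_le_mul_of_nonneg_right h1 h2
        _ = H v v := by field_simp
    rcases S.eq_empty_or_nonempty with hemp | hne
    · exact ⟨1, one_pos, hscale 1 fun v hv => by simp [hemp] at hv⟩
    · obtain ⟨v, hv, hmin⟩ := hSc.exists_isMinOn hne hcont.continuousOn
      refine ⟨H v v, ?_, hscale _ fun w hw => hmin hw⟩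
      refine lt_of_le_of_ne (hessian_nonneg hU hG h0 hx (hz x hx hPx) v) fun h => ?_
      have := normalProj_eq_zero_of_hessian hU hG h0 hz hx hPx hrank h.symm
      have hv2 := hv.2
      rw [hv.1] at this
      simp [this] at hv2
  obtain ⟨c, hc, hcH⟩ := hpos
  have hcontH : ContinuousAt (fun y => ‖fderiv ℝ (fderiv ℝ G) y - H‖) x :=
    ((((hG.contDiffAt (hU.mem_nhds hx)).fderiv_right (m := ∞) (by simp)).fderiv_right
      (m := ∞) (by simp)).sub contDiffAt_const).continuousAt.norm
  have hev : ∀ᶠ y in 𝓝 x, y ∈ U ∧ ‖fderiv ℝ (fderiv ℝ G) y - H‖ < c / 2 :=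
    Eventually.and (hU.mem_nhds hx)
      (hcontH.eventually_lt continuousAt_const (by
        rw [← hH, sub_self]
        exact (norm_zero (E := Euc n →L[ℝ] Euc n →L[ℝ] ℝ)).trans_lt (half_pos hc)))
  obtain ⟨r, hr, hball⟩ := Metric.eventually_nhds_iff_ball.1 hev
  refine ⟨r, hr, c / 4, by positivity, fun y hy => (hball y hy).1, fun y hy => ?_⟩
  set u := normalProj n m y with hu
  set w := y - u with hw
  have hPu : normalProj n m u = u := normalProj_normalProj m y
  have hPw : normalProj n m w = 0 := by rw [hw, map_sub, hPu, ← hu, sub_self]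
  have hwball : w ∈ Metric.ball x r := by
    rw [mem_ball_iff_norm] at hy ⊢
    have : w - x = (y - x) - normalProj n m (y - x) := by
      rw [map_sub, hPx, hw, hu]
      abel
    rw [this]
    exact (norm_sub_normalProj_le _).trans_lt hy
  have hseg : ∀ t ∈ Icc (0 : ℝ) 1, w + t • u ∈ Metric.ball x r := by
    intro t ht
    have := (convex_ball x r).add_smul_sub_mem hwball hy ht
    rwa [hw, sub_sub_cancel, ← hw] at this
  have hwU : w ∈ U := (hball w hwball).1
  have hD : fderiv ℝ G w = 0 := fderiv_eq_zero_of_nonneg hU h0 hwU (hz w hwU hPw)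
  -- Two integrations of the lower bound for the second derivative along the segment.
  have hd1 : ∀ t ∈ Icc (0 : ℝ) 1, HasDerivAt (fun t : ℝ => fderiv ℝ G (w + t • u) u -
      c / 2 * ‖u‖ ^ 2 * t) (fderiv ℝ (fderiv ℝ G) (w + t • u) u u - c / 2 * ‖u‖ ^ 2) t := by
    intro t ht
    have h1 := (hasDerivAt_fderiv_line hU hG (hball _ (hseg t ht)).1).clm_apply
      (hasDerivAt_const t u)
    have h2 := h1.sub ((hasDerivAt_id t).const_mul (c / 2 * ‖u‖ ^ 2))
    rw [map_zero, add_zero, mul_one] at h2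
    exact h2
  have hd2 : ∀ t ∈ Icc (0 : ℝ) 1, HasDerivAt (fun t : ℝ => G (w + t • u) -
      c / 4 * ‖u‖ ^ 2 * t ^ 2) (fderiv ℝ G (w + t • u) u - c / 2 * ‖u‖ ^ 2 * t) t := by
    intro t ht
    have h1 := (hasDerivAt_line hU hG (hball _ (hseg t ht)).1).sub
      (((hasDerivAt_id t).pow 2).const_mul (c / 4 * ‖u‖ ^ 2))
    refine h1.congr_deriv ?_
    simp only [id_eq]
    push_cast
    ring
  have hint : interior (Icc (0 : ℝ) 1) ⊆ Icc 0 1 := interior_subset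
  have hmono1 : MonotoneOn (fun t : ℝ => fderiv ℝ G (w + t • u) u - c / 2 * ‖u‖ ^ 2 * t)
      (Icc 0 1) := by
    refine monotoneOn_of_deriv_nonneg (convex_Icc 0 1)
      (fun t ht => (hd1 t ht).continuousAt.continuousWithinAt)
      (fun t ht => (hd1 t (hint ht)).differentiableAt.differentiableWithinAt) fun t ht => ?_
    rw [(hd1 t (hint ht)).deriv]
    have h1 := (hball _ (hseg t (hint ht))).2
    have h2 : ‖(fderiv ℝ (fderiv ℝ G) (w + t • u) - H) u u‖ ≤ c / 2 * ‖u‖ * ‖u‖ :=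
      ((fderiv ℝ (fderiv ℝ G) (w + t • u) - H).le_opNorm₂ u u).trans (by gcongr)
    rw [sub_apply, sub_apply, Real.norm_eq_abs] at h2
    have h3 := (abs_le.1 h2).1
    have h4 := hcH u hPu
    nlinarith
  have hmono2 : MonotoneOn (fun t : ℝ => G (w + t • u) - c / 4 * ‖u‖ ^ 2 * t ^ 2) (Icc 0 1) := by
    refine monotoneOn_of_deriv_nonneg (convex_Icc 0 1)
      (fun t ht => (hd2 t ht).continuousAt.continuousWithinAt)
      (fun t ht => (hd2 t (hint ht)).differentiableAt.differentiableWithinAt) fun t ht => ?_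
    rw [(hd2 t (hint ht)).deriv]
    have h1 := hmono1 (left_mem_Icc.2 zero_le_one) (hint ht) (hint ht).1
    simpa [hD] using h1
  have hfin := hmono2 (left_mem_Icc.2 zero_le_one) (right_mem_Icc.2 zero_le_one) zero_le_one
  have hwu : w + u = y := by rw [hw, sub_add_cancel]
  simp only [zero_smul, add_zero, one_smul, hwu, hz w hwU hPw] at hfin
  simpa using hfin

/-- The rank of the Hessian at a critical point is invariant under changes of coordinates. -/
theorem finrank_hessian_comp {F : Euc n → ℝ} {φ : Euc n → Euc n} {x : Euc n}
    (hF : ContDiffAt ℝ ∞ F (φ x)) (hφ : ContDiffAt ℝ ∞ φ x) (hcrit : fderiv ℝ F (φ x) = 0)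
    (A : Euc n ≃L[ℝ] Euc n) (hA : fderiv ℝ φ x = A) :
    Module.finrank ℝ (LinearMap.range (fderiv ℝ (fderiv ℝ (F ∘ φ)) x).toLinearMap) =
      Module.finrank ℝ (LinearMap.range (fderiv ℝ (fderiv ℝ F) (φ x)).toLinearMap) := by
  have h1 : fderiv ℝ (F ∘ φ) =ᶠ[𝓝 x] fun y => (fderiv ℝ F (φ y)).comp (fderiv ℝ φ y) := by
    have hF' : ∀ᶠ z in 𝓝 (φ x), DifferentiableAt ℝ F z :=
      ((hF.of_le (m := 1) (by simp)).eventually (by simp)).mono fun z hz =>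
        hz.differentiableAt (by simp)
    have hφ' : ∀ᶠ z in 𝓝 x, DifferentiableAt ℝ φ z :=
      ((hφ.of_le (m := 1) (by simp)).eventually (by simp)).mono fun z hz =>
        hz.differentiableAt (by simp)
    filter_upwards [hφ.continuousAt.eventually hF', hφ'] with y hy hy'
    exact fderiv_comp y hy hy'
  have h2 : HasFDerivAt (fderiv ℝ F) (fderiv ℝ (fderiv ℝ F) (φ x)) (φ x) :=
    ((hF.fderiv_right (m := ∞) (by simp)).differentiableAt (by simp)).hasFDerivAt
  have h3 : HasFDerivAt (fderiv ℝ φ) (fderiv ℝ (fderiv ℝ φ) x) x :=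
    ((hφ.fderiv_right (m := ∞) (by simp)).differentiableAt (by simp)).hasFDerivAt
  have h4 := (h2.comp x (hφ.differentiableAt (by simp)).hasFDerivAt).clm_comp h3
  have h5 : fderiv ℝ (fderiv ℝ (F ∘ φ)) x = _ := h1.fderiv_eq.trans h4.fderiv
  have h6 : (fderiv ℝ (fderiv ℝ (F ∘ φ)) x).toLinearMap =
      (A.symm.arrowCongr (ContinuousLinearEquiv.refl ℝ ℝ)).toLinearEquiv.toLinearMap ∘ₗ
        (fderiv ℝ (fderiv ℝ F) (φ x)).toLinearMap ∘ₗ A.toLinearEquiv.toLinearMap := by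
    ext v w
    rw [h5, hA]
    simp [hcrit]
  rw [h6, LinearMap.range_comp, LinearEquiv.finrank_map_eq, LinearMap.range_comp,
    LinearEquiv.range, ← LinearMap.range_eq_map]

end Hessian

end ResidueCurrents

end

noncomputable section

namespace ResidueCurrents

/-! ### Slice charts of Morse--Bott functions -/

section Slice

theorem exists_equiv_fderiv {n : ℕ} {f g : Euc n → Euc n} {x : Euc n}
    (hf : DifferentiableAt ℝ f x) (hg : DifferentiableAt ℝ g (f x))
    (hgf : ∀ᶠ y in 𝓝 x, g (f y) = y) (hfg : ∀ᶠ y in 𝓝 (f x), f (g y) = y) :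
    ∃ A : Euc n ≃L[ℝ] Euc n, fderiv ℝ f x = A := by
  have hgx : g (f x) = x := hgf.self_of_nhds
  have h1 : (fderiv ℝ g (f x)).comp (fderiv ℝ f x) = ContinuousLinearMap.id ℝ _ := by
    rw [← fderiv_comp x hg hf, ← fderiv_id (𝕜 := ℝ) (x := x)]
    exact Filter.EventuallyEq.fderiv_eq hgf
  have h2 : (fderiv ℝ f x).comp (fderiv ℝ g (f x)) = ContinuousLinearMap.id ℝ _ := by
    have hf' : DifferentiableAt ℝ f (g (f x)) := by rwa [hgx]
    have h3 := fderiv_comp (f x) hf' hg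
    rw [hgx] at h3
    rw [← h3, ← fderiv_id (𝕜 := ℝ) (x := f x)]
    exact Filter.EventuallyEq.fderiv_eq hfg
  exact ⟨ContinuousLinearEquiv.equivOfInverse _ _
    (fun v => congrArg (fun L : Euc n →L[ℝ] Euc n => L v) h1)
    (fun v => congrArg (fun L : Euc n →L[ℝ] Euc n => L v) h2), rfl⟩

variable {n m : ℕ} {X : Type u} [TopologicalSpace X] [ChartedSpace (Euc n) X]

theorem isOpen_extChartAt_preimage (c : X) {s : Set X} (hs : IsOpen s) :
    IsOpen ((extChartAt (𝓡 n) c).target ∩ (extChartAt (𝓡 n) c).symm ⁻¹' s) :=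
  (continuousOn_extChartAt_symm c).isOpen_inter_preimage (isOpen_extChartAt_target c) hs

variable [IsManifold (𝓡 n) ∞ X]

/-- The changes of coordinates between a chart of the maximal atlas and a preferred chart are
smooth. -/
theorem contDiffOn_of_maximalAtlas {e : OpenPartialHomeomorph X (Euc n)}
    (he : e ∈ IsManifold.maximalAtlas (𝓡 n) ∞ X) (c : X) :
    ContDiffOn ℝ ∞ (extChartAt (𝓡 n) c ∘ e.symm)
      (e.target ∩ e.symm ⁻¹' (chartAt (Euc n) c).source) ∧
    ContDiffOn ℝ ∞ (e ∘ (extChartAt (𝓡 n) c).symm)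
      ((extChartAt (𝓡 n) c).target ∩ (extChartAt (𝓡 n) c).symm ⁻¹' e.source) := by
  constructor
  · exact ((contMDiffOn_extChartAt (I := 𝓡 n) (n := ∞) (x := c)).comp
      ((contMDiffOn_symm_of_mem_maximalAtlas he).mono inter_subset_left)
      fun x hx => hx.2).contDiffOn
  · exact ((contMDiffOn_of_mem_maximalAtlas he).comp
      ((contMDiffOn_extChartAt_symm (I := 𝓡 n) (n := ∞) c).mono inter_subset_left)
      fun x hx => hx.2).contDiffOn

theorem exists_equiv_fderiv_of_maximalAtlas {e : OpenPartialHomeomorph X (Euc n)}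
    (he : e ∈ IsManifold.maximalAtlas (𝓡 n) ∞ X) (c : X) {w : Euc n} (hw : w ∈ e.target)
    (hwc : e.symm w ∈ (chartAt (Euc n) c).source) :
    ∃ A : Euc n ≃L[ℝ] Euc n, fderiv ℝ (extChartAt (𝓡 n) c ∘ e.symm) w = A := by
  obtain ⟨h1, h2⟩ := contDiffOn_of_maximalAtlas he c
  have ho1 : IsOpen (e.target ∩ e.symm ⁻¹' (chartAt (Euc n) c).source) :=
    e.isOpen_inter_preimage_symm (chartAt (Euc n) c).open_source
  have ho2 := isOpen_extChartAt_preimage (n := n) c e.open_source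
  have hcs : ∀ y, y ∈ (chartAt (Euc n) c).source ↔ y ∈ (extChartAt (𝓡 n) c).source := by
    intro y
    rw [extChartAt_source]
  have hm1 : w ∈ e.target ∩ e.symm ⁻¹' (chartAt (Euc n) c).source := ⟨hw, hwc⟩
  have hleft := (extChartAt (𝓡 n) c).left_inv ((hcs _).1 hwc)
  have hm2 : (extChartAt (𝓡 n) c ∘ e.symm) w ∈
      (extChartAt (𝓡 n) c).target ∩ (extChartAt (𝓡 n) c).symm ⁻¹' e.source := by
    refine ⟨(extChartAt (𝓡 n) c).map_source ((hcs _).1 hwc), ?_⟩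
    rw [mem_preimage, Function.comp_apply, hleft]
    exact e.map_target hw
  refine exists_equiv_fderiv (g := e ∘ (extChartAt (𝓡 n) c).symm)
    ((h1.contDiffAt (ho1.mem_nhds hm1)).differentiableAt (by simp))
    ((h2.contDiffAt (ho2.mem_nhds hm2)).differentiableAt (by simp)) ?_ ?_
  · filter_upwards [ho1.mem_nhds hm1] with y hy
    simp only [Function.comp_apply]
    rw [(extChartAt (𝓡 n) c).left_inv ((hcs _).1 hy.2), e.right_inv hy.1]
  · filter_upwards [ho2.mem_nhds hm2] with y hy
    simp only [Function.comp_apply]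
    rw [e.left_inv hy.2, (extChartAt (𝓡 n) c).right_inv hy.1]

variable {Y : ClosedSubmanifold n m X}

/-- The expression of a Morse--Bott function in the chart at `c`. -/
def MorseBott.chartFun (μ : MorseBott Y) (c : X) : Euc n → ℝ :=
  μ.toFun ∘ (extChartAt (𝓡 n) c).symm

theorem MorseBott.contDiffOn_chartFun (μ : MorseBott Y) (c : X) :
    ContDiffOn ℝ ∞ (μ.chartFun c) (extChartAt (𝓡 n) c).target :=
  (μ.smooth.comp_contMDiffOn (contMDiffOn_extChartAt_symm (I := 𝓡 n) (n := ∞) c)).contDiffOn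

/-- The rank of the Hessian at a zero may be computed in any smooth chart. -/
theorem MorseBott.finrank_hessian_maximalAtlas (μ : MorseBott Y) {x : X} (hxY : x ∈ Y.carrier)
    {e : OpenPartialHomeomorph X (Euc n)} (he : e ∈ IsManifold.maximalAtlas (𝓡 n) ∞ X)
    (hxe : x ∈ e.source) : Module.finrank ℝ (LinearMap.range
      (fderiv ℝ (fderiv ℝ (μ.toFun ∘ e.symm)) (e x)).toLinearMap) = m := by
  have hxx := mem_chart_source (Euc n) x
  have hex : e.symm (e x) = x := e.left_inv hxe
  obtain ⟨A, hA⟩ := exists_equiv_fderiv_of_maximalAtlas he x (e.map_source hxe)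
    (by rw [hex]; exact hxx)
  have hσx : ContDiffAt ℝ ∞ (extChartAt (𝓡 n) x ∘ e.symm) (e x) :=
    (contDiffOn_of_maximalAtlas he x).1.contDiffAt
      ((e.isOpen_inter_preimage_symm (chartAt (Euc n) x).open_source).mem_nhds
        ⟨e.map_source hxe, by rw [mem_preimage, hex]; exact hxx⟩)
  have hval : (extChartAt (𝓡 n) x ∘ e.symm) (e x) = extChartAt (𝓡 n) x x := by
    rw [Function.comp_apply, hex]
  have hF : ContDiffAt ℝ ∞ (μ.toFun ∘ (extChartAt (𝓡 n) x).symm) (extChartAt (𝓡 n) x x) :=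
    smooth_in_chart μ.smooth hxx
  have hcrit : fderiv ℝ (μ.toFun ∘ (extChartAt (𝓡 n) x).symm) (extChartAt (𝓡 n) x x) = 0 :=
    fderiv_eq_zero_of_nonneg isOpen_univ (fun w _ => μ.nonneg _) (mem_univ _)
      (by simpa using (μ.eq_zero_iff x).2 hxY)
  have h1 := finrank_hessian_comp (by rw [hval]; exact hF) hσx (by rw [hval]; exact hcrit) A hA
  rw [hval, μ.hessian_rank x hxY] at h1
  refine Eq.trans ?_ h1
  have h2 : μ.toFun ∘ e.symm =ᶠ[𝓝 (e x)]
      (μ.toFun ∘ (extChartAt (𝓡 n) x).symm) ∘ (extChartAt (𝓡 n) x ∘ e.symm) := by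
    filter_upwards [(e.isOpen_inter_preimage_symm (chartAt (Euc n) x).open_source).mem_nhds
        ⟨e.map_source hxe, by rw [mem_preimage, hex]; exact hxx⟩] with w hw
    simp only [Function.comp_apply]
    rw [(extChartAt (𝓡 n) x).left_inv ((show _ ∈ _ by rw [extChartAt_source]; exact hw.2))]
  rw [h2.fderiv.fderiv_eq]

/-- Around its zeros, a Morse--Bott function satisfies a quadratic lower bound in suitable smooth
coordinates. -/
theorem MorseBott.exists_sliceChart (μ : MorseBott Y) (c : X) {z : Euc n}
    (hz : z ∈ (extChartAt (𝓡 n) c).target) (hμz : μ.chartFun c z = 0) :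
    Nonempty (SliceChart m (μ.chartFun c) z) := by
  classical
  set x := (extChartAt (𝓡 n) c).symm z with hxdef
  have hxY : x ∈ Y.carrier := (μ.eq_zero_iff x).1 hμz
  have hxc : x ∈ (extChartAt (𝓡 n) c).source := (extChartAt (𝓡 n) c).map_target hz
  obtain ⟨e, he, hxe, hslice⟩ := Y.slice x hxY
  have hcs : ∀ c y : X, y ∈ (chartAt (Euc n) c).source ↔ y ∈ (extChartAt (𝓡 n) c).source := by
    intro c y
    rw [extChartAt_source]
  set D := e.target ∩ e.symm ⁻¹' (chartAt (Euc n) c).source with hD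
  have hDo : IsOpen D := e.isOpen_inter_preimage_symm (chartAt (Euc n) c).open_source
  have hexD : e x ∈ D := by
    refine ⟨e.map_source hxe, ?_⟩
    rw [mem_preimage, e.left_inv hxe]
    exact (hcs c x).2 hxc
  obtain ⟨hσ, hτ⟩ := contDiffOn_of_maximalAtlas he c
  have hG : ContDiffOn ℝ ∞ (μ.toFun ∘ e.symm) D :=
    ((μ.smooth.comp_contMDiffOn (contMDiffOn_symm_of_mem_maximalAtlas he)).contDiffOn).mono
      inter_subset_left
  have hzero : ∀ w ∈ D, normalProj n m w = 0 → (μ.toFun ∘ e.symm) w = 0 := by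
    intro w hw hPw
    rw [Function.comp_apply, μ.eq_zero_iff, hslice _ (e.map_target hw.1), e.right_inv hw.1]
    exact (normalProj_eq_zero_iff m w).1 hPw
  have hPx : normalProj n m (e x) = 0 :=
    (normalProj_eq_zero_iff m _).2 ((hslice x hxe).1 hxY)
  have hrank := μ.finrank_hessian_maximalAtlas hxY he hxe
  obtain ⟨r, hr, κ, hκ, hrD, hlow⟩ := exists_quadratic_lower_bound hDo hG
    (fun w _ => μ.nonneg _) hzero hexD hPx hrank
  set B := Metric.ball (e x) r with hB
  have hcE : ∀ w ∈ B, e.symm w ∈ (extChartAt (𝓡 n) c).source := fun w hw =>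
    (hcs c _).1 (hrD hw).2
  have hW1 := isOpen_extChartAt_preimage (n := n) c e.open_source
  have hexB : e x ∈ B := Metric.mem_ball_self hr
  have hsub : ∀ w ∈ B, w - normalProj n m w ∈ B := by
    intro w hw
    rw [hB, mem_ball_iff_norm] at hw ⊢
    have : w - normalProj n m w - e x = (w - e x) - normalProj n m (w - e x) := by
      rw [map_sub, hPx]
      abel
    rw [this]
    exact (norm_sub_normalProj_le _).trans_lt hw
  have hmeas : Measurable (B.indicator (μ.toFun ∘ e.symm)) := by
    rw [← piecewise_eq_indicator]
    exact (hG.continuousOn.mono hrD).measurable_piecewise continuousOn_const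
      Metric.isOpen_ball.measurableSet
  let S : SliceData n m :=
    { B := B
      G := B.indicator (μ.toFun ∘ e.symm)
      codim_le := Y.codim_le
      isOpen := Metric.isOpen_ball
      convex := convex_ball _ _
      sub_mem := hsub
      measurable := hmeas
      smooth := (hG.mono hrD).congr fun w hw => indicator_of_mem hw _
      eq_zero := fun w hw hPw => (indicator_of_mem hw _).trans (hzero w (hrD hw) hPw)
      c := κ
      c_pos := hκ
      lower := fun w hw => (hlow w hw).trans (indicator_of_mem hw _).ge }
  refine ⟨
    { S := S
      σ := extChartAt (𝓡 n) c ∘ e.symm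
      τ := e ∘ (extChartAt (𝓡 n) c).symm
      W := ((extChartAt (𝓡 n) c).target ∩ (extChartAt (𝓡 n) c).symm ⁻¹' e.source) ∩
        (e ∘ (extChartAt (𝓡 n) c).symm) ⁻¹' B
      isOpen_W := hτ.continuousOn.isOpen_inter_preimage hW1 Metric.isOpen_ball
      mem_W := ⟨⟨hz, hxe⟩, hexB⟩
      smooth := hσ.mono hrD
      injOn := fun w hw w' hw' h => ?_
      det_ne_zero := fun w hw => ?_
      continuousOn_τ := hτ.continuousOn.mono inter_subset_left
      τ_mem := fun w hw => hw.2
      σ_τ := fun w hw => ?_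
      G_eq := fun w hw => (indicator_of_mem hw _).trans ?_ }⟩
  · have h1 := (extChartAt (𝓡 n) c).injOn (hcE w hw) (hcE w' hw') h
    exact e.symm.injOn (hrD hw).1 (hrD hw').1 h1
  · obtain ⟨A, hA⟩ := exists_equiv_fderiv_of_maximalAtlas he c (hrD hw).1 (hrD hw).2
    rw [hA]
    exact (LinearEquiv.isUnit_det' A.toLinearEquiv).ne_zero
  · simp only [Function.comp_apply]
    rw [e.left_inv hw.1.2, (extChartAt (𝓡 n) c).right_inv hw.1.1]
  · simp only [Function.comp_apply, MorseBott.chartFun]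
    rw [(extChartAt (𝓡 n) c).left_inv (hcE w hw)]

end Slice

end ResidueCurrents

end

noncomputable section

namespace ResidueCurrents

/-! ### Zeta integrals in the charts of a manifold -/

section ChartCoeff

open MeasureTheory

variable {n : ℕ} {X : Type u} [TopologicalSpace X] [ChartedSpace (Euc n) X] {p q k : ℕ}

/-- The standard frame of `ℝⁿ`. -/
abbrev stdFrame (n : ℕ) (i : Fin n) : Euc n := EuclideanSpace.single i (1 : ℝ)

/-- The density of the top-degree form `w β` in the oriented chart at `c`, extended by zero. -/
def chartCoeff (o : ManifoldOrientation n X) (w : X → ℝ) (β : Form n X n) (c : X) : Euc n → ℂ :=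
  (extChartAt (𝓡 n) c).target.indicator fun z =>
    ((w ((extChartAt (𝓡 n) c).symm z) * frameSign o.orient c z : ℝ) : ℂ) *
      chartRep β c z (stdFrame n)

theorem chartRep_wedge (h : p + q = k) (α : Form n X p) (φ : Form n X q) (c : X) (z : Euc n) :
    chartRep (wedge h α φ) c z = wedgeAt h (chartRep α c z) (chartRep φ c z) :=
  wedgeAt_comp (V := Euc n) (V' := Euc n) h (α ((extChartAt (𝓡 n) c).symm z))
    (φ ((extChartAt (𝓡 n) c).symm z))
    (mfderiv 𝓘(ℝ, Euc n) (𝓡 n) (extChartAt (𝓡 n) c).symm z)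

theorem chartRep_eq_zero {α : Form n X p} {c : X} {z : Euc n}
    (h : α ((extChartAt (𝓡 n) c).symm z) = 0) : chartRep α c z = 0 := by
  rw [chartRep, h]
  rfl

theorem chartCoeff_smul (o : ManifoldOrientation n X) (w : X → ℝ) (f : X → ℂ) (β : Form n X n)
    (c : X) (z : Euc n) : chartCoeff o w (fun x => f x • β x) c z =
      f ((extChartAt (𝓡 n) c).symm z) * chartCoeff o w β c z := by
  by_cases hz : z ∈ (extChartAt (𝓡 n) c).target
  · rw [chartCoeff, chartCoeff, indicator_of_mem hz, indicator_of_mem hz]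
    exact mul_left_comm _ _ _
  · rw [chartCoeff, chartCoeff, indicator_of_notMem hz, indicator_of_notMem hz, mul_zero]

theorem chartCoeff_add_smul (o : ManifoldOrientation n X) (w : X → ℝ) (a : ℂ) (β β' : Form n X n)
    (c : X) (z : Euc n) : chartCoeff o w (fun x => β x + a • β' x) c z =
      chartCoeff o w β c z + a * chartCoeff o w β' c z := by
  by_cases hz : z ∈ (extChartAt (𝓡 n) c).target
  · rw [chartCoeff, chartCoeff, chartCoeff, indicator_of_mem hz, indicator_of_mem hz,
      indicator_of_mem hz, mul_left_comm a, ← mul_add]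
    rfl
  · rw [chartCoeff, chartCoeff, chartCoeff, indicator_of_notMem hz, indicator_of_notMem hz,
      indicator_of_notMem hz, mul_zero, add_zero]

theorem SmoothFormAt.contDiffAt_chartRep {φ : Form n X q} {c : X} {z : Euc n}
    (hz : z ∈ (extChartAt (𝓡 n) c).target)
    (h : SmoothFormAt φ ((extChartAt (𝓡 n) c).symm z)) : ContDiffAt ℝ ∞ (chartRep φ c) z := by
  have h1 := h c (by
    rw [← extChartAt_source (𝓡 n)]
    exact (extChartAt (𝓡 n) c).map_target hz)
  rwa [(extChartAt (𝓡 n) c).right_inv hz] at h1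

theorem eventually_symm {c : X} {z : Euc n} (hz : z ∈ (extChartAt (𝓡 n) c).target)
    {P : X → Prop} (h : ∀ᶠ x in 𝓝 ((extChartAt (𝓡 n) c).symm z), P x) :
    ∀ᶠ w in 𝓝 z, P ((extChartAt (𝓡 n) c).symm w) :=
  ((continuousOn_extChartAt_symm c).continuousAt
    ((isOpen_extChartAt_target c).mem_nhds hz)).eventually h

/-- A bilinear combination of a fixed smooth function with a locally uniformly bounded family is
locally uniformly bounded. -/
theorem locUnifBdd_bilinear {Λ E F : Type*} [NormedAddCommGroup E] [NormedSpace ℝ E]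
    [NormedAddCommGroup F] [NormedSpace ℝ F] (B : E →L[ℝ] F →L[ℝ] ℂ)
    {W L : Set (Euc n)} (hW : IsOpen W) (hL : IsClosed L) {A : Euc n → E}
    {f : Λ → Euc n → F} (hA : ContDiffOn ℝ ∞ A W) (hf : ∀ a, ContDiffOn ℝ ∞ (f a) W)
    (hb : ∀ i : ℕ, ∃ C : ℝ, ∀ a, ∀ x ∈ W ∩ L, ‖iteratedFDeriv ℝ i (f a) x‖ ≤ C)
    (h0 : ∀ a, ∀ x ∈ W, x ∉ L → B (A x) (f a x) = 0) :
    (∀ a, ContDiffOn ℝ ∞ (fun x => B (A x) (f a x)) W) ∧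
      LocUnifBdd W fun a x => B (A x) (f a x) := by
  refine ⟨fun a => B.isBoundedBilinearMap.contDiff.comp_contDiffOn (hA.prodMk (hf a)), ?_⟩
  intro T hTW hT i
  have hAc : ∀ j : ℕ, ∃ C : ℝ, ∀ x ∈ T, ‖iteratedFDerivWithin ℝ j A W x‖ ≤ C := fun j =>
    hT.exists_bound_of_continuousOn ((hA.continuousOn_iteratedFDerivWithin
      (by exact_mod_cast (le_top : (j : ℕ∞) ≤ ⊤)) hW.uniqueDiffOn).mono hTW)
  choose CA hCA using hAc
  choose Cf hCf using hb
  refine ⟨max 0 (‖B‖ * ∑ j ∈ Finset.range (i + 1), (i.choose j) * CA j * Cf (i - j)),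
    fun a x hx => ?_⟩
  have hxW := hTW hx
  by_cases hxL : x ∈ L
  · refine le_max_of_le_right ?_
    rw [← iteratedFDerivWithin_of_isOpen i hW hxW]
    refine (B.norm_iteratedFDerivWithin_le_of_bilinear hA (hf a) hW.uniqueDiffOn hxW
      (by exact_mod_cast (le_top : (i : ℕ∞) ≤ ⊤))).trans ?_
    refine mul_le_mul_of_nonneg_left (Finset.sum_le_sum fun j _ => ?_) (norm_nonneg B)
    have h1 := hCA j x hx
    have h2 := hCf (i - j) a x ⟨hxW, hxL⟩
    rw [← iteratedFDerivWithin_of_isOpen (i - j) hW hxW] at h2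
    have h3 : 0 ≤ CA j := (norm_nonneg _).trans h1
    gcongr
  · refine le_max_of_le_left ?_
    have h1 : (fun x => B (A x) (f a x)) =ᶠ[𝓝 x] fun _ => 0 := by
      filter_upwards [hW.mem_nhds hxW, hL.isOpen_compl.mem_nhds hxL] with y hy hy'
      exact h0 a y hy hy'
    rw [(h1.iteratedFDeriv ℝ i).self_of_nhds, iteratedFDeriv_fun_zero]
    simp

/-- The bilinear form `(a, b) ↦ (a ∧ b)(e₁, …, eₙ)`. -/
def wedgeEval (h : p + q = n) :
    (Euc n [⋀^Fin p]→L[ℝ] ℂ) →L[ℝ] (Euc n [⋀^Fin q]→L[ℝ] ℂ) →L[ℝ] ℂ :=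
  (ContinuousLinearMap.compL ℝ _ _ _
    (ContinuousAlternatingMap.apply ℝ (Euc n) ℂ (stdFrame n))).comp (wedgeCLM (Euc n) h)

theorem wedgeEval_apply (h : p + q = n) (a : Euc n [⋀^Fin p]→L[ℝ] ℂ) (b : Euc n [⋀^Fin q]→L[ℝ] ℂ) :
    wedgeEval h a b = wedgeAt h a b (stdFrame n) := rfl

variable {m : ℕ} {Y : ClosedSubmanifold n m X}

theorem MorseBott.chartFun_eq_zero (μ : MorseBott Y) {c : X} {z : Euc n} :
    μ.chartFun c z = 0 ↔ (extChartAt (𝓡 n) c).symm z ∈ Y.carrier := μ.eq_zero_iff _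

variable [T2Space X]

theorem TestForm.contDiffAt_chartRep (φ : TestForm n X q) {c : X} {z : Euc n}
    (hz : z ∈ (extChartAt (𝓡 n) c).target) : ContDiffAt ℝ ∞ (chartRep φ.form c) z :=
  SmoothFormAt.contDiffAt_chartRep hz (φ.2.1 _)

variable [IsManifold (𝓡 n) ∞ X]

/-- The zeta integrals of `α ∧ φ` in a chart, for a singular form `α` and a bounded family of
test forms `φ`. -/
theorem zetaFam_chart {Λ : Type*} (o : ManifoldOrientation n X) (μ : MorseBott Y) (h : p + q = n)
    (α : singularForms μ p) (φ : Λ → TestForm n X q) (c : X) {w : X → ℝ}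
    (hw : ContMDiff (𝓡 n) 𝓘(ℝ) ∞ w) {L : Set (Euc n)} (hL : IsCompact L)
    (hLt : L ⊆ (extChartAt (𝓡 n) c).target)
    (h0 : ∀ a, ∀ z ∈ (extChartAt (𝓡 n) c).target, z ∉ L →
      w ((extChartAt (𝓡 n) c).symm z) = 0 ∨ (φ a).form ((extChartAt (𝓡 n) c).symm z) = 0)
    (hb : ∀ i : ℕ, ∃ C : ℝ, ∀ a, ∀ z ∈ L, ‖iteratedFDeriv ℝ i (chartRep (φ a).form c) z‖ ≤ C) :
    ZetaFam (μ.chartFun c) (fun a => chartCoeff o w (wedge h α.1 (φ a).form) c)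
      (∀ z ∈ L, μ.chartFun c z ≠ 0) := by
  have hcoef : ∀ a, ∀ z ∈ (extChartAt (𝓡 n) c).target,
      chartCoeff o w (wedge h α.1 (φ a).form) c z =
      ((w ((extChartAt (𝓡 n) c).symm z) * frameSign o.orient c z : ℝ) : ℂ) *
        wedgeEval h (chartRep α.1 c z) (chartRep (φ a).form c z) := by
    intro a z hz
    rw [chartCoeff, indicator_of_mem hz, chartRep_wedge, wedgeEval_apply]
  have hvan : ∀ a, ∀ z ∈ (extChartAt (𝓡 n) c).target, z ∉ L →
      ((w ((extChartAt (𝓡 n) c).symm z) : ℝ) : ℂ) = 0 ∨ chartRep (φ a).form c z = 0 := by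
    intro a z hz hzL
    rcases h0 a z hz hzL with h | h
    · exact Or.inl (by rw [h, Complex.ofReal_zero])
    · exact Or.inr (chartRep_eq_zero h)
  refine zetaFam_of_local (m := m) (U := (extChartAt (𝓡 n) c).target) hL (μ.contDiffOn_chartFun c)
    (fun z _ => μ.nonneg _) (fun a z hz => ?_) (fun a z hz => ?_)
    (fun z hz hz0 => μ.exists_sliceChart c (hLt hz) hz0) fun z hz => ?_
  · by_cases hzt : z ∈ (extChartAt (𝓡 n) c).target
    · rw [hcoef a z hzt]
      rcases hvan a z hzt hz with h | h
      · rw [Complex.ofReal_mul, h, zero_mul, zero_mul]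
      · rw [h, map_zero, mul_zero]
    · exact indicator_of_notMem hzt _
  · by_cases hzt : z ∈ (extChartAt (𝓡 n) c).target
    · rw [hcoef a z hzt, chartRep_eq_zero (α.2.1 _ (μ.chartFun_eq_zero.1 hz)), map_zero]
      exact mul_zero _
    · exact indicator_of_notMem hzt _
  · have hzt := hLt hz
    obtain ⟨N, η, hη⟩ := α.2.2.2 ((extChartAt (𝓡 n) c).symm z)
    obtain ⟨W, hWsub, hWo, hzW⟩ := eventually_nhds_iff.1 (((isOpen_extChartAt_target
      (I := 𝓡 n) c).eventually_mem hzt).and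
        ((eventually_symm hzt hη).and (o.locallyConstant c z hzt)))
    set A : Euc n → Euc n [⋀^Fin p]→L[ℝ] ℂ := fun x =>
      (w ((extChartAt (𝓡 n) c).symm x) * frameSign o.orient c z) • chartRep η c x with hA
    have hAs : ContDiffOn ℝ ∞ A W := by
      intro x hx
      obtain ⟨hxt, hxη, _⟩ := hWsub x hx
      have h1 := smooth_in_chart hw (c := c) (x := (extChartAt (𝓡 n) c).symm x) (by
        rw [← extChartAt_source (𝓡 n)]
        exact (extChartAt (𝓡 n) c).map_target hxt)
      rw [(extChartAt (𝓡 n) c).right_inv hxt] at h1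
      exact ((h1.mul contDiffAt_const).smul
        (SmoothFormAt.contDiffAt_chartRep hxt hxη.1)).contDiffWithinAt
    have hφs : ∀ a, ContDiffOn ℝ ∞ (chartRep (φ a).form c) W := fun a x hx =>
      ((φ a).contDiffAt_chartRep (hWsub x hx).1).contDiffWithinAt
    have hfam := locUnifBdd_bilinear (wedgeEval h) hWo hL.isClosed hAs hφs (fun i => by
      obtain ⟨C, hC⟩ := hb i
      exact ⟨C, fun a x hx => hC a x hx.2⟩) fun a x hx hxL => by
        rcases h0 a x (hWsub x hx).1 hxL with h | h
        · have hA0 : A x = 0 := by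
            simp only [hA]
            rw [h, zero_mul]
            ext v
            exact zero_smul ℝ _
          rw [hA0, map_zero]
          rfl
        · rw [chartRep_eq_zero h, map_zero]
    refine ⟨W, hWo, hzW, fun x hx => (hWsub x hx).1, N,
      fun a x => wedgeEval h (A x) (chartRep (φ a).form c x), hfam.1, hfam.2, ?_⟩
    intro a x hx hgx
    obtain ⟨hxt, hxη, hxo⟩ := hWsub x hx
    have hxY : (extChartAt (𝓡 n) c).symm x ∉ Y.carrier := fun h => hgx (μ.chartFun_eq_zero.2 h)
    have h1 : chartRep η c x = ((μ.chartFun c x : ℂ) ^ N) • chartRep α.1 c x := by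
      rw [chartRep, hxη.2 hxY]
      ext v
      change ((μ.toFun ((extChartAt (𝓡 n) c).symm x) ^ N : ℝ) : ℝ) •
        (chartRep α.1 c x v) = _
      rw [Complex.real_smul, Complex.ofReal_pow]
      rfl
    have h2 : A x = ((w ((extChartAt (𝓡 n) c).symm x) * frameSign o.orient c z : ℝ) : ℂ) •
        ((μ.chartFun c x : ℂ) ^ N) • chartRep α.1 c x := by
      simp only [hA]
      rw [h1]
      ext v
      exact Complex.real_smul
    beta_reduce
    rw [hcoef a x hxt, hxo, h2, wedgeEval_apply, wedgeEval_apply, wedgeAt_smul_left,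
      wedgeAt_smul_left]
    exact mul_left_comm _ _ _

end ChartCoeff

section FormIntegral

open MeasureTheory

variable {n : ℕ} {X : Type u} [TopologicalSpace X] [ChartedSpace (Euc n) X]
  [T2Space X] [SigmaCompactSpace X] [IsManifold (𝓡 n) ∞ X]

variable (n X) in
theorem chartPartition_tsupport_subset (c : X) :
    tsupport (chartPartition n X c) ⊆ (extChartAt (𝓡 n) c).source := by
  rw [extChartAt_source]
  exact Classical.choose_spec (SmoothPartitionOfUnity.exists_isSubordinate_chartAt_source (𝓡 n) X) c

theorem finite_charts {K : Set X} (hK : IsCompact K) :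
    {c : X | (tsupport (chartPartition n X c) ∩ K).Nonempty}.Finite :=
  (chartPartition n X).locallyFinite.closure.finite_nonempty_inter_compact hK

/-- The finitely many charts that contribute to integrals of forms supported in `K`. -/
def chartsOn {K : Set X} (hK : IsCompact K) : Finset X := (finite_charts (n := n) hK).toFinset

theorem mem_chartsOn {K : Set X} (hK : IsCompact K) {c x : X} (hx : x ∈ K)
    (hc : chartPartition n X c x ≠ 0) : c ∈ chartsOn (n := n) hK := by
  rw [chartsOn, Set.Finite.mem_toFinset]
  exact ⟨x, subset_tsupport _ hc, hx⟩

/-- The part of the chart at `c` that contributes to integrals of forms supported in `K`. -/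
def chartSet (n : ℕ) {X : Type u} [TopologicalSpace X] [ChartedSpace (Euc n) X]
    [T2Space X] [SigmaCompactSpace X] [IsManifold (𝓡 n) ∞ X] (K : Set X) (c : X) : Set (Euc n) :=
  extChartAt (𝓡 n) c '' (tsupport (chartPartition n X c) ∩ K)

theorem chartSet_subset (K : Set X) (c : X) : chartSet n K c ⊆ (extChartAt (𝓡 n) c).target := by
  rintro _ ⟨x, hx, rfl⟩
  exact (extChartAt (𝓡 n) c).map_source (chartPartition_tsupport_subset n X c hx.1)

theorem isCompact_chartSet {K : Set X} (hK : IsCompact K) (c : X) :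
    IsCompact (chartSet n K c) :=
  (hK.inter_left (isClosed_tsupport _)).image_of_continuousOn
    ((continuousOn_extChartAt c).mono fun _ hx => chartPartition_tsupport_subset n X c hx.1)

theorem eq_zero_of_notMem_chartSet {K : Set X} {c : X} {z : Euc n}
    (hz : z ∈ (extChartAt (𝓡 n) c).target) (hzK : z ∉ chartSet n K c) :
    chartPartition n X c ((extChartAt (𝓡 n) c).symm z) = 0 ∨
      (extChartAt (𝓡 n) c).symm z ∉ K := by
  by_contra! hcon
  exact hzK ⟨_, ⟨subset_tsupport _ hcon.1, hcon.2⟩, (extChartAt (𝓡 n) c).right_inv hz⟩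

theorem formIntegral_eq_sum (o : ManifoldOrientation n X) {K : Set X} (hK : IsCompact K)
    {β : Form n X n} (hβ : ∀ x ∉ K, β x = 0) :
    formIntegral o β =
      ∑ c ∈ chartsOn (n := n) hK, ∫ z, chartCoeff o (chartPartition n X c) β c z := by
  have h1 : ∀ c, ∫ z, chartCoeff o (chartPartition n X c) β c z =
      ∫ z in (extChartAt (𝓡 n) c).target,
        ((chartPartition n X c ((extChartAt (𝓡 n) c).symm z) * frameSign o.orient c z : ℝ) : ℂ) *
          chartRep β c z fun i => EuclideanSpace.single i (1 : ℝ) := fun c =>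
    integral_indicator (isOpen_extChartAt_target (I := 𝓡 n) c).measurableSet
  rw [formIntegral, ← finsum_eq_sum_of_support_subset]
  · exact finsum_congr fun c => (h1 c).symm
  · intro c hc
    by_contra hcon
    refine hc ?_
    refine integral_eq_zero_of_ae (Eventually.of_forall fun z => ?_)
    by_cases hz : z ∈ (extChartAt (𝓡 n) c).target
    · rw [chartCoeff, indicator_of_mem hz]
      by_cases hzK : (extChartAt (𝓡 n) c).symm z ∈ K
      · have : chartPartition n X c ((extChartAt (𝓡 n) c).symm z) = 0 := by
          by_contra h
          exact hcon (mem_chartsOn hK hzK h)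
        rw [this, zero_mul, Complex.ofReal_zero, zero_mul]
        rfl
      · rw [chartRep_eq_zero (hβ _ hzK)]
        exact mul_zero _
    · exact indicator_of_notMem hz _

end FormIntegral

end ResidueCurrents

end

noncomputable section

namespace ResidueCurrents

/-! ### The residue pairing -/

section Pairing

open MeasureTheory

variable {n : ℕ} {X : Type u} [TopologicalSpace X] [ChartedSpace (Euc n) X] {p q m : ℕ}

theorem wedge_eq_zero (h : p + q = n) (α : Form n X p) {φ : Form n X q} {x : X} (hx : φ x = 0) :
    wedge h α φ x = 0 := by
  rw [wedge, hx]
  exact wedgeAt_zero_right (V := Euc n) h (α x)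

theorem wedge_add_smul_right (h : p + q = n) (α : Form n X p) (φ ψ : Form n X q) (a : ℂ) :
    wedge h α (φ + a • ψ) = fun x => wedge h α φ x + a • wedge h α ψ x :=
  funext fun x => wedgeAt_add_smul_right (V := Euc n) h a (α x) (φ x) (ψ x)

theorem wedge_add_smul_left (h : p + q = n) (α β : Form n X p) (φ : Form n X q) (a : ℂ) :
    wedge h (α + a • β) φ = fun x => wedge h α φ x + a • wedge h β φ x :=
  funext fun x => wedgeAt_add_smul_left (V := Euc n) h a (α x) (β x) (φ x)

variable [T2Space X]

theorem TestForm.eq_zero_of_notMem (φ : TestForm n X q) {K : Set X} (hK : formSupport φ.form ⊆ K)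
    {x : X} (hx : x ∉ K) : φ.form x = 0 := by
  by_contra h
  exact hx (hK (subset_closure h))

theorem TestForm.exists_bound (φ : TestForm n X q) (c : X) {L : Set (Euc n)} (hL : IsCompact L)
    (hLt : L ⊆ (extChartAt (𝓡 n) c).target) (i : ℕ) :
    ∃ C : ℝ, ∀ z ∈ L, ‖iteratedFDeriv ℝ i (chartRep φ.form c) z‖ ≤ C := by
  refine hL.exists_bound_of_continuousOn fun z hz => ?_
  have h3 : ContDiffAt ℝ 0 (iteratedFDeriv ℝ i (chartRep φ.form c)) z :=
    (φ.contDiffAt_chartRep (hLt hz)).iteratedFDeriv_right (by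
      rw [zero_add]
      exact_mod_cast (le_top : (i : ℕ∞) ≤ ⊤))
  exact h3.continuousAt.continuousWithinAt

variable [SigmaCompactSpace X] [IsManifold (𝓡 n) ∞ X]

/-- The function `s ↦ ∫_X f ^ (s / 2) β`. -/
def zetaFun (o : ManifoldOrientation n X) (f : X → ℝ) (β : Form n X n) (s : ℂ) : ℂ :=
  formIntegral o fun x => ((f x : ℂ) ^ (s / 2)) • β x

/-- The integrals of `f ^ (s / 2) β` over the charts that meet `K` converge for `Re s` large. -/
def ZetaIntegrable (o : ManifoldOrientation n X) (f : X → ℝ) {K : Set X} (hK : IsCompact K)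
    (β : Form n X n) : Prop :=
  ∃ R : ℝ, ∀ c ∈ chartsOn (n := n) hK, ∀ s : ℂ, R < s.re → Integrable fun z =>
    (f ((extChartAt (𝓡 n) c).symm z) : ℂ) ^ (s / 2) * chartCoeff o (chartPartition n X c) β c z

theorem zetaFun_eq_sum (o : ManifoldOrientation n X) (f : X → ℝ) {K : Set X} (hK : IsCompact K)
    {β : Form n X n} (hβ : ∀ x ∉ K, β x = 0) (s : ℂ) :
    zetaFun o f β s = ∑ c ∈ chartsOn (n := n) hK, ∫ z,
      (f ((extChartAt (𝓡 n) c).symm z) : ℂ) ^ (s / 2) *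
        chartCoeff o (chartPartition n X c) β c z := by
  rw [zetaFun, formIntegral_eq_sum o hK fun x hx => by
    rw [hβ x hx]
    exact smul_zero (A := TangentSpace (𝓡 n) x [⋀^Fin n]→L[ℝ] ℂ) ((f x : ℂ) ^ (s / 2))]
  refine Finset.sum_congr rfl fun c _ => integral_congr_ae (Eventually.of_forall fun z => ?_)
  exact chartCoeff_smul o _ (fun x => (f x : ℂ) ^ (s / 2)) β c z

theorem zetaFun_add_smul (o : ManifoldOrientation n X) (f : X → ℝ) {K : Set X} (hK : IsCompact K)
    {β β' : Form n X n} (hβ : ∀ x ∉ K, β x = 0) (hβ' : ∀ x ∉ K, β' x = 0)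
    (hi : ZetaIntegrable o f hK β) (hi' : ZetaIntegrable o f hK β') (a : ℂ) :
    ∃ R : ℝ, ∀ s : ℂ, R < s.re →
      zetaFun o f (fun x => β x + a • β' x) s = zetaFun o f β s + a * zetaFun o f β' s := by
  obtain ⟨R, hR⟩ := hi
  obtain ⟨R', hR'⟩ := hi'
  refine ⟨max R R', fun s hs => ?_⟩
  have h0 : ∀ x ∉ K, β x + a • β' x = 0 := fun x hx => by
    rw [hβ x hx, hβ' x hx]
    exact (zero_add (M := TangentSpace (𝓡 n) x [⋀^Fin n]→L[ℝ] ℂ) _).trans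
      (smul_zero (A := TangentSpace (𝓡 n) x [⋀^Fin n]→L[ℝ] ℂ) a)
  rw [zetaFun_eq_sum o f hK h0, zetaFun_eq_sum o f hK hβ, zetaFun_eq_sum o f hK hβ',
    Finset.mul_sum, ← Finset.sum_add_distrib]
  refine Finset.sum_congr rfl fun c hc => ?_
  rw [← integral_const_mul, ← integral_add (hR c hc s ((le_max_left _ _).trans_lt hs))
    ((hR' c hc s ((le_max_right _ _).trans_lt hs)).const_mul a)]
  refine integral_congr_ae (Eventually.of_forall fun z => ?_)
  beta_reduce
  rw [chartCoeff_add_smul]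
  ring

/-- The value of `I0` does not depend on the chosen continuation. -/
theorem I0_eq_of_hasSimpleResidue {o : ManifoldOrientation n X} {f : X → ℝ} {β : Form n X n}
    {a : ℂ} (h : HasSimpleResidue (zetaFun o f β) a) :
    (∃ Z, IsZetaContinuation o f β Z) ∧ I0 o f β = a := by
  obtain ⟨Z, hZ, R, hR⟩ := exists_meromorphic_of_halfPlanes h.1
  have hex : ∃ Z, IsZetaContinuation o f β Z := ⟨Z, hZ, R, hR⟩
  refine ⟨hex, ?_⟩
  rw [I0, dif_pos hex]
  obtain ⟨hm, R', hR'⟩ := hex.choose_spec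
  exact h.residue_eq hm hR'

variable {Y : ClosedSubmanifold n m X}

theorem zetaFam_chartPartition {Λ : Type*} (o : ManifoldOrientation n X) (μ : MorseBott Y)
    (h : p + q = n) (α : singularForms μ p) (φ : Λ → TestForm n X q) {K : Set X}
    (hK : IsCompact K) (hφ : ∀ a, formSupport (φ a).form ⊆ K) (c : X)
    (hb : ∀ i : ℕ, ∃ C : ℝ, ∀ a, ∀ z ∈ chartSet n K c,
      ‖iteratedFDeriv ℝ i (chartRep (φ a).form c) z‖ ≤ C) :
    ZetaFam (μ.chartFun c)
      (fun a => chartCoeff o (chartPartition n X c) (wedge h α.1 (φ a).form) c)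
      (∀ z ∈ chartSet n K c, μ.chartFun c z ≠ 0) :=
  zetaFam_chart o μ h α φ c (chartPartition n X c).contMDiff (isCompact_chartSet hK c)
    (chartSet_subset K c)
    (fun a _ hz hzL => (eq_zero_of_notMem_chartSet hz hzL).imp_right fun hx =>
      (φ a).eq_zero_of_notMem (hφ a) hx) hb

/-- The real part of `s` beyond which the integrals converge may be chosen for all charts at once,
since finitely many charts contribute. -/
theorem zetaIntegrable_wedge (o : ManifoldOrientation n X) (μ : MorseBott Y)
    (h : p + q = n) (α : singularForms μ p) (φ : TestForm n X q) {K : Set X}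
    (hK : IsCompact K) (hφ : formSupport φ.form ⊆ K) :
    ZetaIntegrable o μ.toFun hK (wedge h α.1 φ.form) := by
  have h1 : ∀ c : X, ∃ R : ℝ, ∀ s : ℂ, R < s.re → Integrable fun z =>
      (μ.toFun ((extChartAt (𝓡 n) c).symm z) : ℂ) ^ (s / 2) *
        chartCoeff o (chartPartition n X c) (wedge h α.1 φ.form) c z := by
    intro c
    obtain ⟨R, hR⟩ := (zetaFam_chartPartition (Λ := Unit) o μ h α (fun _ => φ) hK (fun _ => hφ) c
      fun i => (φ.exists_bound c (isCompact_chartSet hK c) (chartSet_subset K c) i).imp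
        fun C hC _ => hC).integrable
    exact ⟨R, fun s hs => hR () s hs⟩
  choose R hR using h1
  obtain ⟨M, hM⟩ := ((chartsOn (n := n) hK).finite_toSet.image R).bddAbove
  exact ⟨M, fun c hc s hs => hR c s ((hM ⟨c, hc, rfl⟩).trans_lt hs)⟩

/-- The zeta functions of a bounded family of test forms supported in `K` have meromorphic
continuations with bounded residues at `0`, which vanish if `K` does not meet the zero set. -/
theorem exists_bounded_residue {Λ : Type*} (o : ManifoldOrientation n X) (μ : MorseBott Y)
    (h : p + q = n) (α : singularForms μ p) (φ : Λ → TestForm n X q) {K : Set X}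
    (hK : IsCompact K) (hφ : ∀ a, formSupport (φ a).form ⊆ K)
    (hb : ∀ c ∈ chartsOn (n := n) hK, ∀ i : ℕ, ∃ C : ℝ, ∀ a, ∀ z ∈ chartSet n K c,
      ‖iteratedFDeriv ℝ i (chartRep (φ a).form c) z‖ ≤ C) :
    ∃ r : Λ → ℂ, (∃ C : ℝ, ∀ a, ‖r a‖ ≤ C) ∧
      (∀ a, HasSimpleResidue (zetaFun o μ.toFun (wedge h α.1 (φ a).form)) (r a)) ∧
      (Disjoint K Y.carrier → ∀ a, r a = 0) := by
  classical
  have h1 : ∀ c : X, ∃ r : Λ → ℂ, c ∈ chartsOn (n := n) hK → (∃ C : ℝ, ∀ a, ‖r a‖ ≤ C) ∧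
      (∀ a, HasSimpleResidue (fun s => ∫ z, (μ.toFun ((extChartAt (𝓡 n) c).symm z) : ℂ) ^ (s / 2) *
        chartCoeff o (chartPartition n X c) (wedge h α.1 (φ a).form) c z) (r a)) ∧
      (Disjoint K Y.carrier → ∀ a, r a = 0) := by
    intro c
    by_cases hc : c ∈ chartsOn (n := n) hK
    · obtain ⟨r, hr1, hr2, hr3⟩ :=
        (zetaFam_chartPartition o μ h α φ hK hφ c (hb c hc)).residue
      refine ⟨r, fun _ => ⟨hr1, hr2, fun hd => hr3 ?_⟩⟩
      rintro _ ⟨x, hx, rfl⟩ h0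
      rw [μ.chartFun_eq_zero, (extChartAt (𝓡 n) c).left_inv
        (chartPartition_tsupport_subset n X c hx.1)] at h0
      exact disjoint_left.1 hd hx.2 h0
    · exact ⟨0, fun h => absurd h hc⟩
  choose r hr using h1
  refine ⟨fun a => ∑ c ∈ chartsOn (n := n) hK, r c a, ?_, fun a => ?_, fun hd a => ?_⟩
  · have h2 : ∀ c : X, ∃ C : ℝ, c ∈ chartsOn (n := n) hK → ∀ a, ‖r c a‖ ≤ C := by
      intro c
      by_cases hc : c ∈ chartsOn (n := n) hK
      · obtain ⟨C, hC⟩ := (hr c hc).1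
        exact ⟨C, fun _ => hC⟩
      · exact ⟨0, fun h => absurd h hc⟩
    choose C hC using h2
    exact ⟨∑ c ∈ chartsOn (n := n) hK, C c, fun a =>
      (norm_sum_le _ _).trans (Finset.sum_le_sum fun c hc => hC c hc a)⟩
  · refine (HasSimpleResidue.sum (chartsOn (n := n) hK) fun c hc => (hr c hc).2.1 a).congr (R := 0)
      fun s _ => ?_
    exact (zetaFun_eq_sum o μ.toFun hK (fun x hx =>
      wedge_eq_zero h α.1 ((φ a).eq_zero_of_notMem (hφ a) hx)) s).symm
  · exact Finset.sum_eq_zero fun c hc => (hr c hc).2.2 hd a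

/-- `I0` is the residue of the zeta function of `α ∧ φ`, and vanishes if the support of `φ` does not
meet the zero set of `μ`. -/
theorem hasSimpleResidue_I0 (o : ManifoldOrientation n X) (μ : MorseBott Y) (h : p + q = n)
    (α : singularForms μ p) (φ : TestForm n X q) :
    HasSimpleResidue (zetaFun o μ.toFun (wedge h α.1 φ.form))
      (I0 o μ.toFun (wedge h α.1 φ.form)) ∧
    (Disjoint (formSupport φ.form) Y.carrier → I0 o μ.toFun (wedge h α.1 φ.form) = 0) := by
  obtain ⟨r, -, hr, hr0⟩ := exists_bounded_residue (Λ := Unit) o μ h α (fun _ => φ) φ.2.2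
    (fun _ => Subset.rfl) fun c _ i => (φ.exists_bound c (isCompact_chartSet φ.2.2 c)
      (chartSet_subset _ c) i).imp fun C hC _ => hC
  rw [(I0_eq_of_hasSimpleResidue (hr ())).2]
  exact ⟨hr (), fun hd => hr0 hd ()⟩

theorem I0_add_smul_right (o : ManifoldOrientation n X) (μ : MorseBott Y) (h : p + q = n)
    (α : singularForms μ p) (φ ψ : TestForm n X q) (a : ℂ) :
    I0 o μ.toFun (wedge h α.1 (φ + a • ψ).form) =
      I0 o μ.toFun (wedge h α.1 φ.form) + a * I0 o μ.toFun (wedge h α.1 ψ.form) := by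
  have hK := φ.2.2.union ψ.2.2
  obtain ⟨R, hR⟩ := zetaFun_add_smul o μ.toFun hK
    (fun x hx => wedge_eq_zero h α.1 (φ.eq_zero_of_notMem subset_union_left hx))
    (fun x hx => wedge_eq_zero h α.1 (ψ.eq_zero_of_notMem subset_union_right hx))
    (zetaIntegrable_wedge o μ h α φ hK subset_union_left)
    (zetaIntegrable_wedge o μ h α ψ hK subset_union_right) a
  refine (hasSimpleResidue_I0 o μ h α (φ + a • ψ)).1.unique
    (((hasSimpleResidue_I0 o μ h α φ).1.add
      ((hasSimpleResidue_I0 o μ h α ψ).1.const_mul a)).congr (R := R) fun s hs => ?_)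
  rw [show (φ + a • ψ).form = φ.form + a • ψ.form from rfl, wedge_add_smul_right, hR s hs]
  rfl

theorem I0_add_smul_left (o : ManifoldOrientation n X) (μ : MorseBott Y) (h : p + q = n)
    (α β : singularForms μ p) (φ : TestForm n X q) (a : ℂ) :
    I0 o μ.toFun (wedge h (α + a • β).1 φ.form) =
      I0 o μ.toFun (wedge h α.1 φ.form) + a * I0 o μ.toFun (wedge h β.1 φ.form) := by
  obtain ⟨R, hR⟩ := zetaFun_add_smul o μ.toFun φ.2.2
    (fun x hx => wedge_eq_zero h α.1 (φ.eq_zero_of_notMem Subset.rfl hx))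
    (fun x hx => wedge_eq_zero h β.1 (φ.eq_zero_of_notMem Subset.rfl hx))
    (zetaIntegrable_wedge o μ h α φ φ.2.2 Subset.rfl)
    (zetaIntegrable_wedge o μ h β φ φ.2.2 Subset.rfl) a
  refine (hasSimpleResidue_I0 o μ h (α + a • β) φ).1.unique
    (((hasSimpleResidue_I0 o μ h α φ).1.add
      ((hasSimpleResidue_I0 o μ h β φ).1.const_mul a)).congr (R := R) fun s hs => ?_)
  rw [show (α + a • β).1 = α.1 + a • β.1 from rfl, wedge_add_smul_left, hR s hs]
  rfl

end Pairing

end ResidueCurrents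

end

noncomputable section

namespace ResidueCurrents

/-! ### Independence of the chart -/

section ChangeOfChart

open MeasureTheory

variable {n : ℕ}

theorem alternatingMap_comp_stdFrame {N : Type*} [AddCommGroup N] [Module ℝ N]
    (B : Euc n [⋀^Fin n]→ₗ[ℝ] N) (A : Euc n →ₗ[ℝ] Euc n) :
    B (fun i => A (stdFrame n i)) = LinearMap.det A • B (stdFrame n) := by
  set b := (EuclideanSpace.basisFun (Fin n) ℝ).toBasis with hb
  have hbi : ∀ i, b i = stdFrame n i := fun i => by simp [hb]
  have hbf : (b : Fin n → Euc n) = stdFrame n := funext hbi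
  have h1 : B = (LinearMap.toSpanSingleton ℝ N (B b)).compAlternatingMap b.det := by
    refine b.ext_alternating fun v hv => ?_
    set σ : Equiv.Perm (Fin n) := Equiv.ofBijective v (Finite.injective_iff_bijective.1 hv)
    change B (b ∘ σ) = b.det (b ∘ σ) • B b
    rw [AlternatingMap.map_perm, AlternatingMap.map_perm, b.det_self, smul_assoc, one_smul]
  have h2 : B (fun i => A (stdFrame n i)) = b.det (A ∘ b) • B b := by
    conv_lhs => rw [h1]
    rw [hbf]
    rfl
  rw [h2, b.det_comp, b.det_self, mul_one, hbf]

variable {X : Type u} [TopologicalSpace X] [ChartedSpace (Euc n) X]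

/-- The change of coordinates from the chart at `j` to the chart at `c`. -/
abbrev transition (j c : X) : Euc n → Euc n := extChartAt (𝓡 n) c ∘ (extChartAt (𝓡 n) j).symm

/-- The domain of the change of coordinates. -/
abbrev transitionDomain (j c : X) : Set (Euc n) :=
  (extChartAt (𝓡 n) j).target ∩ (extChartAt (𝓡 n) j).symm ⁻¹' (extChartAt (𝓡 n) c).source

theorem isOpen_transitionDomain (j c : X) : IsOpen (transitionDomain (n := n) j c) :=
  isOpen_extChartAt_preimage j (isOpen_extChartAt_source c)

theorem transition_mem {j c : X} {z : Euc n} (hz : z ∈ transitionDomain j c) :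
    transition j c z ∈ transitionDomain c j ∧
      (extChartAt (𝓡 n) c).symm (transition j c z) = (extChartAt (𝓡 n) j).symm z ∧
      transition c j (transition j c z) = z := by
  have h1 : (extChartAt (𝓡 n) c).symm (transition j c z) = (extChartAt (𝓡 n) j).symm z :=
    (extChartAt (𝓡 n) c).left_inv hz.2
  refine ⟨⟨(extChartAt (𝓡 n) c).map_source hz.2, ?_⟩, h1, ?_⟩
  · rw [mem_preimage, h1]
    exact (extChartAt (𝓡 n) j).map_target hz.1
  · change extChartAt (𝓡 n) j ((extChartAt (𝓡 n) c).symm (transition j c z)) = z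
    rw [h1, (extChartAt (𝓡 n) j).right_inv hz.1]

theorem image_transition (j c : X) :
    transition j c '' transitionDomain (n := n) j c = transitionDomain c j := by
  refine Subset.antisymm ?_ fun z hz => ?_
  · rintro _ ⟨z, hz, rfl⟩
    exact (transition_mem hz).1
  · exact ⟨transition c j z, (transition_mem hz).1, (transition_mem hz).2.2⟩

variable [IsManifold (𝓡 n) ∞ X]

theorem differentiableAt_transition {j c : X} {z : Euc n} (hz : z ∈ transitionDomain j c) :
    DifferentiableAt ℝ (transition j c) z := by
  have h1 := contDiffAt_transition (n := n) (c := j) (c' := c)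
    (x := (extChartAt (𝓡 n) j).symm z)
    (by rw [← extChartAt_source (𝓡 n)]; exact (extChartAt (𝓡 n) j).map_target hz.1)
    (by rw [← extChartAt_source (𝓡 n)]; exact hz.2)
  rw [(extChartAt (𝓡 n) j).right_inv hz.1] at h1
  exact h1.differentiableAt (by simp)

theorem det_fderiv_transition_ne_zero {j c : X} {z : Euc n} (hz : z ∈ transitionDomain j c) :
    (fderiv ℝ (transition j c) z).det ≠ 0 := by
  obtain ⟨A, hA⟩ := exists_equiv_fderiv (f := transition j c) (g := transition c j)
    (differentiableAt_transition hz) (differentiableAt_transition (transition_mem hz).1)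
    (by
      filter_upwards [(isOpen_transitionDomain j c).mem_nhds hz] with y hy
      exact (transition_mem hy).2.2)
    (by
      filter_upwards [(isOpen_transitionDomain c j).mem_nhds (transition_mem hz).1] with y hy
      exact (transition_mem hy).2.2)
  rw [hA]
  exact (LinearEquiv.isUnit_det' A.toLinearEquiv).ne_zero

theorem mfderiv_symm_transition {j c : X} {z : Euc n} (hz : z ∈ transitionDomain j c)
    (v : Euc n) : (mfderiv 𝓘(ℝ, Euc n) (𝓡 n) (extChartAt (𝓡 n) j).symm z v : Euc n) =
      mfderiv 𝓘(ℝ, Euc n) (𝓡 n) (extChartAt (𝓡 n) c).symm (transition j c z)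
        (fderiv ℝ (transition j c) z v) := by
  have hcomp : mfderiv 𝓘(ℝ, Euc n) (𝓡 n) ((extChartAt (𝓡 n) c).symm ∘ transition j c) z =
      (mfderiv 𝓘(ℝ, Euc n) (𝓡 n) (extChartAt (𝓡 n) c).symm (transition j c z)).comp
        (mfderiv 𝓘(ℝ, Euc n) 𝓘(ℝ, Euc n) (transition j c) z) :=
    mfderiv_comp z (mdifferentiableAt_symm (transition_mem hz).1.1)
      (differentiableAt_transition hz).mdifferentiableAt
  have heq : (extChartAt (𝓡 n) c).symm ∘ transition j c =ᶠ[𝓝 z] (extChartAt (𝓡 n) j).symm := by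
    filter_upwards [(isOpen_transitionDomain j c).mem_nhds hz] with y hy
    exact (transition_mem hy).2.1
  have h5 := heq.mfderiv_eq (I := 𝓘(ℝ, Euc n)) (I' := 𝓡 n)
  have h6 : (mfderiv 𝓘(ℝ, Euc n) (𝓡 n) ((extChartAt (𝓡 n) c).symm ∘ transition j c) z v :
      Euc n) = mfderiv 𝓘(ℝ, Euc n) (𝓡 n) (extChartAt (𝓡 n) c).symm (transition j c z)
        (fderiv ℝ (transition j c) z v) := by
    rw [hcomp, mfderiv_eq_fderiv]
    rfl
  rw [← h6]
  exact (congrArg (fun A : Euc n →L[ℝ] Euc n => A v) h5).symm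

theorem chartRep_stdFrame_transition (β : Form n X n) {j c : X} {z : Euc n}
    (hz : z ∈ transitionDomain j c) : chartRep β j z (stdFrame n) =
      ((fderiv ℝ (transition j c) z).det : ℂ) * chartRep β c (transition j c z) (stdFrame n) := by
  have h1 : chartRep β j z (stdFrame n) = chartRep β c (transition j c z)
      (fun i => fderiv ℝ (transition j c) z (stdFrame n i)) := by
    let βf : X → (Fin n → Euc n) → ℂ := fun y w => β y w
    change βf ((extChartAt (𝓡 n) j).symm z) _ = βf ((extChartAt (𝓡 n) c).symm (transition j c z)) _
    rw [(transition_mem hz).2.1]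
    congr 1
    funext i
    exact mfderiv_symm_transition hz _
  rw [h1]
  exact (alternatingMap_comp_stdFrame (chartRep β c (transition j c z)).toAlternatingMap
    (fderiv ℝ (transition j c) z).toLinearMap).trans Complex.real_smul

theorem someVector_coordFrame_ne_zero
    (o : (x : X) → Orientation ℝ (TangentSpace (𝓡 n) x) (Fin n)) {c : X} {z : Euc n}
    (hz : z ∈ (extChartAt (𝓡 n) c).target) :
    ((o ((extChartAt (𝓡 n) c).symm z)).someVector fun i : Fin n =>
      mfderiv 𝓘(ℝ, Euc n) (𝓡 n) (extChartAt (𝓡 n) c).symm z (stdFrame n i)) ≠ 0 := by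
  have : IsManifold (𝓡 n) 1 X := IsManifold.of_le (n := ∞) (by simp)
  intro h0
  have hinv := isInvertible_mfderivWithin_extChartAt_symm (I := 𝓡 n) hz
  rw [ModelWithCorners.range_eq_univ, mfderivWithin_univ] at hinv
  obtain ⟨A, hA⟩ := hinv
  set B : Euc n [⋀^Fin n]→ₗ[ℝ] ℝ := (o ((extChartAt (𝓡 n) c).symm z)).someVector.compLinearMap
    (mfderiv 𝓘(ℝ, Euc n) (𝓡 n) (extChartAt (𝓡 n) c).symm z).toLinearMap with hB
  have hb : ((EuclideanSpace.basisFun (Fin n) ℝ).toBasis : Fin n → Euc n) = stdFrame n :=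
    funext fun i => by simp
  have hB0 : B = 0 := by
    rw [← AlternatingMap.map_basis_eq_zero_iff (EuclideanSpace.basisFun (Fin n) ℝ).toBasis, hb]
    exact h0
  refine (o ((extChartAt (𝓡 n) c).symm z)).someVector_ne_zero ?_
  ext v
  have h2 : ∀ i, mfderiv 𝓘(ℝ, Euc n) (𝓡 n) (extChartAt (𝓡 n) c).symm z (A.symm (v i)) = v i :=
    fun i => by
      rw [← hA]
      exact A.apply_symm_apply (v i)
  have h1 : ((o ((extChartAt (𝓡 n) c).symm z)).someVector fun i : Fin n =>
      mfderiv 𝓘(ℝ, Euc n) (𝓡 n) (extChartAt (𝓡 n) c).symm z (A.symm (v i))) = 0 :=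
    congrArg (fun f : Euc n [⋀^Fin n]→ₗ[ℝ] ℝ => f fun i => A.symm (v i)) hB0
  rw [funext h2] at h1
  exact h1

/-- The orientation sign changes by the sign of the Jacobian determinant. -/
theorem frameSign_transition (o : (x : X) → Orientation ℝ (TangentSpace (𝓡 n) x) (Fin n))
    {j c : X} {z : Euc n} (hz : z ∈ transitionDomain j c) :
    |(fderiv ℝ (transition j c) z).det| * frameSign o c (transition j c z) =
      frameSign o j z * (fderiv ℝ (transition j c) z).det := by
  set d := (fderiv ℝ (transition j c) z).det with hd
  have hd0 : d ≠ 0 := det_fderiv_transition_ne_zero hz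
  set t := (o ((extChartAt (𝓡 n) c).symm (transition j c z))).someVector fun i : Fin n =>
      mfderiv 𝓘(ℝ, Euc n) (𝓡 n) (extChartAt (𝓡 n) c).symm (transition j c z) (stdFrame n i)
    with ht
  have ht0 : t ≠ 0 := someVector_coordFrame_ne_zero o (transition_mem hz).1.1
  have h1 : ((o ((extChartAt (𝓡 n) j).symm z)).someVector fun i : Fin n =>
      mfderiv 𝓘(ℝ, Euc n) (𝓡 n) (extChartAt (𝓡 n) j).symm z (stdFrame n i)) = d * t := by
    set B : Euc n [⋀^Fin n]→ₗ[ℝ] ℝ :=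
      (o ((extChartAt (𝓡 n) c).symm (transition j c z))).someVector.compLinearMap
        (mfderiv 𝓘(ℝ, Euc n) (𝓡 n) (extChartAt (𝓡 n) c).symm (transition j c z)).toLinearMap
    have h2 := alternatingMap_comp_stdFrame B (fderiv ℝ (transition j c) z).toLinearMap
    refine Eq.trans ?_ h2
    let αf : X → (Fin n → Euc n) → ℝ := fun y w => (o y).someVector w
    change αf ((extChartAt (𝓡 n) j).symm z) _ = αf ((extChartAt (𝓡 n) c).symm (transition j c z)) _
    rw [(transition_mem hz).2.1]
    congr 1
    funext i
    exact mfderiv_symm_transition hz _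
  have h3 : frameSign o c (transition j c z) = if 0 < t then 1 else -1 := rfl
  have h4 : frameSign o j z = if 0 < d * t then 1 else -1 := by
    rw [← h1]
    rfl
  rw [h3, h4]
  rcases lt_or_gt_of_ne hd0 with hd1 | hd1 <;> rcases lt_or_gt_of_ne ht0 with ht1 | ht1
  · rw [if_neg ht1.not_gt, if_pos (mul_pos_of_neg_of_neg hd1 ht1), abs_of_neg hd1]
    ring
  · rw [if_pos ht1, if_neg (mul_neg_of_neg_of_pos hd1 ht1).not_gt, abs_of_neg hd1]
    ring
  · rw [if_neg ht1.not_gt, if_neg (mul_neg_of_pos_of_neg hd1 ht1).not_gt, abs_of_pos hd1]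
    ring
  · rw [if_pos ht1, if_pos (mul_pos hd1 ht1), abs_of_pos hd1]
    ring

/-- The integral of a form supported in two charts may be computed in either of them. -/
theorem integral_chartCoeff_eq (o : ManifoldOrientation n X) (w : X → ℝ) (β : Form n X n) (c j : X)
    (hc : ∀ x, w x ≠ 0 → x ∈ (extChartAt (𝓡 n) c).source)
    (hj : ∀ x, β x ≠ 0 → x ∈ (extChartAt (𝓡 n) j).source) :
    ∫ z, chartCoeff o w β c z = ∫ z, chartCoeff o w β j z := by
  have h1 : ∀ z ∉ transitionDomain c j, chartCoeff o w β c z = 0 := by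
    intro z hz
    by_cases hzt : z ∈ (extChartAt (𝓡 n) c).target
    · rw [chartCoeff, indicator_of_mem hzt, chartRep_eq_zero (by
        by_contra h
        exact hz ⟨hzt, hj _ h⟩)]
      exact mul_zero _
    · exact indicator_of_notMem hzt _
  have h2 : ∀ z ∉ transitionDomain j c, chartCoeff o w β j z = 0 := by
    intro z hz
    by_cases hzt : z ∈ (extChartAt (𝓡 n) j).target
    · have hw : w ((extChartAt (𝓡 n) j).symm z) = 0 := by
        by_contra h
        exact hz ⟨hzt, hc _ h⟩
      rw [chartCoeff, indicator_of_mem hzt, hw, zero_mul, Complex.ofReal_zero, zero_mul]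
    · exact indicator_of_notMem hzt _
  rw [← setIntegral_eq_integral_of_forall_compl_eq_zero h1,
    ← setIntegral_eq_integral_of_forall_compl_eq_zero h2, ← image_transition j c,
    integral_image_eq_integral_abs_det_fderiv_smul volume
      (isOpen_transitionDomain j c).measurableSet
      (fun z hz => (differentiableAt_transition hz).hasFDerivAt.hasFDerivWithinAt)
      (fun z hz z' hz' h => by
        rw [← (transition_mem hz).2.2, h, (transition_mem hz').2.2])]
  refine setIntegral_congr_fun (isOpen_transitionDomain j c).measurableSet fun z hz => ?_
  beta_reduce
  rw [chartCoeff, chartCoeff, indicator_of_mem hz.1, indicator_of_mem (transition_mem hz).1.1,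
    (transition_mem hz).2.1, chartRep_stdFrame_transition β hz, Complex.real_smul]
  have h3 := congrArg (fun t : ℝ => (t : ℂ)) (frameSign_transition o.orient hz)
  simp only [Complex.ofReal_mul] at h3 ⊢
  linear_combination ((w ((extChartAt (𝓡 n) j).symm z) : ℂ) *
    chartRep β c (transition j c z) (stdFrame n)) * h3

variable [T2Space X] [SigmaCompactSpace X]

theorem sum_chartPartition_eq_one {K : Set X} (hK : IsCompact K) {x : X} (hx : x ∈ K) :
    ∑ c ∈ chartsOn (n := n) hK, chartPartition n X c x = 1 := by
  rw [← (chartPartition n X).sum_eq_one (mem_univ x), finsum_eq_sum_of_support_subset]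
  intro c hc
  exact mem_chartsOn hK hx hc

variable {p q m : ℕ} {Y : ClosedSubmanifold n m X}

/-- The zeta function of `α ∧ φ` for a test form supported in a chart is an integral in this
chart. -/
theorem zetaFun_wedge_eq_integral (o : ManifoldOrientation n X) (μ : MorseBott Y)
    (h : p + q = n) (α : singularForms μ p) (φ : TestForm n X q) {K : Set X}
    (hK : IsCompact K) (hφ : formSupport φ.form ⊆ K) (j : X)
    (hKj : K ⊆ (extChartAt (𝓡 n) j).source) :
    ∃ R : ℝ, ∀ s : ℂ, R < s.re →
      (Integrable fun z => (μ.chartFun j z : ℂ) ^ (s / 2) *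
        chartCoeff o (fun _ => 1) (wedge h α.1 φ.form) j z) ∧
      zetaFun o μ.toFun (wedge h α.1 φ.form) s = ∫ z, (μ.chartFun j z : ℂ) ^ (s / 2) *
        chartCoeff o (fun _ => 1) (wedge h α.1 φ.form) j z := by
  set β := wedge h α.1 φ.form with hβ
  have hβ0 : ∀ x ∉ K, β x = 0 := fun x hx =>
    wedge_eq_zero h α.1 (φ.eq_zero_of_notMem hφ hx)
  set L := extChartAt (𝓡 n) j '' K with hLdef
  have hL : IsCompact L := hK.image_of_continuousOn ((continuousOn_extChartAt j).mono hKj)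
  have hLt : L ⊆ (extChartAt (𝓡 n) j).target := by
    rintro _ ⟨x, hx, rfl⟩
    exact (extChartAt (𝓡 n) j).map_source (hKj hx)
  have hfam : ∀ w : X → ℝ, ContMDiff (𝓡 n) 𝓘(ℝ) ∞ w → ∃ R : ℝ, ∀ s : ℂ, R < s.re →
      Integrable fun z => (μ.chartFun j z : ℂ) ^ (s / 2) * chartCoeff o w β j z := by
    intro w hw
    obtain ⟨R, hR⟩ := (zetaFam_chart (Λ := Unit) o μ h α (fun _ => φ) j hw hL hLt
      (fun _ z hz hzL => Or.inr (φ.eq_zero_of_notMem hφ fun hx =>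
        hzL ⟨_, hx, (extChartAt (𝓡 n) j).right_inv hz⟩))
      fun i => (φ.exists_bound j hL hLt i).imp fun C hC _ => hC).integrable
    exact ⟨R, fun s hs => hR () s hs⟩
  obtain ⟨R0, hR0⟩ := hfam (fun _ => 1) contMDiff_const
  have h1 := fun c : X => hfam (chartPartition n X c) (chartPartition n X c).contMDiff
  choose R hR using h1
  obtain ⟨M, hM⟩ := ((chartsOn (n := n) hK).finite_toSet.image R).bddAbove
  refine ⟨max R0 M, fun s hs => ⟨hR0 s ((le_max_left _ _).trans_lt hs), ?_⟩⟩
  have hs' : M < s.re := (le_max_right _ _).trans_lt hs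
  set βs : Form n X n := fun x => ((μ.toFun x : ℂ) ^ (s / 2)) • β x with hβs
  have hβs0 : ∀ x, βs x ≠ 0 → x ∈ (extChartAt (𝓡 n) j).source := by
    intro x hx
    refine hKj ?_
    by_contra hxK
    refine hx ?_
    rw [hβs]
    simp only [hβ0 x hxK]
    exact smul_zero (A := TangentSpace (𝓡 n) x [⋀^Fin n]→L[ℝ] ℂ) ((μ.toFun x : ℂ) ^ (s / 2))
  have hco : ∀ (w : X → ℝ) (c : X) (z : Euc n), chartCoeff o w βs c z =
      (μ.chartFun c z : ℂ) ^ (s / 2) * chartCoeff o w β c z := fun w c z =>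
    chartCoeff_smul o w (fun x => (μ.toFun x : ℂ) ^ (s / 2)) β c z
  rw [zetaFun_eq_sum o μ.toFun hK hβ0]
  have h2 : ∀ c : X, ∫ z, (μ.toFun ((extChartAt (𝓡 n) c).symm z) : ℂ) ^ (s / 2) *
      chartCoeff o (chartPartition n X c) β c z =
      ∫ z, (μ.chartFun j z : ℂ) ^ (s / 2) * chartCoeff o (chartPartition n X c) β j z := by
    intro c
    have h3 := integral_chartCoeff_eq o (chartPartition n X c) βs c j
      (fun x hx => chartPartition_tsupport_subset n X c (subset_tsupport _ hx)) hβs0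
    simp only [hco] at h3
    exact h3
  rw [Finset.sum_congr rfl fun c _ => h2 c, ← integral_finsetSum _ fun c hc =>
    hR c s ((hM ⟨c, hc, rfl⟩).trans_lt hs')]
  refine integral_congr_ae (Eventually.of_forall fun z => ?_)
  beta_reduce
  rw [← Finset.mul_sum]
  congr 1
  by_cases hz : z ∈ (extChartAt (𝓡 n) j).target
  · simp only [chartCoeff, indicator_of_mem hz]
    by_cases hzK : (extChartAt (𝓡 n) j).symm z ∈ K
    · rw [← Finset.sum_mul, ← Complex.ofReal_sum, ← Finset.sum_mul,
        sum_chartPartition_eq_one hK hzK]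
    · rw [chartRep_eq_zero (hβ0 _ hzK)]
      exact (Finset.sum_eq_zero fun c _ => mul_zero _).trans (mul_zero _).symm
  · simp only [chartCoeff, indicator_of_notMem hz, Finset.sum_const_zero]

end ChangeOfChart

end ResidueCurrents

end

noncomputable section

namespace ResidueCurrents

/-! ### Stokes' theorem for `μ ^ (s / 2) ω` -/

section ExtDeriv

open MeasureTheory

variable {V : Type*} [NormedAddCommGroup V] [NormedSpace ℝ V] {k : ℕ}

theorem differentiableAt_alternating_apply {γ : V → V [⋀^Fin k]→L[ℝ] ℂ} {z : V}
    (hγ : DifferentiableAt ℝ γ z) (v : Fin k → V) : DifferentiableAt ℝ (fun y => γ y v) z :=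
  (ContinuousAlternatingMap.apply ℝ V ℂ v).differentiableAt.comp z hγ

theorem extDeriv_fun_smul_apply {c : V → ℂ} {γ : V → V [⋀^Fin k]→L[ℝ] ℂ} {z : V}
    (hc : DifferentiableAt ℝ c z) (hγ : DifferentiableAt ℝ γ z) (v : Fin (k + 1) → V) :
    extDeriv (fun y => c y • γ y) z v = c z * extDeriv γ z v +
      ∑ i : Fin (k + 1), (-1) ^ i.val • (fderiv ℝ c z (v i) * γ z (i.removeNth v)) := by
  have hcγ : DifferentiableAt ℝ (fun y => c y • γ y) z := hc.smul hγ
  rw [extDeriv_apply hcγ, extDeriv_apply hγ, Finset.mul_sum, ← Finset.sum_add_distrib]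
  refine Finset.sum_congr rfl fun i _ => ?_
  have h1 : fderiv ℝ (fun y => (c y • γ y) (i.removeNth v)) z (v i) =
      c z * fderiv ℝ (fun y => γ y (i.removeNth v)) z (v i) +
        fderiv ℝ c z (v i) * γ z (i.removeNth v) := by
    have h2 := fderiv_mul hc (differentiableAt_alternating_apply hγ (i.removeNth v))
    change fderiv ℝ (c * fun y => γ y (i.removeNth v)) z (v i) = _
    rw [h2]
    simp only [add_apply, smul_apply, smul_eq_mul]
    ring
  rw [h1, smul_add, mul_smul_comm]

theorem hasFDerivAt_ofReal_cpow {g : V → ℝ} {a : ℂ} (ha : 1 < a.re) {z : V}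
    (hg : DifferentiableAt ℝ g z) : ∃ c' : V →L[ℝ] ℂ,
      HasFDerivAt (fun y => (g y : ℂ) ^ a) c' z ∧
        ∀ v, c' v = a * (g z : ℂ) ^ (a - 1) * (fderiv ℝ g z v : ℂ) := by
  refine ⟨_, (hasDerivAt_ofReal_cpow ha (g z)).hasFDerivAt.comp z hg.hasFDerivAt, fun v => ?_⟩
  simp only [ContinuousLinearMap.comp_apply, ContinuousLinearMap.toSpanSingleton_apply,
    Complex.real_smul]
  ring

/-- The product rule for a complex power, with `dg ∧ γ` written as `d(g γ) - g dγ`. -/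
theorem extDeriv_cpow_smul {g : V → ℝ} {a : ℂ} (ha : 1 < a.re) {γ : V → V [⋀^Fin k]→L[ℝ] ℂ}
    {z : V} (hg : DifferentiableAt ℝ g z) (hγ : DifferentiableAt ℝ γ z) :
    extDeriv (fun y => ((g y : ℂ) ^ a) • γ y) z = ((g z : ℂ) ^ a) • extDeriv γ z +
      (a * (g z : ℂ) ^ (a - 1)) • (extDeriv (fun y => (g y : ℂ) • γ y) z -
        (g z : ℂ) • extDeriv γ z) := by
  obtain ⟨c', hc', hcv⟩ := hasFDerivAt_ofReal_cpow ha hg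
  have hgC : HasFDerivAt (fun y => (g y : ℂ)) (Complex.ofRealCLM.comp (fderiv ℝ g z)) z :=
    Complex.ofRealCLM.hasFDerivAt.comp z hg.hasFDerivAt
  ext v
  simp only [ContinuousAlternatingMap.add_apply, ContinuousAlternatingMap.smul_apply,
    ContinuousAlternatingMap.sub_apply, smul_eq_mul]
  rw [extDeriv_fun_smul_apply hc'.differentiableAt hγ,
    extDeriv_fun_smul_apply hgC.differentiableAt hγ, hc'.fderiv, hgC.fderiv, add_sub_cancel_left,
    Finset.mul_sum]
  congr 1
  refine Finset.sum_congr rfl fun i _ => ?_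
  rw [hcv, mul_smul_comm]
  congr 1
  simp only [ContinuousLinearMap.comp_apply, Complex.ofRealCLM_apply]
  ring

/-- Stokes' theorem for compactly supported forms on a vector space. -/
theorem integral_extDeriv_eq_zero {Ψ : Euc (k + 1) → Euc (k + 1) [⋀^Fin k]→L[ℝ] ℂ}
    (hΨ : ContDiff ℝ 1 Ψ) (hc : HasCompactSupport Ψ) :
    ∫ z, extDeriv Ψ z (stdFrame (k + 1)) = 0 := by
  have h1 : ∀ u : Fin k → Euc (k + 1), ContDiff ℝ 1 fun z => Ψ z u := fun u =>
    (ContinuousAlternatingMap.apply ℝ (Euc (k + 1)) ℂ u).contDiff.comp hΨ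
  have h2 : ∀ u : Fin k → Euc (k + 1), HasCompactSupport fun z => Ψ z u := fun u =>
    hc.comp_left (g := fun a : Euc (k + 1) [⋀^Fin k]→L[ℝ] ℂ => a u) rfl
  have h3 : ∀ (u : Fin k → Euc (k + 1)) (v : Euc (k + 1)),
      Integrable fun z => fderiv ℝ (fun z => Ψ z u) z v := fun u v =>
    (((h1 u).continuous_fderiv one_ne_zero).clm_apply
      continuous_const).integrable_of_hasCompactSupport ((h2 u).fderiv_apply ℝ v)
  simp only [extDeriv_apply (hΨ.differentiable one_ne_zero _), zsmul_eq_mul]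
  rw [integral_finsetSum _ fun i _ => (h3 _ _).const_mul (((-1) ^ i.val : ℤ) : ℂ)]
  refine Finset.sum_eq_zero fun i _ => ?_
  rw [integral_const_mul, integral_fderiv_apply_eq_zero (h1 _) (h2 _), mul_zero]

end ExtDeriv

section LogWedge

variable {n m : ℕ} {X : Type u} [TopologicalSpace X] [ChartedSpace (Euc n) X]
  [IsManifold (𝓡 n) ∞ X] {p : ℕ} {Y : ClosedSubmanifold n m X} {μ : MorseBott Y}

theorem IsSingularForm.mul {α : Form n X p} (hα : IsSingularForm μ α) :
    IsSingularForm μ (fun x => μ.toFun x • α x) := by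
  refine ⟨fun x hx => ?_, fun x hx => (hα.2.1 x hx).funSmul μ.smooth, fun x => ?_⟩
  · beta_reduce
    rw [hα.1 x hx]
    exact smul_zero (A := TangentSpace (𝓡 n) x [⋀^Fin p]→L[ℝ] ℂ) (μ.toFun x)
  · obtain ⟨N, η, h⟩ := hα.2.2 x
    refine ⟨N, fun y => μ.toFun y • η y, h.mono fun y hy => ⟨hy.1.funSmul μ.smooth, fun hyY => ?_⟩⟩
    beta_reduce
    rw [hy.2 hyY, smul_comm]

theorem IsSingularForm.inv_mul {α : Form n X p} (hα : IsSingularForm μ α) :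
    IsSingularForm μ (fun x => (μ.toFun x)⁻¹ • α x) := by
  refine ⟨fun x hx => ?_, fun x hx c hc => ?_, fun x => ?_⟩
  · beta_reduce
    rw [hα.1 x hx]
    exact smul_zero (A := TangentSpace (𝓡 n) x [⋀^Fin p]→L[ℝ] ℂ) (μ.toFun x)⁻¹
  · have h1 := smooth_in_chart μ.smooth hc
    have h2 : (μ.toFun ∘ (extChartAt (𝓡 n) c).symm) (extChartAt (𝓡 n) c x) ≠ 0 := by
      rw [Function.comp_apply, (extChartAt (𝓡 n) c).left_inv (by rwa [extChartAt_source])]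
      exact fun h => hx ((μ.eq_zero_iff x).1 h)
    exact (h1.inv h2).smul (hα.2.1 x hx c hc)
  · obtain ⟨N, η, h⟩ := hα.2.2 x
    refine ⟨N + 1, η, h.mono fun y hy => ⟨hy.1, fun hyY => ?_⟩⟩
    have h3 : μ.toFun y ≠ 0 := fun h => hyY ((μ.eq_zero_iff y).1 h)
    beta_reduce
    rw [hy.2 hyY, smul_smul, pow_succ, mul_assoc, mul_inv_cancel₀ h3, mul_one]

/-- The form `μ⁻¹ dμ ∧ α`, written as `μ⁻¹ (d(μ α) - μ dα)`. -/
def logWedge (μ : MorseBott Y) (α : singularForms μ p) : singularForms μ (p + 1) :=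
  ⟨_, IsSingularForm.inv_mul ((singularForms μ (p + 1)).sub_mem
    (IsSingularForm.derivOff (IsSingularForm.mul α.2)) (IsSingularForm.mul (singularD μ p α).2))⟩

theorem chartRep_derivOff {α : Form n X p} {c : X} {z : Euc n}
    (hz : z ∈ (extChartAt (𝓡 n) c).target) (hzY : (extChartAt (𝓡 n) c).symm z ∉ Y.carrier)
    (hα : SmoothFormAt α ((extChartAt (𝓡 n) c).symm z)) :
    chartRep (derivOff Y α) c z = extDeriv (chartRep α c) z := by
  have h1 := chartRep_formDeriv (c := c) hα (by
    rw [← extChartAt_source (𝓡 n)]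
    exact (extChartAt (𝓡 n) c).map_target hz)
  rw [(extChartAt (𝓡 n) c).right_inv hz] at h1
  rw [← h1, chartRep, chartRep, derivOff_of_notMem hzY]

theorem chartRep_logWedge (α : singularForms μ p) {c : X} {z : Euc n}
    (hz : z ∈ (extChartAt (𝓡 n) c).target) (hg : μ.chartFun c z ≠ 0) :
    chartRep (logWedge μ α).1 c z = ((μ.chartFun c z : ℂ)⁻¹) •
      (extDeriv (fun y => (μ.chartFun c y : ℂ) • chartRep α.1 c y) z -
        (μ.chartFun c z : ℂ) • extDeriv (chartRep α.1 c) z) := by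
  have hzY : (extChartAt (𝓡 n) c).symm z ∉ Y.carrier := fun h => hg (μ.chartFun_eq_zero.2 h)
  have h1 : chartRep (logWedge μ α).1 c z = (μ.chartFun c z)⁻¹ •
      (chartRep (derivOff Y fun x => μ.toFun x • α.1 x) c z -
        μ.chartFun c z • chartRep (derivOff Y α.1) c z) := rfl
  have h2 : (fun y => (μ.chartFun c y : ℂ) • chartRep α.1 c y) =
      chartRep (fun x => μ.toFun x • α.1 x) c :=
    funext fun y => by
      ext v
      exact (Complex.real_smul (x := μ.chartFun c y)).symm
  rw [h1, chartRep_derivOff hz hzY ((α.2.2.1 _ hzY).funSmul μ.smooth),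
    chartRep_derivOff hz hzY (α.2.2.1 _ hzY), h2, ← Complex.ofReal_inv]
  ext v
  simp only [ContinuousAlternatingMap.smul_apply, ContinuousAlternatingMap.sub_apply,
    Complex.real_smul, smul_eq_mul]

end LogWedge

end ResidueCurrents

end

noncomputable section

namespace ResidueCurrents

/-! ### The residue pairing and the differential -/

section Local

variable {E : Type*} [NormedAddCommGroup E] [NormedSpace ℝ E]

theorem contDiffAt_bilinear {F G H : Type*} [NormedAddCommGroup F] [NormedSpace ℝ F]
    [NormedAddCommGroup G] [NormedSpace ℝ G] [NormedAddCommGroup H] [NormedSpace ℝ H]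
    (L : F →L[ℝ] G →L[ℝ] H) {r : WithTop ℕ∞} {A : E → F} {B : E → G} {z : E}
    (hA : ContDiffAt ℝ r A z) (hB : ContDiffAt ℝ r B z) :
    ContDiffAt ℝ r (fun y => L (A y) (B y)) z :=
  (L.contDiff.contDiffAt.comp z hA).clm_apply hB

/-- Above the critical exponent, a complex power of a real function times a smooth function is
continuously differentiable, with derivative zero where the real function vanishes. -/
theorem contDiffAt_cpow_smul {F : Type*} [NormedAddCommGroup F] [NormedSpace ℝ F]
    [NormedSpace ℂ F] [IsScalarTower ℝ ℂ F] {g : E → ℝ} {H : E → F} {z : E} {a : ℂ}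
    (ha : 1 < a.re) (σ : ℂ) (hg : ContDiffAt ℝ ∞ g z) (hH : ContDiffAt ℝ ∞ H z) :
    ContDiffAt ℝ 1 (fun y => (σ * (g y : ℂ) ^ a) • H y) z ∧
      (g z = 0 → fderiv ℝ (fun y => (σ * (g y : ℂ) ^ a) • H y) z = 0) := by
  have ha0 : a ≠ 0 := by
    rintro rfl
    rw [Complex.zero_re] at ha
    linarith
  have ha1 : a - 1 ≠ 0 := by
    intro h0
    rw [sub_eq_zero.1 h0, Complex.one_re] at ha
    exact lt_irrefl _ ha
  have hgc : ContDiffAt ℝ 1 (fun y => (g y : ℂ) ^ a) z :=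
    (contDiff_ofReal_cpow ha).contDiffAt.comp z (hg.of_le (by simp))
  refine ⟨(contDiffAt_const.mul hgc).smul (hH.of_le (by simp)), fun h0 => ?_⟩
  obtain ⟨c', hc', hcv⟩ := hasFDerivAt_ofReal_cpow ha (hg.differentiableAt (by simp))
  have hc0 : c' = 0 := by
    ext v
    rw [hcv, h0, Complex.ofReal_zero, Complex.zero_cpow ha1]
    simp
  have h1 := (hc'.const_mul σ).smul (hH.differentiableAt (by simp)).hasFDerivAt
  refine h1.fderiv.trans ?_
  ext v
  simp [hc0, h0, Complex.zero_cpow ha0]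

end Local

section Stokes

open MeasureTheory

variable {k m p q : ℕ} {X : Type u} [TopologicalSpace X] [ChartedSpace (Euc (k + 1)) X]
  [IsManifold (𝓡 (k + 1)) ∞ X] [T2Space X] {Y : ClosedSubmanifold (k + 1) m X}

/-- The form `μ ^ (s / 2) α ∧ φ` of degree one less than the dimension, in the oriented chart
at `j`, extended by zero. -/
def primitive (o : ManifoldOrientation (k + 1) X) (μ : MorseBott Y) (h : p + q = k)
    (α : singularForms μ p) (φ : TestForm (k + 1) X q) (j : X) (s : ℂ) :
    Euc (k + 1) → Euc (k + 1) [⋀^Fin k]→L[ℝ] ℂ :=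
  (extChartAt (𝓡 (k + 1)) j).target.indicator fun z => (frameSign o.orient j z : ℂ) •
    ((μ.chartFun j z : ℂ) ^ (s / 2)) • wedgeAt h (chartRep α.1 j z) (chartRep φ.form j z)

/-- For `Re s` large, `μ ^ (s / 2) α ∧ φ` is continuously differentiable, with derivative zero on
the zero set of `μ`. -/
theorem contDiffAt_primitive (o : ManifoldOrientation (k + 1) X) (μ : MorseBott Y) (h : p + q = k)
    (α : singularForms μ p) (φ : TestForm (k + 1) X q) (j : X) {z : Euc (k + 1)}
    (hz : z ∈ (extChartAt (𝓡 (k + 1)) j).target) :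
    ∃ W ∈ 𝓝 z, ∃ R : ℝ, ∀ s : ℂ, R < s.re → ∀ y ∈ W,
      ContDiffAt ℝ 1 (primitive o μ h α φ j s) y ∧
        (μ.chartFun j y = 0 → fderiv ℝ (primitive o μ h α φ j s) y = 0) := by
  obtain ⟨N, η, hη⟩ := α.2.2.2 ((extChartAt (𝓡 (k + 1)) j).symm z)
  obtain ⟨W, hWsub, hWo, hzW⟩ := eventually_nhds_iff.1 (((isOpen_extChartAt_target
    (I := 𝓡 (k + 1)) j).eventually_mem hz).and
      ((eventually_symm hz hη).and (o.locallyConstant j z hz)))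
  refine ⟨W, hWo.mem_nhds hzW, 2 * N + 2, fun s hs y hy => ?_⟩
  set a : ℂ := s / 2 - N with ha
  have hare : 1 < a.re := by
    have h1 : a.re = s.re / 2 - N := by simp [ha]
    rw [h1]
    linarith
  set H : Euc (k + 1) → Euc (k + 1) [⋀^Fin k]→L[ℝ] ℂ := fun y =>
    wedgeAt h (chartRep η j y) (chartRep φ.form j y) with hH
  have heq : primitive o μ h α φ j s =ᶠ[𝓝 y] fun y =>
      ((frameSign o.orient j z : ℂ) * (μ.chartFun j y : ℂ) ^ a) • H y := by
    filter_upwards [hWo.mem_nhds hy] with y hy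
    obtain ⟨hyt, hyη, hyo⟩ := hWsub y hy
    rw [primitive, indicator_of_mem hyt, hyo, mul_smul]
    congr 1
    ext v
    simp only [ContinuousAlternatingMap.smul_apply, smul_eq_mul, hH, ha]
    refine cpow_mul_eq (by linarith) (fun h0 => ?_) fun h0 => ?_
    · rw [chartRep_eq_zero (α.2.1 _ (μ.chartFun_eq_zero.1 h0)), wedgeAt_zero_left]
      rfl
    · have hyY : (extChartAt (𝓡 (k + 1)) j).symm y ∉ Y.carrier := fun h =>
        h0 (μ.chartFun_eq_zero.2 h)
      have h1 : chartRep η j y = ((μ.chartFun j y : ℂ) ^ N) • chartRep α.1 j y := by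
        rw [chartRep, hyη.2 hyY]
        ext v
        change ((μ.toFun ((extChartAt (𝓡 (k + 1)) j).symm y) ^ N : ℝ) : ℝ) •
          (chartRep α.1 j y v) = _
        rw [Complex.real_smul, Complex.ofReal_pow]
        rfl
      rw [h1, wedgeAt_smul_left]
      rfl
  obtain ⟨hyt, hyη, -⟩ := hWsub y hy
  have hHs : ContDiffAt ℝ ∞ H y := contDiffAt_bilinear (wedgeCLM (Euc (k + 1)) h)
    (SmoothFormAt.contDiffAt_chartRep hyt hyη.1) (φ.contDiffAt_chartRep hyt)
  have hg : ContDiffAt ℝ ∞ (μ.chartFun j) y :=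
    (μ.contDiffOn_chartFun j).contDiffAt ((isOpen_extChartAt_target j).mem_nhds hyt)
  have hcs := contDiffAt_cpow_smul hare (frameSign o.orient j z : ℂ) hg hHs
  exact ⟨hcs.1.congr_of_eventuallyEq heq, fun h0 => heq.fderiv_eq.trans (hcs.2 h0)⟩

/-- The exterior derivative of `μ ^ (s / 2) α ∧ φ` away from the zero set of `μ`. -/
theorem extDeriv_primitive (o : ManifoldOrientation (k + 1) X) (μ : MorseBott Y) (h : p + q = k)
    (h' : p + 1 + q = k + 1) (h'' : p + (q + 1) = k + 1)
    (α : singularForms μ p) (φ : TestForm (k + 1) X q) (j : X) {s : ℂ} (hs : 2 < s.re)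
    {z : Euc (k + 1)} (hz : z ∈ (extChartAt (𝓡 (k + 1)) j).target) (hg : μ.chartFun j z ≠ 0) :
    extDeriv (primitive o μ h α φ j s) z (stdFrame (k + 1)) =
      (μ.chartFun j z : ℂ) ^ (s / 2) * (
        chartCoeff o (fun _ => 1) (wedge h' (singularD μ p α).1 φ.form) j z +
        (-1) ^ p * chartCoeff o (fun _ => 1) (wedge h'' α.1 (formDeriv φ.form)) j z +
        s / 2 * chartCoeff o (fun _ => 1) (wedge h' (logWedge μ α).1 φ.form) j z) := by
  have hzY : (extChartAt (𝓡 (k + 1)) j).symm z ∉ Y.carrier := fun h =>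
    hg (μ.chartFun_eq_zero.2 h)
  have hA := (SmoothFormAt.contDiffAt_chartRep hz (α.2.2.1 _ hzY)).differentiableAt
    (by simp : (∞ : WithTop ℕ∞) ≠ 0)
  have hB := (φ.contDiffAt_chartRep hz).differentiableAt (by simp : (∞ : WithTop ℕ∞) ≠ 0)
  have hgd : DifferentiableAt ℝ (μ.chartFun j) z :=
    ((μ.contDiffOn_chartFun j).contDiffAt
      ((isOpen_extChartAt_target j).mem_nhds hz)).differentiableAt (by simp)
  have hgC : DifferentiableAt ℝ (fun y => (μ.chartFun j y : ℂ)) z :=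
    Complex.ofRealCLM.differentiableAt.comp z hgd
  have hgA : DifferentiableAt ℝ (fun y => (μ.chartFun j y : ℂ) • chartRep α.1 j y) z :=
    hgC.smul hA
  set γ : Euc (k + 1) → Euc (k + 1) [⋀^Fin k]→L[ℝ] ℂ := fun y =>
    wedgeAt h (chartRep α.1 j y) (chartRep φ.form j y) with hγdef
  have hγ : DifferentiableAt ℝ γ z := ((wedgeCLM (Euc (k + 1)) h).hasFDerivAt_of_bilinear
    hA.hasFDerivAt hB.hasFDerivAt).differentiableAt
  have ha : 1 < (s / 2).re := by
    have h1 : (s / 2).re = s.re / 2 := by simp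
    rw [h1]
    linarith
  obtain ⟨c', hc', -⟩ := hasFDerivAt_ofReal_cpow ha hgd
  have hF : DifferentiableAt ℝ (fun y => ((μ.chartFun j y : ℂ) ^ (s / 2)) • γ y) z :=
    hc'.differentiableAt.smul hγ
  have heq : primitive o μ h α φ j s =ᶠ[𝓝 z] (frameSign o.orient j z : ℂ) •
      fun y => ((μ.chartFun j y : ℂ) ^ (s / 2)) • γ y := by
    filter_upwards [(isOpen_extChartAt_target (I := 𝓡 (k + 1)) j).mem_nhds hz,
      o.locallyConstant j z hz] with y hy hyo
    rw [primitive, indicator_of_mem hy, hyo]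
    rfl
  have hdγ : extDeriv γ z = wedgeAt h' (extDeriv (chartRep α.1 j) z) (chartRep φ.form j z) +
      (-1 : ℂ) ^ p • wedgeAt h'' (chartRep α.1 j z) (extDeriv (chartRep φ.form j) z) :=
    extDeriv_wedgeAt h h' h'' hA hB
  have hdgγ : extDeriv (fun y => (μ.chartFun j y : ℂ) • γ y) z =
      wedgeAt h' (extDeriv (fun y => (μ.chartFun j y : ℂ) • chartRep α.1 j y) z)
        (chartRep φ.form j z) + (-1 : ℂ) ^ p • wedgeAt h''
          ((μ.chartFun j z : ℂ) • chartRep α.1 j z) (extDeriv (chartRep φ.form j) z) := by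
    rw [← extDeriv_wedgeAt h h' h'' hgA hB]
    congr 1
    funext y
    exact (wedgeAt_smul_left h _ _ _).symm
  have hc1 : chartCoeff o (fun _ => 1) (wedge h' (singularD μ p α).1 φ.form) j z =
      (frameSign o.orient j z : ℂ) * wedgeAt h' (extDeriv (chartRep α.1 j) z)
        (chartRep φ.form j z) (stdFrame (k + 1)) := by
    rw [chartCoeff, indicator_of_mem hz, one_mul, chartRep_wedge]
    have := chartRep_derivOff (Y := Y) hz hzY (α.2.2.1 _ hzY)
    rw [← this]
    rfl
  have hc2 : chartCoeff o (fun _ => 1) (wedge h'' α.1 (formDeriv φ.form)) j z =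
      (frameSign o.orient j z : ℂ) * wedgeAt h'' (chartRep α.1 j z)
        (extDeriv (chartRep φ.form j) z) (stdFrame (k + 1)) := by
    rw [chartCoeff, indicator_of_mem hz, one_mul, chartRep_wedge]
    have h1 := chartRep_formDeriv (c := j) (φ.2.1 ((extChartAt (𝓡 (k + 1)) j).symm z)) (by
      rw [← extChartAt_source (𝓡 (k + 1))]
      exact (extChartAt (𝓡 (k + 1)) j).map_target hz)
    rw [(extChartAt (𝓡 (k + 1)) j).right_inv hz] at h1
    rw [show extDeriv (chartRep φ.form j) z = _ from h1.symm]
    rfl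
  have hc3 : chartCoeff o (fun _ => 1) (wedge h' (logWedge μ α).1 φ.form) j z =
      (frameSign o.orient j z : ℂ) * ((μ.chartFun j z : ℂ)⁻¹ *
        (wedgeAt h' (extDeriv (fun y => (μ.chartFun j y : ℂ) • chartRep α.1 j y) z)
          (chartRep φ.form j z) (stdFrame (k + 1)) -
        (μ.chartFun j z : ℂ) * wedgeAt h' (extDeriv (chartRep α.1 j) z)
          (chartRep φ.form j z) (stdFrame (k + 1)))) := by
    rw [chartCoeff, indicator_of_mem hz, one_mul, chartRep_wedge, chartRep_logWedge α hz hg,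
      wedgeAt_smul_left, sub_eq_add_neg, ← neg_smul, wedgeAt_add_smul_left]
    simp only [ContinuousAlternatingMap.smul_apply, ContinuousAlternatingMap.add_apply,
      smul_eq_mul]
    ring
  have hgne : (μ.chartFun j z : ℂ) ≠ 0 := by exact_mod_cast hg
  rw [heq.extDeriv_eq, extDeriv_complex_smul _ _ _ hF, extDeriv_cpow_smul ha hgd hγ, hdγ, hdgγ,
    hc1, hc2, hc3, wedgeAt_smul_left, Complex.cpow_sub _ _ hgne, Complex.cpow_one]
  simp only [ContinuousAlternatingMap.smul_apply, ContinuousAlternatingMap.add_apply,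
    ContinuousAlternatingMap.sub_apply, smul_eq_mul]
  field_simp
  ring

/-- Stokes' theorem for `μ ^ (s / 2) α ∧ φ` in a chart. -/
theorem integral_stokes (o : ManifoldOrientation (k + 1) X) (μ : MorseBott Y) (h : p + q = k)
    (h' : p + 1 + q = k + 1) (h'' : p + (q + 1) = k + 1)
    (α : singularForms μ p) (φ : TestForm (k + 1) X q) (j : X)
    (hφj : formSupport φ.form ⊆ (extChartAt (𝓡 (k + 1)) j).source) :
    ∃ R : ℝ, ∀ s : ℂ, R < s.re → ∫ z, (μ.chartFun j z : ℂ) ^ (s / 2) * (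
        chartCoeff o (fun _ => 1) (wedge h' (singularD μ p α).1 φ.form) j z +
        (-1) ^ p * chartCoeff o (fun _ => 1) (wedge h'' α.1 (formDeriv φ.form)) j z +
        s / 2 * chartCoeff o (fun _ => 1) (wedge h' (logWedge μ α).1 φ.form) j z) = 0 := by
  set L := extChartAt (𝓡 (k + 1)) j '' formSupport φ.form with hLdef
  have hL : IsCompact L := φ.2.2.image_of_continuousOn ((continuousOn_extChartAt j).mono hφj)
  have hLt : L ⊆ (extChartAt (𝓡 (k + 1)) j).target := by
    rintro _ ⟨x, hx, rfl⟩
    exact (extChartAt (𝓡 (k + 1)) j).map_source (hφj hx)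
  have hreg : ∃ R : ℝ, ∀ s : ℂ, R < s.re → ∀ y ∈ L,
      ContDiffAt ℝ 1 (primitive o μ h α φ j s) y ∧
        (μ.chartFun j y = 0 → fderiv ℝ (primitive o μ h α φ j s) y = 0) := by
    -- The bound on `Re s` is local in the point; compactness of the support makes it uniform.
    refine hL.induction_on (p := fun L => ∃ R : ℝ, ∀ s : ℂ, R < s.re → ∀ y ∈ L,
      ContDiffAt ℝ 1 (primitive o μ h α φ j s) y ∧
        (μ.chartFun j y = 0 → fderiv ℝ (primitive o μ h α φ j s) y = 0)) ?_ ?_ ?_ ?_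
    · exact ⟨0, fun s _ y hy => absurd hy (notMem_empty y)⟩
    · rintro A B hAB ⟨R, hR⟩
      exact ⟨R, fun s hs y hy => hR s hs y (hAB hy)⟩
    · rintro A B ⟨R, hR⟩ ⟨R', hR'⟩
      refine ⟨max R R', fun s hs y hy => ?_⟩
      rcases hy with hy | hy
      · exact hR s ((le_max_left _ _).trans_lt hs) y hy
      · exact hR' s ((le_max_right _ _).trans_lt hs) y hy
    · intro z hz
      obtain ⟨W, hW, R, hR⟩ := contDiffAt_primitive o μ h α φ j (hLt hz)
      exact ⟨W, mem_nhdsWithin_of_mem_nhds hW, R, hR⟩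
  obtain ⟨R, hR⟩ := hreg
  have hφ0 : ∀ z ∈ (extChartAt (𝓡 (k + 1)) j).target, z ∉ L →
      φ.form ((extChartAt (𝓡 (k + 1)) j).symm z) = 0 := fun z hz hzL =>
    φ.eq_zero_of_notMem Subset.rfl fun hx =>
      hzL ⟨_, hx, (extChartAt (𝓡 (k + 1)) j).right_inv hz⟩
  have hP0 : ∀ s, ∀ z ∉ L, primitive o μ h α φ j s z = 0 := by
    intro s z hzL
    by_cases hz : z ∈ (extChartAt (𝓡 (k + 1)) j).target
    · rw [primitive, indicator_of_mem hz, chartRep_eq_zero (hφ0 z hz hzL), wedgeAt_zero_right]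
      ext v
      change (frameSign o.orient j z : ℂ) * ((μ.chartFun j z : ℂ) ^ (s / 2) * 0) = 0
      rw [mul_zero, mul_zero]
    · exact indicator_of_notMem hz _
  refine ⟨max R 2, fun s hs => ?_⟩
  have hsR : R < s.re := (le_max_left _ _).trans_lt hs
  have hs2 : 2 < s.re := (le_max_right _ _).trans_lt hs
  have hPoff : ∀ z ∉ L, primitive o μ h α φ j s =ᶠ[𝓝 z] fun _ => 0 := fun z hz => by
    filter_upwards [hL.isClosed.isOpen_compl.mem_nhds hz] with y hy
    exact hP0 s y hy
  have hcd : ContDiff ℝ 1 (primitive o μ h α φ j s) := by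
    rw [contDiff_iff_contDiffAt]
    intro z
    by_cases hz : z ∈ L
    · exact (hR s hsR z hz).1
    · exact contDiffAt_const.congr_of_eventuallyEq (hPoff z hz)
  rw [← integral_extDeriv_eq_zero hcd (hasCompactSupport_of_forall_notMem hL (hP0 s))]
  refine integral_congr_ae (Eventually.of_forall fun z => ?_)
  beta_reduce
  by_cases hz : z ∈ (extChartAt (𝓡 (k + 1)) j).target
  · -- On the zero set of `μ` both sides vanish.
    by_cases hg : μ.chartFun j z = 0
    · have hfd : fderiv ℝ (primitive o μ h α φ j s) z = 0 := by
        by_cases hzL : z ∈ L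
        · exact (hR s hsR z hzL).2 hg
        · rw [(hPoff z hzL).fderiv_eq, fderiv_fun_const]
          rfl
      have hs0 : s / 2 ≠ 0 := by
        intro h0
        have : s = 0 := by simpa using h0
        rw [this, Complex.zero_re] at hs2
        linarith
      rw [extDeriv, hfd, hg,
        Complex.ofReal_zero, Complex.zero_cpow hs0, zero_mul]
      exact (congrArg (fun a : Euc (k + 1) [⋀^Fin (k + 1)]→L[ℝ] ℂ => a (stdFrame (k + 1)))
        (map_zero (ContinuousAlternatingMap.alternatizeUncurryFinCLM ℝ (Euc (k + 1)) ℂ))).symm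
    · exact (extDeriv_primitive o μ h h' h'' α φ j hs2 hz hg).symm
  · have hzL : z ∉ L := fun h => hz (hLt h)
    rw [(hPoff z hzL).extDeriv_eq, extDeriv, fderiv_fun_const]
    simp only [chartCoeff, indicator_of_notMem hz, mul_zero, add_zero]
    exact (congrArg (fun a : Euc (k + 1) [⋀^Fin (k + 1)]→L[ℝ] ℂ => a (stdFrame (k + 1)))
      (map_zero (ContinuousAlternatingMap.alternatizeUncurryFinCLM ℝ (Euc (k + 1)) ℂ))).symm

variable [SigmaCompactSpace X]

/-- The residue of `d(μ ^ (s / 2) α ∧ φ)` vanishes for a test form supported in a chart: the term in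
which `μ ^ (s / 2)` is differentiated carries a factor `s`, which cancels the pole at `0`. -/
theorem I0_stokes_of_chart (o : ManifoldOrientation (k + 1) X) (μ : MorseBott Y) (h : p + q = k)
    (h' : p + 1 + q = k + 1) (h'' : p + (q + 1) = k + 1)
    (α : singularForms μ p) (φ : TestForm (k + 1) X q) (j : X)
    (hφj : formSupport φ.form ⊆ (extChartAt (𝓡 (k + 1)) j).source) :
    I0 o μ.toFun (wedge h' (singularD μ p α).1 φ.form) +
      (-1) ^ p * I0 o μ.toFun (wedge h'' α.1 (testD (k + 1) X q φ).form) = 0 := by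
  have hd : formSupport (testD (k + 1) X q φ).form ⊆ formSupport φ.form :=
    formSupport_formDeriv_subset φ.form
  obtain ⟨R1, hR1⟩ := zetaFun_wedge_eq_integral o μ h' (singularD μ p α) φ φ.2.2 Subset.rfl j hφj
  obtain ⟨R2, hR2⟩ := zetaFun_wedge_eq_integral o μ h'' α (testD (k + 1) X q φ) φ.2.2 hd j hφj
  obtain ⟨R3, hR3⟩ := zetaFun_wedge_eq_integral o μ h' (logWedge μ α) φ φ.2.2 Subset.rfl j hφj
  obtain ⟨R4, hR4⟩ := integral_stokes o μ h h' h'' α φ j hφj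
  have h1 := (hasSimpleResidue_I0 o μ h' (singularD μ p α) φ).1
  have h2 := (hasSimpleResidue_I0 o μ h'' α (testD (k + 1) X q φ)).1
  have h3 := (hasSimpleResidue_I0 o μ h' (logWedge μ α) φ).1
  -- The integral of `d(μ ^ (s / 2) α ∧ φ)` vanishes; its last term has no residue at `0`.
  have h4 := (h1.add (h2.const_mul ((-1) ^ p))).add (h3.id_mul.const_mul (1 / 2))
  rw [mul_zero, add_zero] at h4
  refine h4.unique (hasSimpleResidue_zero.congr (R := max (max R1 R2) (max R3 R4)) fun s hs => ?_)
  simp only [max_lt_iff] at hs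
  obtain ⟨i1, e1⟩ := hR1 s hs.1.1
  obtain ⟨i2, e2⟩ := hR2 s hs.1.2
  obtain ⟨i3, e3⟩ := hR3 s hs.2.1
  simp only [Pi.zero_apply, Pi.add_apply]
  have i2' := i2.const_mul ((-1 : ℂ) ^ p)
  have i12 := i1.add i2'
  rw [e1, e2, e3, ← mul_assoc, ← integral_const_mul, ← integral_add i1 i2']
  refine Eq.symm ((congrArg _ (integral_const_mul _ _).symm).trans
    ((integral_add i12 (i3.const_mul _)).symm.trans ?_))
  rw [← hR4 s hs.2.2]
  refine integral_congr_ae (Eventually.of_forall fun z => ?_)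
  simp only [Pi.add_apply]
  rw [show (testD (k + 1) X q φ).form = formDeriv φ.form from rfl]
  ring

end Stokes

end ResidueCurrents

end

noncomputable section

namespace ResidueCurrents

/-! ### Residue currents -/

section ResidueCurrent

variable {n m p q : ℕ} {X : Type u} [TopologicalSpace X] [ChartedSpace (Euc n) X] [T2Space X]

theorem formSupport_smul_subset (φ : TestForm n X q) (a : ℂ) :
    formSupport (a • φ).form ⊆ formSupport φ.form :=
  closure_mono fun x hx h0 => hx (by
    change a • φ.form x = 0
    rw [show φ.form x = 0 from h0]
    exact smul_zero (A := TangentSpace (𝓡 n) x [⋀^Fin q]→L[ℝ] ℂ) a)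

theorem norm_iteratedFDeriv_chartRep_smul (φ : TestForm n X q) (a : ℂ) (c : X) (i : ℕ) {z : Euc n}
    (hz : z ∈ (extChartAt (𝓡 n) c).target) :
    ‖iteratedFDeriv ℝ i (chartRep (a • φ).form c) z‖ =
      ‖a‖ * ‖iteratedFDeriv ℝ i (chartRep φ.form c) z‖ := by
  change ‖iteratedFDeriv ℝ i (a • chartRep φ.form c) z‖ = _
  rw [iteratedFDeriv_const_smul_apply
    ((φ.contDiffAt_chartRep hz).of_le (by exact_mod_cast (le_top : (i : ℕ∞) ≤ ⊤))), norm_smul]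

variable [IsManifold (𝓡 n) ∞ X]

/-- The product of a test form with a smooth real function. -/
def mulTest {f : X → ℝ} (hf : ContMDiff (𝓡 n) 𝓘(ℝ) ∞ f) (φ : TestForm n X q) : TestForm n X q :=
  ⟨fun x => f x • φ.form x, fun x => SmoothFormAt.funSmul hf (φ.2.1 x),
    φ.2.2.of_isClosed_subset isClosed_closure (closure_mono fun x hx h0 => hx (by
      change f x • φ.form x = 0
      rw [show φ.form x = 0 from h0]
      exact smul_zero (A := TangentSpace (𝓡 n) x [⋀^Fin q]→L[ℝ] ℂ) (f x)))⟩

theorem formSupport_mulTest_subset {f : X → ℝ} (hf : ContMDiff (𝓡 n) 𝓘(ℝ) ∞ f)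
    (φ : TestForm n X q) : formSupport (mulTest hf φ).form ⊆ tsupport f :=
  closure_mono fun x hx h0 => hx (by
    change f x • φ.form x = 0
    rw [h0]
    exact zero_smul ℝ (A := TangentSpace (𝓡 n) x [⋀^Fin q]→L[ℝ] ℂ) _)

variable {Y : ClosedSubmanifold n m X} [SigmaCompactSpace X]

theorem sum_mulTest_chartPartition (φ : TestForm n X q) :
    ∑ j ∈ chartsOn (n := n) φ.2.2, mulTest (chartPartition n X j).contMDiff φ = φ := by
  refine Subtype.ext (funext fun x => ?_)
  have h1 := map_sum (testForms n X q).subtype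
    (fun j => mulTest (chartPartition n X j).contMDiff φ) (chartsOn (n := n) φ.2.2)
  refine (congrFun h1 x).trans ?_
  rw [Finset.sum_apply]
  change ∑ j ∈ chartsOn (n := n) φ.2.2, chartPartition n X j x • φ.form x = φ.form x
  rw [← Finset.sum_smul]
  by_cases hx : x ∈ formSupport φ.form
  · rw [sum_chartPartition_eq_one φ.2.2 hx]
    exact one_smul ℝ (φ.form x)
  · rw [φ.eq_zero_of_notMem Subset.rfl hx]
    exact smul_zero (A := TangentSpace (𝓡 n) x [⋀^Fin q]→L[ℝ] ℂ) _

/-- The linear form `φ ↦ I₀(μ, α ∧ φ)` on test forms. -/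
def residueLin (o : ManifoldOrientation n X) (μ : MorseBott Y) (h : p + q = n)
    (α : singularForms μ p) : TestForm n X q →ₗ[ℂ] ℂ where
  toFun φ := I0 o μ.toFun (wedge h α.1 φ.form)
  map_add' φ ψ := by
    have h1 := I0_add_smul_right o μ h α φ ψ 1
    rwa [one_smul, one_mul] at h1
  map_smul' a φ := by
    have h0 := I0_add_smul_right o μ h α (0 : TestForm n X q) 0 1
    rw [one_smul, one_mul, add_zero, left_eq_add] at h0
    have h1 := I0_add_smul_right o μ h α 0 φ a
    rwa [h0, zero_add, zero_add] at h1

/-- A seminorm on test forms is admissible if it is bounded on each sequence of test forms with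
supports in a compact set whose derivatives are bounded. Otherwise suitable multiples of test
forms violating the required estimates would make up an unbounded sequence. -/
theorem isAdmissible_of_bounded (P : Seminorm ℂ (TestForm n X q))
    (hbdd : ∀ (K : Set X) (hK : IsCompact K) (ψ : ℕ → TestForm n X q),
      (∀ k, formSupport (ψ k).form ⊆ K) →
      (∀ c ∈ chartsOn (n := n) hK, ∀ i : ℕ, ∃ C : ℝ, ∀ k, ∀ z ∈ chartSet n K c,
        ‖iteratedFDeriv ℝ i (chartRep (ψ k).form c) z‖ ≤ C) → ∃ C : ℝ, ∀ k, P (ψ k) ≤ C) :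
    IsAdmissible P := by
  intro K hK
  by_contra hcon
  -- The `k`-th estimate that fails involves the derivatives of order at most `k` in all charts.
  have key : ∀ k : ℕ, ∃ φ : TestForm n X q, formSupport φ.form ⊆ K ∧
      k * ∑ x ∈ chartsOn (n := n) hK ×ˢ Finset.range (k + 1),
        chartSeminorm x.1 (chartSet n K x.1) x.2 φ < P φ := by
    intro k
    by_contra hk
    push Not at hk
    set T := chartsOn (n := n) hK ×ˢ Finset.range (k + 1)
    refine hcon ⟨T.card, fun i => (T.equivFin.symm i).1.1,
      fun i => chartSet n K (T.equivFin.symm i).1.1, fun i => (T.equivFin.symm i).1.2, k,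
      k.cast_nonneg, fun i => ⟨isCompact_chartSet hK _, chartSet_subset K _⟩, fun φ hφ => ?_⟩
    rw [Equiv.sum_comp T.equivFin.symm
      fun x : T => chartSeminorm x.1.1 (chartSet n K x.1.1) x.1.2 φ,
      Finset.sum_coe_sort T fun x => chartSeminorm x.1 (chartSet n K x.1) x.2 φ]
    exact hk φ hφ
  choose φ hφK hφ using key
  have hpos : ∀ k, 0 < P (φ k) := fun k => (mul_nonneg k.cast_nonneg
    (Finset.sum_nonneg fun x _ => chartSeminorm_nonneg _ _ _ _)).trans_lt (hφ k)
  have hψb : ∀ c ∈ chartsOn (n := n) hK, ∀ i k : ℕ, i ≤ k → ∀ z ∈ chartSet n K c,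
      k * ‖iteratedFDeriv ℝ i (chartRep (φ k).form c) z‖ ≤ P (φ k) := by
    intro c hc i k hik z hz
    obtain ⟨C, hC⟩ := (φ k).exists_bound c (isCompact_chartSet hK c) (chartSet_subset K c) i
    have h1 : ‖iteratedFDeriv ℝ i (chartRep (φ k).form c) z‖ ≤
        chartSeminorm c (chartSet n K c) i (φ k) :=
      le_ciSup (f := fun z : chartSet n K c => ‖iteratedFDeriv ℝ i (chartRep (φ k).form c) z‖)
        ⟨C, by rintro _ ⟨y, rfl⟩; exact hC y y.2⟩ ⟨z, hz⟩
    have hmem : (c, i) ∈ chartsOn (n := n) hK ×ˢ Finset.range (k + 1) :=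
      Finset.mem_product.2 ⟨hc, Finset.mem_range.2 (Nat.lt_succ_of_le hik)⟩
    have hF : ∀ x ∈ chartsOn (n := n) hK ×ˢ Finset.range (k + 1),
        0 ≤ chartSeminorm x.1 (chartSet n K x.1) x.2 (φ k) :=
      fun x _ => chartSeminorm_nonneg _ _ _ _
    have h2 := Finset.single_le_sum hF hmem
    exact (mul_le_mul_of_nonneg_left (h1.trans h2) k.cast_nonneg).trans (hφ k).le
  have hnorm : ∀ k : ℕ, ‖((k / P (φ k) : ℝ) : ℂ)‖ = k / P (φ k) := fun k => by
    rw [Complex.norm_real, Real.norm_of_nonneg (div_nonneg k.cast_nonneg (hpos k).le)]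
  -- Normalization: `P (ψ k) = k`, while the derivatives of order at most `k` are bounded by `1`.
  obtain ⟨ψ, hψ⟩ : ∃ ψ : ℕ → TestForm n X q, ∀ k, ψ k = ((k / P (φ k) : ℝ) : ℂ) • φ k :=
    ⟨_, fun _ => rfl⟩
  have hψK : ∀ k, formSupport (ψ k).form ⊆ K := fun k => by
    rw [hψ]
    exact (formSupport_smul_subset _ _).trans (hφK k)
  have hψ1 : ∀ c ∈ chartsOn (n := n) hK, ∀ i k : ℕ, i ≤ k → ∀ z ∈ chartSet n K c,
      ‖iteratedFDeriv ℝ i (chartRep (ψ k).form c) z‖ ≤ 1 := by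
    intro c hc i k hik z hz
    rw [hψ, norm_iteratedFDeriv_chartRep_smul _ _ _ _ (chartSet_subset K c hz), hnorm,
      div_mul_eq_mul_div, div_le_one (hpos k)]
    exact hψb c hc i k hik z hz
  obtain ⟨C, hC⟩ := hbdd K hK ψ hψK fun c hc i => by
    have hex : ∀ k, ∃ B : ℝ, ∀ z ∈ chartSet n K c,
        ‖iteratedFDeriv ℝ i (chartRep (ψ k).form c) z‖ ≤ B := fun k =>
      (ψ k).exists_bound c (isCompact_chartSet hK c) (chartSet_subset K c) i
    choose B hB using hex
    refine ⟨1 + ∑ k ∈ Finset.range i, |B k|, fun k z hz => ?_⟩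
    have hsum : 0 ≤ ∑ k ∈ Finset.range i, |B k| := Finset.sum_nonneg fun _ _ => abs_nonneg _
    rcases le_or_gt i k with hik | hik
    · linarith [hψ1 c hc i k hik z hz]
    · have h1 := Finset.single_le_sum (f := fun k => |B k|) (fun _ _ => abs_nonneg _)
        (Finset.mem_range.2 hik)
      linarith [hB k z hz, le_abs_self (B k)]
  obtain ⟨k, hk⟩ := exists_nat_gt C
  have h3 := hC k
  rw [hψ, map_smul_eq_mul, hnorm, div_mul_cancel₀ _ (hpos k).ne'] at h3
  linarith

/-- The absolute value of the residue is a continuous seminorm on test forms. -/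
theorem isAdmissible_residueLin (o : ManifoldOrientation n X) (μ : MorseBott Y) (h : p + q = n)
    (α : singularForms μ p) :
    IsAdmissible ((normSeminorm ℂ ℂ).comp (residueLin o μ h α)) := by
  refine isAdmissible_of_bounded _ fun K hK ψ hψK hψb => ?_
  obtain ⟨r, ⟨C, hC⟩, hr, -⟩ := exists_bounded_residue o μ h α ψ hK hψK hψb
  refine ⟨C, fun k => ?_⟩
  have h1 : r k = residueLin o μ h α (ψ k) := (hr k).unique (hasSimpleResidue_I0 o μ h α (ψ k)).1
  have h2 := hC k
  rw [h1] at h2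
  exact h2

/-- The continuous linear form `φ ↦ I₀(μ, α ∧ φ)` on test forms. -/
def residueCLM (o : ManifoldOrientation n X) (μ : MorseBott Y) (h : p + q = n)
    (α : singularForms μ p) : TestForm n X q →L[ℂ] ℂ where
  toLinearMap := residueLin o μ h α
  cont := (norm_withSeminorms ℂ ℂ).continuous_of_continuous_comp (residueLin o μ h α) fun _ =>
    withSeminorms_testForm.continuous_seminorm ⟨_, isAdmissible_residueLin o μ h α⟩

/-- The residue current `I₀(μ, α ∧ —)`, as a linear function of the form `α`. -/
def residueCurrent (o : ManifoldOrientation n X) (μ : MorseBott Y) (p : ℕ) :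
    singularForms μ p →ₗ[ℂ] Current n X p where
  toFun α := fun q => residueCLM o μ q.2 α
  map_add' α β := by
    funext q
    ext φ
    have h1 := I0_add_smul_left o μ q.2 α β φ 1
    rwa [one_smul, one_mul] at h1
  map_smul' a α := by
    funext q
    ext φ
    have h0 := I0_add_smul_left o μ q.2 (0 : singularForms μ p) 0 φ 1
    rw [one_smul, one_mul, add_zero, left_eq_add] at h0
    have h1 := I0_add_smul_left o μ q.2 0 α φ a
    rwa [h0, zero_add, zero_add] at h1

theorem supportedOn_residueCurrent (o : ManifoldOrientation n X) (μ : MorseBott Y)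
    (α : singularForms μ p) : SupportedOn (residueCurrent o μ p α) Y.carrier := fun q φ hφ =>
  (hasSimpleResidue_I0 o μ q.2 α φ).2 (subset_compl_iff_disjoint_right.1 hφ)

/-- The residue of `d(μ ^ (s / 2) α ∧ φ)` vanishes: a partition of unity reduces this to test forms
supported in a chart. -/
theorem I0_stokes (o : ManifoldOrientation n X) (μ : MorseBott Y) (h' : p + 1 + q = n)
    (h'' : p + (q + 1) = n) (α : singularForms μ p) (φ : TestForm n X q) :
    I0 o μ.toFun (wedge h' (singularD μ p α).1 φ.form) +
      (-1) ^ p * I0 o μ.toFun (wedge h'' α.1 (testD n X q φ).form) = 0 := by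
  obtain rfl : n = p + q + 1 := by omega
  set Λ : TestForm (p + q + 1) X q →ₗ[ℂ] ℂ := residueLin o μ h' (singularD μ p α) +
    (-1 : ℂ) ^ p • (residueLin o μ h'' α ∘ₗ testDLin (p + q + 1) X q) with hΛ
  change Λ φ = 0
  rw [← sum_mulTest_chartPartition φ, map_sum]
  refine Finset.sum_eq_zero fun j _ => I0_stokes_of_chart o μ rfl h' h'' α _ j ?_
  exact (formSupport_mulTest_subset _ φ).trans (chartPartition_tsupport_subset _ X j)

/-- The residue is compatible with the differentials: this is Stokes' theorem for the residues, the
sign being that of the differential of currents. -/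
theorem currentD_residueCurrent (o : ManifoldOrientation n X) (μ : MorseBott Y) (p : ℕ)
    (α : singularForms μ p) :
    currentD n X p (residueCurrent o μ p α) = residueCurrent o μ (p + 1) (singularD μ p α) := by
  funext q
  ext φ
  have h1 := I0_stokes o μ q.2 (by have := q.2; omega) α φ
  change (-1 : ℂ) ^ (p + 1) * I0 o μ.toFun (wedge _ α.1 (testD n X q φ).form) =
    I0 o μ.toFun (wedge q.2 (singularD μ p α).1 φ.form)
  linear_combination -h1

/-- The morphism of complexes `α ↦ I₀(μ, α ∧ —)`. -/
def residueMorphism (o : ManifoldOrientation n X) (μ : MorseBott Y) :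
    singularComplex μ ⟶ currentComplex n X :=
  CochainComplex.ofHom (fun p => ModuleCat.ofHom (residueCurrent o μ p)) fun p => by
    have h1 : (currentComplex n X).d p (p + 1) = ModuleCat.ofHom (currentD n X p) :=
      CochainComplex.of_d (fun p => ModuleCat.of ℂ (Current n X p))
        (fun p => ModuleCat.ofHom (currentD n X p)) p
    have h2 : (singularComplex μ).d p (p + 1) = ModuleCat.ofHom (singularD μ p) :=
      CochainComplex.of_d (fun p => ModuleCat.of ℂ (singularForms μ p))
        (fun p => ModuleCat.ofHom (singularD μ p)) p
    rw [h1, h2]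
    ext α
    exact currentD_residueCurrent o μ p α

end ResidueCurrent

end ResidueCurrents

end

theorem mainTheorem3 (n m : ℕ) (X : Type u) [TopologicalSpace X] [T2Space X] [SigmaCompactSpace X]
    [ChartedSpace (Euc n) X] [IsManifold (𝓡 n) ∞ X] (o : ManifoldOrientation n X)
    (Y : ClosedSubmanifold n m X) (μ : MorseBott Y) :
    (∀ (p q : ℕ) (h : p + q = n) (α : singularForms μ p) (φ : TestForm n X q),
      ∃ Z : ℂ → ℂ, IsZetaContinuation o μ.toFun (wedge h α.1 φ.form) Z) ∧
    ∃ F : singularComplex μ ⟶ currentComplex n X,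
      ∀ (p : ℕ) (α : singularForms μ p), ∃ κ : Current n X p, (F.f p).hom α = κ ∧
        (∀ (q : ℕ) (h : p + q = n) (φ : TestForm n X q),
          κ ⟨q, h⟩ φ = I0 o μ.toFun (wedge h α.1 φ.form)) ∧
        SupportedOn κ Y.carrier :=
  ⟨fun _ _ h α φ => (I0_eq_of_hasSimpleResidue (hasSimpleResidue_I0 o μ h α φ).1).1,
    residueMorphism o μ, fun p α => ⟨residueCurrent o μ p α, rfl, fun _ _ _ => rfl,
      supportedOn_residueCurrent o μ α⟩⟩
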